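/- \textbf{Setting.} Fix a first-order signature: countably infinitely many term variables, function symbols (each of some arity $\ge 0$), and predicate symbols (each of some arity $\ge 0$) with an arity-preserving negation $P\mapsto\overline P$ satisfying $\overline{\overline P}=P$ and $\overline P\ne P$. Formulas are built from atoms $Pt_1\ldots t_n$ by $\otimes$, $\parr$, $\forall x$, $\exists x$, and are identified up to renaming of bound variables; negation extends to formulas by De Morgan duality ($\overline{A\otimes B}=\overline A\parr\overline B$, $\overline{\exists x A}=\forall x\overline A$, and dually). A formula is identified with its parse tree, with edges directed towards the root. A \emph{sequent} is a finite disjoint union of formulas. A \emph{cut} $\{A\,|\,\overline A\}$ is a disjoint union of two dual formulas, joined at their roots; all free variables of $A$ count as bound in the cut. A \emph{cut sequent} is a finite disjoint union of formulas and cuts. \textbf{Linkings.} A \emph{link} on a cut sequent is a pair of leaves (atom occurrences) whose predicate symbols are dual. A \emph{linking} is a set of disjoint links whose union contains every leaf. \textbf{Correctness on cut-free sequents.} Let $\theta$ be a linking on a sequent $\Gamma$, with bound variables renamed to be distinct from one another and from the free variables. A variable bound by $\exists$ (resp. $\forall$) is existential (resp. universal); a quantifier is vacuous if it binds no variable occurrence.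 A \emph{unifier} of $\theta$ assigns to the non-vacuous existential variables terms (in free and universal variables) which make the term sequences at the two ends of every link equal; it is \emph{most general} if every unifier arises from it by substituting terms for free variables that do not occur free in $\Gamma$. The \emph{graph} of $\theta$ is the directed forest $\Gamma$ together with an undirected edge between the two leaves of each link and a directed edge (leap) from $\exists x$ to $\forall y$ whenever a most general unifier assigns to $x$ a term containing $y$. A \emph{switching} is obtained by deleting all but one of the edges into each $\parr$ and each $\forall$ vertex and forgetting directions. $\theta$ is \emph{correct} if it has a unifier and all its switchings are trees (connected and acyclic, parallel edges counting as a cycle). \textbf{Unification nets.} The \emph{encoding} of a cut sequent $\Delta$ replaces each cut $\{A\,|\,\overline A\}$ by $\exists x_1\ldots\exists x_n(A\otimes\overline A)$, where $x_1,\ldots,x_n$ are the free variables of $A$; it has the same leaves as $\Delta$. A \emph{unification net} on $\Delta$ is a linking on $\Delta$ which is correct as a linking on the encoding of $\Delta$. \textbf{The calculus.} The sequent calculus FOMLL$^+$ derives cut sequents by the rules $$\frac{}{P\vec t,\ \overline P\vec t}\qquad \frac{\Gamma,A,B}{\Gamma,A\parr B}\qquad \frac{\Gamma,A\quad B,\Delta}{\Gamma,A\otimes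 B,\Delta}\qquad \frac{\Gamma,A\{x\leftarrow t\}}{\Gamma,\exists xA}\qquad \frac{\Gamma,A}{\Gamma,\forall xA}\ (x\text{ not free in }\Gamma)\qquad \frac{\Gamma,A\sigma\quad \overline A\sigma,\Delta}{\Gamma,\{A\,|\,\overline A\},\Delta}$$ where $\Gamma,\Delta$ are cut sequents and $\sigma$ is any substitution of terms for the free variables of $A$. Each rule tracks the leaves of its hypotheses to leaves of its conclusion in the evident way. The \emph{translation} of a proof of $\Delta$ is the set of pairs of leaves of $\Delta$ obtained by tracking the two atoms of each axiom down the proof to its conclusion. \textbf{Theorem (surjectivity).} The translation from FOMLL$^+$ proofs to linkings is a surjection onto unification nets. That is, for every cut sequent $\Delta$, the translation of every FOMLL$^+$ proof of $\Delta$ is a unification net on $\Delta$, and every unification net on $\Delta$ is the translation of some FOMLL$^+$ proof of $\Delta$. -/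

import Mathlib

universe u v

namespace FOMLL

/-- An arity-preserving negation on the predicate symbols of the signature `L`, with
`P̿ = P` and `P̄ ≠ P`. -/
structure Duality (L : FirstOrder.Language.{u, v}) where
  dual : ∀ {n : ℕ}, L.Relations n → L.Relations n
  dual_dual : ∀ {n : ℕ} (P : L.Relations n), dual (dual P) = P
  dual_ne : ∀ {n : ℕ} (P : L.Relations n), dual P ≠ P

/-- A predicate symbol together with its arity. -/
abbrev PredSym (L : FirstOrder.Language.{u, v}) : Type v := Σ n : ℕ, L.Relations n

/-- Duality of predicate symbols. -/
def PredSym.IsDual {L : FirstOrder.Language.{u, v}} (D : Duality L) (p q : PredSym L) : Prop :=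
  q = ⟨p.1, D.dual p.2⟩

open Classical in
/-- The variables occurring in a term. -/
noncomputable def termVars {L : FirstOrder.Language.{u, v}} {X : Type} (t : L.Term X) : Finset X :=
  t.varFinset

/-- An atom `P t₁ … tₙ` with term variables in `X`. -/
structure Atom (L : FirstOrder.Language.{u, v}) (X : Type) where
  arity : ℕ
  pred : L.Relations arity
  args : Fin arity → L.Term X

namespace Atom

variable {L : FirstOrder.Language.{u, v}} {X Y : Type}

/-- Simultaneous substitution. -/
def subst (a : Atom L X) (σ : X → L.Term Y) : Atom L Y :=
  ⟨a.arity, a.pred, fun i => (a.args i).subst σ⟩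

/-- Renaming of variables. -/
def relabel (a : Atom L X) (g : X → Y) : Atom L Y :=
  ⟨a.arity, a.pred, fun i => (a.args i).relabel g⟩

def neg (D : Duality L) (a : Atom L X) : Atom L X :=
  ⟨a.arity, D.dual a.pred, a.args⟩

/-- The sequence of terms `t₁, …, tₙ` of an atom `P t₁ … tₙ`. -/
def termSeq (a : Atom L X) : List (L.Term X) := List.ofFn a.args

open Classical in
/-- The variables occurring in an atom. -/
noncomputable def vars (a : Atom L X) : Finset X :=
  Finset.univ.biUnion fun i => termVars (a.args i)

end Atom

/-- Formulas whose free variables are in `X`, up to renaming of bound variables: in the body of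
a quantifier, `none` is the variable bound by the quantifier and `some x` is the variable `x`
of the surrounding formula. -/
inductive Formula (L : FirstOrder.Language.{u, v}) : Type → Type (max 1 u v)
  | atom {X : Type} (a : Atom L X) : Formula L X
  | tensor {X : Type} (A B : Formula L X) : Formula L X
  | par {X : Type} (A B : Formula L X) : Formula L X
  | all {X : Type} (A : Formula L (Option X)) : Formula L X
  | ex {X : Type} (A : Formula L (Option X)) : Formula L X

/-- The kinds of vertices in the parse tree of a formula. -/
inductive Kind
  | atom | tensor | par | all | ex

/-- A substitution carried under a quantifier. -/
def liftSubst {L : FirstOrder.Language.{u, v}} {X Y : Type} (σ : X → L.Term Y) :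
    Option X → L.Term (Option Y)
  | none => .var none
  | some x => (σ x).relabel some

namespace Formula

variable {L : FirstOrder.Language.{u, v}}

/-- Negation of formulas. -/
def neg (D : Duality L) : {X : Type} → Formula L X → Formula L X
  | _, atom a => atom (a.neg D)
  | _, tensor A B => par (A.neg D) (B.neg D)
  | _, par A B => tensor (A.neg D) (B.neg D)
  | _, all A => ex (A.neg D)
  | _, ex A => all (A.neg D)

/-- Simultaneous (capture-avoiding) substitution of terms for the free variables. -/
def subst : {X Y : Type} → Formula L X → (X → L.Term Y) → Formula L Y
  | _, _, atom a, σ => atom (a.subst σ)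
  | _, _, tensor A B, σ => tensor (A.subst σ) (B.subst σ)
  | _, _, par A B, σ => par (A.subst σ) (B.subst σ)
  | _, _, all A, σ => all (A.subst (liftSubst σ))
  | _, _, ex A, σ => ex (A.subst (liftSubst σ))

/-- For the body `A` of a quantified formula `∀x A` or `∃x A`, the formula `A{x ← t}`. -/
def inst {X : Type} (A : Formula L (Option X)) (t : L.Term X) : Formula L X :=
  A.subst fun o => o.elim t FirstOrder.Language.Term.var

/-- The body of the quantified formula `∀x A` or `∃x A`, for a free variable `x` of `A`. -/
def bind (x : ℕ) (A : Formula L ℕ) : Formula L (Option ℕ) :=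
  A.subst fun y => if y = x then .var none else .var (some y)

/-- `∃x₁ … ∃xₙ A`. -/
def exs : List ℕ → Formula L ℕ → Formula L ℕ
  | [], A => A
  | x :: xs, A => ex (bind x (exs xs A))

/-- The free variables of a formula. -/
noncomputable def freeVars : {X : Type} → Formula L X → Finset X
  | _, atom a => a.vars
  | _, tensor A B => by classical exact A.freeVars ∪ B.freeVars
  | _, par A B => by classical exact A.freeVars ∪ B.freeVars
  | _, all A => Finset.eraseNone A.freeVars
  | _, ex A => Finset.eraseNone A.freeVars

/-- The leaves (atom occurrences) of a formula. -/
def Leaf : {X : Type} → Formula L X → Type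
  | _, atom _ => Unit
  | _, tensor A B => A.Leaf ⊕ B.Leaf
  | _, par A B => A.Leaf ⊕ B.Leaf
  | _, all A => A.Leaf
  | _, ex A => A.Leaf

/-- The vertices of the parse tree of a formula; `none` is the root vertex of a compound
formula. -/
def Vertex : {X : Type} → Formula L X → Type
  | _, atom _ => Unit
  | _, tensor A B => Option (A.Vertex ⊕ B.Vertex)
  | _, par A B => Option (A.Vertex ⊕ B.Vertex)
  | _, all A => Option A.Vertex
  | _, ex A => Option A.Vertex

/-- A leaf as a vertex of the parse tree. -/
def leafVertex : {X : Type} → (A : Formula L X) → A.Leaf → A.Vertex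
  | _, atom _, _ => ()
  | _, tensor A B, l => match (l : A.Leaf ⊕ B.Leaf) with
    | .inl l => some (.inl (A.leafVertex l))
    | .inr l => some (.inr (B.leafVertex l))
  | _, par A B, l => match (l : A.Leaf ⊕ B.Leaf) with
    | .inl l => some (.inl (A.leafVertex l))
    | .inr l => some (.inr (B.leafVertex l))
  | _, all A, l => some (A.leafVertex l)
  | _, ex A, l => some (A.leafVertex l)

/-- The label of a vertex of the parse tree. -/
def kind : {X : Type} → (A : Formula L X) → A.Vertex → Kind
  | _, atom _, _ => .atom
  | _, tensor A B, w => match (w : Option (A.Vertex ⊕ B.Vertex)) with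
    | none => .tensor
    | some (.inl v) => A.kind v
    | some (.inr v) => B.kind v
  | _, par A B, w => match (w : Option (A.Vertex ⊕ B.Vertex)) with
    | none => .par
    | some (.inl v) => A.kind v
    | some (.inr v) => B.kind v
  | _, all A, w => match (w : Option A.Vertex) with
    | none => .all
    | some v => A.kind v
  | _, ex A, w => match (w : Option A.Vertex) with
    | none => .ex
    | some v => A.kind v

/-- The parent of a vertex of the parse tree, if it has one: the vertex at the end of the unique
edge which leaves it. (If `v` is the root of `A`, then `A.parent v = none`, and the parent of `v`
in a compound formula with immediate subformula `A` is the root `none` of the latter.) -/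
def parent : {X : Type} → (A : Formula L X) → A.Vertex → Option A.Vertex
  | _, atom _, _ => none
  | _, tensor A B, w => match (w : Option (A.Vertex ⊕ B.Vertex)) with
    | none => none
    | some (.inl v) => some ((A.parent v).map Sum.inl)
    | some (.inr v) => some ((B.parent v).map Sum.inr)
  | _, par A B, w => match (w : Option (A.Vertex ⊕ B.Vertex)) with
    | none => none
    | some (.inl v) => some ((A.parent v).map Sum.inl)
    | some (.inr v) => some ((B.parent v).map Sum.inr)
  | _, all A, w => match (w : Option A.Vertex) with
    | none => none
    | some v => some (A.parent v)
  | _, ex A, w => match (w : Option A.Vertex) with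
    | none => none
    | some v => some (A.parent v)

/-- The predicate symbol of a leaf. -/
def leafPred : {X : Type} → (A : Formula L X) → A.Leaf → PredSym L
  | _, atom a, _ => ⟨a.arity, a.pred⟩
  | _, tensor A B, l => match (l : A.Leaf ⊕ B.Leaf) with
    | .inl l => A.leafPred l
    | .inr l => B.leafPred l
  | _, par A B, l => match (l : A.Leaf ⊕ B.Leaf) with
    | .inl l => A.leafPred l
    | .inr l => B.leafPred l
  | _, all A, l => A.leafPred l
  | _, ex A, l => A.leafPred l

/-- How a variable of the body of a quantified formula with root `none` is named in the clean
form of that formula. -/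
def underQuantifier {X V : Type} : Option X ⊕ V → X ⊕ Option V
  | .inl none => .inr none
  | .inl (some x) => .inl x
  | .inr v => .inr (some v)

/-- The atom at a leaf in the clean form of the formula in which every bound variable is named by
the quantifier vertex which binds it: `Sum.inl x` is the free variable `x`, and `Sum.inr v` is
the variable bound by the quantifier at `v`. -/
def leafAtom : {X : Type} → (A : Formula L X) → A.Leaf → Atom L (X ⊕ A.Vertex)
  | _, atom a, _ => a.relabel Sum.inl
  | _, tensor A B, l => match (l : A.Leaf ⊕ B.Leaf) with
    | .inl l => (A.leafAtom l).relabel (Sum.map id fun w => some (.inl w))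
    | .inr l => (B.leafAtom l).relabel (Sum.map id fun w => some (.inr w))
  | _, par A B, l => match (l : A.Leaf ⊕ B.Leaf) with
    | .inl l => (A.leafAtom l).relabel (Sum.map id fun w => some (.inl w))
    | .inr l => (B.leafAtom l).relabel (Sum.map id fun w => some (.inr w))
  | _, all A, l => (A.leafAtom l).relabel underQuantifier
  | _, ex A, l => (A.leafAtom l).relabel underQuantifier

/-- Substitution does not change the leaves of a formula. -/
def leafSubst : {X Y : Type} → (A : Formula L X) → (σ : X → L.Term Y) →
    (A.subst σ).Leaf ≃ A.Leaf
  | _, _, atom _, _ => Equiv.refl Unit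
  | _, _, tensor A B, σ => Equiv.sumCongr (A.leafSubst σ) (B.leafSubst σ)
  | _, _, par A B, σ => Equiv.sumCongr (A.leafSubst σ) (B.leafSubst σ)
  | _, _, all A, σ => A.leafSubst (liftSubst σ)
  | _, _, ex A, σ => A.leafSubst (liftSubst σ)

/-- The leaves of `∃x₁ … ∃xₙ A` are those of `A`. -/
def leafExs : (xs : List ℕ) → (A : Formula L ℕ) → A.Leaf ≃ (exs xs A).Leaf
  | [], A => Equiv.refl A.Leaf
  | _ :: xs, A => (leafExs xs A).trans (leafSubst (exs xs A) _).symm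

end Formula

/-! ### Cut-free sequents -/

/-- A sequent: a disjoint union (a family) of formulas. -/
abbrev Sequent (L : FirstOrder.Language.{u, v}) (ι : Type) := ι → Formula L ℕ

namespace Sequent

variable {L : FirstOrder.Language.{u, v}} {ι : Type}

abbrev Leaf (Γ : Sequent L ι) : Type := Σ i, (Γ i).Leaf

abbrev Vertex (Γ : Sequent L ι) : Type := Σ i, (Γ i).Vertex

def leafVertex (Γ : Sequent L ι) (l : Γ.Leaf) : Γ.Vertex := ⟨l.1, (Γ l.1).leafVertex l.2⟩

def kind (Γ : Sequent L ι) (w : Γ.Vertex) : Kind := (Γ w.1).kind w.2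

def parent (Γ : Sequent L ι) (w : Γ.Vertex) : Option Γ.Vertex :=
  ((Γ w.1).parent w.2).map fun p => ⟨w.1, p⟩

/-- The atom at a leaf in the clean form of the sequent in which every bound variable is named by
the quantifier vertex which binds it. -/
def leafAtom (Γ : Sequent L ι) (l : Γ.Leaf) : Atom L (ℕ ⊕ Γ.Vertex) :=
  ((Γ l.1).leafAtom l.2).relabel (Sum.map id fun w => ⟨l.1, w⟩)

/-- The vertex `w` is a non-vacuous existential quantifier. -/
def IsEssentialEx (Γ : Sequent L ι) (w : Γ.Vertex) : Prop :=
  Γ.kind w = .ex ∧ ∃ l, Sum.inr w ∈ (Γ.leafAtom l).vars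

/-- `σ` is a unifier: an assignment of terms (in the free and the universal variables) to the
non-vacuous existential variables, extended by the identity to the other bound variables, which
equalizes the term sequences at the ends of every link. -/
structure IsUnifier (Γ : Sequent L ι) (θ : Set (Sym2 Γ.Leaf))
    (σ : Γ.Vertex → L.Term (ℕ ⊕ Γ.Vertex)) : Prop where
  eq_var : ∀ w, ¬ Γ.IsEssentialEx w → σ w = .var (.inr w)
  universal : ∀ w, Γ.IsEssentialEx w → ∀ y, Sum.inr y ∈ termVars (σ w) → Γ.kind y = .all
  equalizes : ∀ l l', s(l, l') ∈ θ →
    ((Γ.leafAtom l).subst (Sum.elim (fun x => .var (Sum.inl x)) σ)).termSeq =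
      ((Γ.leafAtom l').subst (Sum.elim (fun x => .var (Sum.inl x)) σ)).termSeq

/-- `θ` is unifiable. -/
def Unifiable (Γ : Sequent L ι) (θ : Set (Sym2 Γ.Leaf)) : Prop :=
  ∃ σ, Γ.IsUnifier θ σ

/-- `σ` is a most general unifier: every unifier is obtained from it by a substitution of terms
for free variables other than those of the sequent (which, like the universal variables, are
treated as constants). -/
def IsMGU (Γ : Sequent L ι) (θ : Set (Sym2 Γ.Leaf))
    (σ : Γ.Vertex → L.Term (ℕ ⊕ Γ.Vertex)) : Prop :=
  Γ.IsUnifier θ σ ∧ ∀ τ, Γ.IsUnifier θ τ →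
    ∃ ρ : ℕ → L.Term (ℕ ⊕ Γ.Vertex),
      (∀ i, ∀ x ∈ (Γ i).freeVars, ρ x = .var (.inl x)) ∧
      ∀ w, Γ.IsEssentialEx w → τ w = (σ w).subst (Sum.elim ρ fun y => .var (.inr y))

/-- The precedence `x ≺ y` between an existential quantifier `x` and a universal quantifier `y`:
the most general unifier assigns to `x` a term containing `y`. -/
def Precedes (Γ : Sequent L ι) (θ : Set (Sym2 Γ.Leaf)) (x y : Γ.Vertex) : Prop :=
  Γ.kind x = .ex ∧ Γ.kind y = .all ∧ ∃ σ, Γ.IsMGU θ σ ∧ Sum.inr y ∈ termVars (σ x)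

/-- The possible edges of the graph of a linking. -/
inductive Edge (Γ : Sequent L ι)
  /-- the directed edge from the vertex `w` to its parent `p` -/
  | tree (w p : Γ.Vertex)
  /-- the undirected edge between the ends of the link `e` -/
  | link (e : Sym2 Γ.Leaf)
  /-- the leap from the existential quantifier `x` to the universal quantifier `y` -/
  | leap (x y : Γ.Vertex)

namespace Edge

variable {Γ : Sequent L ι}

/-- The end points of an edge. -/
def ends : Γ.Edge → Sym2 Γ.Vertex
  | tree w p => s(w, p)
  | link e => e.map Γ.leafVertex
  | leap x y => s(x, y)

/-- The edge is directed into the vertex `z`. -/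
def Into (z : Γ.Vertex) : Γ.Edge → Prop
  | tree _ p => p = z
  | link _ => False
  | leap _ y => y = z

end Edge

/-- The edges of the graph of a linking. -/
def graph (Γ : Sequent L ι) (θ : Set (Sym2 Γ.Leaf)) : Set Γ.Edge :=
  {e | match e with
    | .tree w p => Γ.parent w = some p
    | .link e => e ∈ θ
    | .leap x y => Γ.Precedes θ x y}

/-- The vertex `z` is a par or a universal quantifier. -/
def IsSwitched (Γ : Sequent L ι) (z : Γ.Vertex) : Prop :=
  Γ.kind z = .par ∨ Γ.kind z = .all

/-- `S` is the edge set of a switching of `θ`: it is obtained from the graph of `θ` by deleting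
all but one edge into each par and each universal quantifier. -/
structure IsSwitching (Γ : Sequent L ι) (θ : Set (Sym2 Γ.Leaf)) (S : Set Γ.Edge) : Prop where
  subset : S ⊆ Γ.graph θ
  keep : ∀ e ∈ Γ.graph θ, (∀ z, Γ.IsSwitched z → ¬ e.Into z) → e ∈ S
  choose : ∀ z, Γ.IsSwitched z → ∃! e, e ∈ S ∧ e.Into z

/-- The undirected (multi)graph with vertices those of `Γ` and edges those in `S` is a tree: it
has no loops and no parallel edges, and is connected and acyclic. -/
def IsTree (Γ : Sequent L ι) (S : Set Γ.Edge) : Prop :=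
  (∀ e ∈ S, ¬ e.ends.IsDiag) ∧ Set.InjOn Edge.ends S ∧
    (SimpleGraph.fromEdgeSet (Edge.ends '' S)).IsTree

/-- Correctness of a linking on a cut-free sequent. -/
def Correct (Γ : Sequent L ι) (θ : Set (Sym2 Γ.Leaf)) : Prop :=
  Γ.Unifiable θ ∧ ∀ S, Γ.IsSwitching θ S → Γ.IsTree S

end Sequent

/-! ### Cut sequents -/

/-- A component of a cut sequent: a formula, or the cut between `A` and its negation. All free
variables of `A` count as bound in the cut. -/
inductive Item (L : FirstOrder.Language.{u, v}) : Type (max 1 u v)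
  | formula (A : Formula L ℕ) : Item L
  | cut (A : Formula L ℕ) : Item L

namespace Item

variable {L : FirstOrder.Language.{u, v}}

/-- The free variables of a component: none, in the case of a cut. -/
noncomputable def freeVars : Item L → Finset ℕ
  | formula A => A.freeVars
  | cut _ => ∅

/-- The leaves of a component. -/
def Leaf (D : Duality L) : Item L → Type
  | formula A => A.Leaf
  | cut A => A.Leaf ⊕ (A.neg D).Leaf

/-- The predicate symbol of a leaf. -/
def leafPred (D : Duality L) : (I : Item L) → I.Leaf D → PredSym L
  | formula A, l => A.leafPred l
  | cut A, Sum.inl l => A.leafPred l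
  | cut A, Sum.inr l => (A.neg D).leafPred l

/-- The encoding of a cut is the existentially closed tensor of its cut formulas. -/
noncomputable def encode (D : Duality L) : Item L → Formula L ℕ
  | formula A => A
  | cut A => Formula.exs (A.freeVars.sort (· ≤ ·)) (.tensor A (A.neg D))

/-- The leaves of a cut are the leaves of its encoding. -/
noncomputable def encodeLeaf (D : Duality L) : (I : Item L) → I.Leaf D ≃ (I.encode D).Leaf
  | formula A => Equiv.refl A.Leaf
  | cut A => Formula.leafExs (A.freeVars.sort (· ≤ ·)) (.tensor A (A.neg D))

end Item

/-- A cut sequent: a disjoint union (a family) of formulas and cuts. -/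
abbrev CutSequent (L : FirstOrder.Language.{u, v}) (ι : Type) := ι → Item L

namespace CutSequent

variable {L : FirstOrder.Language.{u, v}} {ι κ : Type}

abbrev Leaf (D : Duality L) (Δ : CutSequent L ι) : Type := Σ i, (Δ i).Leaf D

/-- A linking: a set of disjoint links, i.e. pairs of leaves with dual predicate symbols, whose
union contains every leaf. -/
structure IsLinking (D : Duality L) (Δ : CutSequent L ι) (θ : Set (Sym2 (Δ.Leaf D))) : Prop where
  dual : ∀ l l', s(l, l') ∈ θ →
    ((Δ l.1).leafPred D l.2).IsDual D ((Δ l'.1).leafPred D l'.2)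
  cover : ∀ l, ∃! e, e ∈ θ ∧ l ∈ e

/-- The encoding of a cut sequent. -/
noncomputable def encode (D : Duality L) (Δ : CutSequent L ι) : Sequent L ι :=
  fun i => (Δ i).encode D

/-- The leaves of a cut sequent are the leaves of its encoding. -/
noncomputable def encodeLeaf (D : Duality L) (Δ : CutSequent L ι) (l : Δ.Leaf D) :
    (Δ.encode D).Leaf :=
  ⟨l.1, (Δ l.1).encodeLeaf D l.2⟩

/-- A unification net on a cut sequent: a linking which is correct on the encoding. -/
def IsUnificationNet (D : Duality L) (Δ : CutSequent L ι) (θ : Set (Sym2 (Δ.Leaf D))) : Prop :=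
  Δ.IsLinking D θ ∧ (Δ.encode D).Correct (Sym2.map (Δ.encodeLeaf D) '' θ)

/-- The cut sequent `I, Γ`. -/
def cons (I : Item L) (Γ : CutSequent L ι) : CutSequent L (Option ι)
  | none => I
  | some i => Γ i

/-- The cut sequent `Γ, Δ`. -/
def append (Γ : CutSequent L ι) (Δ : CutSequent L κ) : CutSequent L (ι ⊕ κ)
  | .inl i => Γ i
  | .inr j => Δ j

end CutSequent

open CutSequent in
/-- Proofs in the sequent calculus with the extended cut rule. The rule `reindex` does nothing
but rename the index set of a family (sequents are disjoint unions of formulas and cuts, with no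
order among them). -/
inductive Proof {L : FirstOrder.Language.{u, v}} (D : Duality L) :
    {ι : Type} → CutSequent L ι → Type (max 1 u v)
  | reindex {ι κ : Type} (e : ι ≃ κ) (Γ : CutSequent L κ)
      (π : Proof D fun i => Γ (e i)) : Proof D Γ
  | ax (a : Atom L ℕ) :
      Proof D (cons (.formula (.atom a)) fun _ : Unit => .formula (.atom (a.neg D)))
  | par {ι : Type} (Γ : CutSequent L ι) (A B : Formula L ℕ)
      (π : Proof D (cons (.formula A) (cons (.formula B) Γ))) :
      Proof D (cons (.formula (.par A B)) Γ)
  | tensor {ι κ : Type} (Γ : CutSequent L ι) (Δ : CutSequent L κ) (A B : Formula L ℕ)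
      (π₁ : Proof D (cons (.formula A) Γ)) (π₂ : Proof D (cons (.formula B) Δ)) :
      Proof D (cons (.formula (.tensor A B)) (append Γ Δ))
  | ex {ι : Type} (Γ : CutSequent L ι) (A : Formula L (Option ℕ)) (t : L.Term ℕ)
      (π : Proof D (cons (.formula (A.inst t)) Γ)) :
      Proof D (cons (.formula (.ex A)) Γ)
  | all {ι : Type} (Γ : CutSequent L ι) (A : Formula L (Option ℕ)) (x : ℕ)
      (hA : x ∉ (Formula.all A).freeVars) (hΓ : ∀ i, x ∉ (Γ i).freeVars)
      (π : Proof D (cons (.formula (A.inst (.var x))) Γ)) :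
      Proof D (cons (.formula (.all A)) Γ)
  | cut {ι κ : Type} (Γ : CutSequent L ι) (Δ : CutSequent L κ) (A : Formula L ℕ)
      (σ : ℕ → L.Term ℕ)
      (π₁ : Proof D (cons (.formula (A.subst σ)) Γ))
      (π₂ : Proof D (cons (.formula ((A.neg D).subst σ)) Δ)) :
      Proof D (cons (.cut A) (append Γ Δ))

/-! ### Tracking of leaves from the hypotheses of a rule to its conclusion -/

namespace Track

open CutSequent

variable {L : FirstOrder.Language.{u, v}} {D : Duality L} {ι κ : Type}

def reindex (e : ι ≃ κ) (Γ : CutSequent L κ) :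
    Leaf D (fun i => Γ (e i)) → Γ.Leaf D
  | ⟨i, l⟩ => ⟨e i, l⟩

def par (Γ : CutSequent L ι) (A B : Formula L ℕ) :
    (cons (.formula A) (cons (.formula B) Γ)).Leaf D → (cons (.formula (.par A B)) Γ).Leaf D
  | ⟨none, l⟩ => ⟨none, Sum.inl l⟩
  | ⟨some none, l⟩ => ⟨none, Sum.inr l⟩
  | ⟨some (some i), l⟩ => ⟨some i, l⟩

def tensorLeft (Γ : CutSequent L ι) (Δ : CutSequent L κ) (A B : Formula L ℕ) :
    (cons (.formula A) Γ).Leaf D → (cons (.formula (.tensor A B)) (append Γ Δ)).Leaf D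
  | ⟨none, l⟩ => ⟨none, Sum.inl l⟩
  | ⟨some i, l⟩ => ⟨some (.inl i), l⟩

def tensorRight (Γ : CutSequent L ι) (Δ : CutSequent L κ) (A B : Formula L ℕ) :
    (cons (.formula B) Δ).Leaf D → (cons (.formula (.tensor A B)) (append Γ Δ)).Leaf D
  | ⟨none, l⟩ => ⟨none, Sum.inr l⟩
  | ⟨some j, l⟩ => ⟨some (.inr j), l⟩

def ex (Γ : CutSequent L ι) (A : Formula L (Option ℕ)) (t : L.Term ℕ) :
    (cons (.formula (A.inst t)) Γ).Leaf D → (cons (.formula (.ex A)) Γ).Leaf D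
  | ⟨none, l⟩ => ⟨none, A.leafSubst _ l⟩
  | ⟨some i, l⟩ => ⟨some i, l⟩

def all (Γ : CutSequent L ι) (A : Formula L (Option ℕ)) (x : ℕ) :
    (cons (.formula (A.inst (.var x))) Γ).Leaf D → (cons (.formula (.all A)) Γ).Leaf D
  | ⟨none, l⟩ => ⟨none, A.leafSubst _ l⟩
  | ⟨some i, l⟩ => ⟨some i, l⟩

def cutLeft (Γ : CutSequent L ι) (Δ : CutSequent L κ) (A : Formula L ℕ) (σ : ℕ → L.Term ℕ) :
    (cons (.formula (A.subst σ)) Γ).Leaf D → (cons (.cut A) (append Γ Δ)).Leaf D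
  | ⟨none, l⟩ => ⟨none, Sum.inl (A.leafSubst σ l)⟩
  | ⟨some i, l⟩ => ⟨some (.inl i), l⟩

def cutRight (Γ : CutSequent L ι) (Δ : CutSequent L κ) (A : Formula L ℕ) (σ : ℕ → L.Term ℕ) :
    (cons (.formula ((A.neg D).subst σ)) Δ).Leaf D → (cons (.cut A) (append Γ Δ)).Leaf D
  | ⟨none, l⟩ => ⟨none, Sum.inr ((A.neg D).leafSubst σ l)⟩
  | ⟨some j, l⟩ => ⟨some (.inr j), l⟩

end Track

/-- The translation of a proof: the set of links obtained by tracking the two atoms of each axiom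
down the proof onto the conclusion. -/
def Proof.translate {L : FirstOrder.Language.{u, v}} {D : Duality L} :
    {ι : Type} → {Δ : CutSequent L ι} → Proof D Δ → Set (Sym2 (Δ.Leaf D))
  | _, _, .reindex e Γ π => Sym2.map (Track.reindex e Γ) '' π.translate
  | _, _, .ax _ => {s(⟨none, ()⟩, ⟨some (), ()⟩)}
  | _, _, .par Γ A B π => Sym2.map (Track.par Γ A B) '' π.translate
  | _, _, .tensor Γ Δ A B π₁ π₂ =>
      Sym2.map (Track.tensorLeft Γ Δ A B) '' π₁.translate ∪
        Sym2.map (Track.tensorRight Γ Δ A B) '' π₂.translate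
  | _, _, .ex Γ A t π => Sym2.map (Track.ex Γ A t) '' π.translate
  | _, _, .all Γ A x _ _ π => Sym2.map (Track.all Γ A x) '' π.translate
  | _, _, .cut Γ Δ A σ π₁ π₂ =>
      Sym2.map (Track.cutLeft Γ Δ A σ) '' π₁.translate ∪
        Sym2.map (Track.cutRight Γ Δ A σ) '' π₂.translate

end FOMLL

/-! A proof and a unification net determine each other up to the order of rules, and each inclusion
reduces to a statement about connectivity of switchings.

From proofs to nets. A proof carries its own unifier: each ∃ rule names a term, and a cut with
substitution σ is a tensor followed by ∃ rules whose terms are the values of σ. Turning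
eigenvariables into the universal vertices that bind them yields an assignment equalizing all links,
a `Witness`. Its leaps define a graph, and `Good` asks that all switchings of this graph be
connected with at most |V| - 1 edges. Each logical rule adds one vertex, under one subgraph
(`SwGraph.Correct.pendant`) or under two disjoint ones (`SwGraph.Correct.join`), and preserves this;
a cut adds the tensor and then its quantifiers one at a time. The witness need not be most general.
But every unifier is an instance of a most general one by a substitution fixing universal variables,
so the leaps of the linking are among those of the witness (`Sequent.Precedes.leap`), and its
switchings are covered by those of the larger graph. A connected graph with at most |V| - 1 edges is
a tree. That translations are linkings holds because the tracking maps of a rule biject leaves and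
keep predicate symbols.

From nets to proofs. A unifiable linking has a most general unifier, constructed as the least
general generalization of all its unifiers (`Sequent.exists_isMGU`). Its leaps make the tree
condition available, in the form used below: every switching is connected, and every edge into an
unswitched vertex is a bridge. Sequentialization (`Net.derives`) is induction on the size of a
module, a predecessor-closed and link-closed set of vertices. A terminal par or ∀ is removed at
once. Otherwise a maximal empire gives a terminal ∃ or tensor, and at a tensor it splits the module
in two (`SwGraph.exists_splitting`). When only atoms remain, connectivity leaves a single link, an
axiom. Leaps are edges into ∀, so a terminal ∀ has all the existentials that use its eigenvariable
still in the module above or beside it; this gives the eigenvariable condition (`Net.eigen_notMem`).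

Cuts are handled by working on the encoding while the actual component stays a cut (`Rep`): the
outer ∃ of an encoded cut are stripped without a rule, only recording a substitution, and the tensor
below them becomes a cut rule.

Leaves of formulas that are equal but not syntactically identical live in different types. Labelled
formulas `LForm` replace transport of links between such types by sets of pairs of labels. -/

namespace FOMLL

open FirstOrder.Language (Term)

/-! ### Substitution and variables in terms and atoms. -/

section Terms

variable {L : FirstOrder.Language.{u, v}} {X Y Z : Type}

@[simp] theorem mem_termVars_var {x y : X} : y ∈ termVars (Term.var x : L.Term X) ↔ y = x := by
  simp [termVars]

@[simp] theorem mem_termVars_func {n : ℕ} {f : L.Functions n} {ts : Fin n → L.Term X} {y : X} :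
    y ∈ termVars (Term.func f ts) ↔ ∃ i, y ∈ termVars (ts i) := by
  simp [termVars]

theorem term_subst_congr {t : L.Term X} {σ τ : X → L.Term Y} (h : ∀ x ∈ termVars t, σ x = τ x) :
    t.subst σ = t.subst τ := by
  induction t with
  | var x => simpa using h
  | func f ts ih =>
    simp only [Term.subst]
    congr 1
    funext i
    exact ih i fun x hx => h x (by simpa using ⟨i, hx⟩)

@[simp] theorem term_subst_var (t : L.Term X) : t.subst Term.var = t := by
  induction t with
  | var x => rfl
  | func f ts ih => simp only [Term.subst, ih]

theorem term_subst_subst (t : L.Term X) (σ : X → L.Term Y) (τ : Y → L.Term Z) :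
    (t.subst σ).subst τ = t.subst fun x => (σ x).subst τ := by
  induction t with
  | var x => rfl
  | func f ts ih => simp only [Term.subst, ih]

theorem term_relabel_eq_subst (t : L.Term X) (g : X → Y) :
    t.relabel g = t.subst fun x => .var (g x) := by
  induction t with
  | var x => rfl
  | func f ts ih => simp only [Term.subst, Term.relabel, ih]

theorem mem_termVars_subst {t : L.Term X} {σ : X → L.Term Y} {y : Y} :
    y ∈ termVars (t.subst σ) ↔ ∃ x ∈ termVars t, y ∈ termVars (σ x) := by
  induction t with
  | var x => simp [Term.subst]
  | func f ts ih =>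
    simp only [Term.subst, mem_termVars_func, ih]
    constructor
    · rintro ⟨i, x, h, h'⟩
      exact ⟨x, ⟨i, h⟩, h'⟩
    · rintro ⟨x, ⟨i, h⟩, h'⟩
      exact ⟨i, x, h, h'⟩

theorem mem_termVars_relabel {t : L.Term X} {g : X → Y} {y : Y} :
    y ∈ termVars (t.relabel g) ↔ ∃ x ∈ termVars t, y = g x := by
  simp [term_relabel_eq_subst, mem_termVars_subst]

end Terms

namespace Atom

variable {L : FirstOrder.Language.{u, v}} {X Y Z : Type}

theorem mem_vars {a : Atom L X} {x : X} : x ∈ a.vars ↔ ∃ i, x ∈ termVars (a.args i) := by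
  simp [vars]

theorem subst_congr {a : Atom L X} {σ τ : X → L.Term Y} (h : ∀ x ∈ a.vars, σ x = τ x) :
    a.subst σ = a.subst τ := by
  unfold subst
  congr 1
  funext i
  exact term_subst_congr fun x hx => h x (mem_vars.2 ⟨i, hx⟩)

@[simp] theorem subst_var (a : Atom L X) : a.subst Term.var = a := by
  simp [subst]

theorem subst_subst (a : Atom L X) (σ : X → L.Term Y) (τ : Y → L.Term Z) :
    (a.subst σ).subst τ = a.subst fun x => (σ x).subst τ := by
  simp [subst, term_subst_subst]

theorem relabel_eq_subst (a : Atom L X) (g : X → Y) :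
    a.relabel g = a.subst fun x => .var (g x) := by
  simp [subst, relabel, term_relabel_eq_subst]

theorem relabel_subst (a : Atom L X) (g : X → Y) (σ : Y → L.Term Z) :
    (a.relabel g).subst σ = a.subst fun x => σ (g x) := by
  rw [relabel_eq_subst, subst_subst]
  rfl

theorem mem_vars_subst {a : Atom L X} {σ : X → L.Term Y} {y : Y} :
    y ∈ (a.subst σ).vars ↔ ∃ x ∈ a.vars, y ∈ termVars (σ x) := by
  simp only [mem_vars, subst, mem_termVars_subst]
  constructor
  · rintro ⟨i, x, h, h'⟩
    exact ⟨x, ⟨i, h⟩, h'⟩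
  · rintro ⟨x, ⟨i, h⟩, h'⟩
    exact ⟨i, x, h, h'⟩

theorem mem_vars_relabel {a : Atom L X} {g : X → Y} {y : Y} :
    y ∈ (a.relabel g).vars ↔ ∃ x ∈ a.vars, y = g x := by
  simp [relabel_eq_subst, mem_vars_subst]

theorem termSeq_subst (a : Atom L X) (σ : X → L.Term Y) :
    (a.subst σ).termSeq = a.termSeq.map fun t => t.subst σ := by
  simp only [termSeq, subst, List.map_ofFn]
  rfl

theorem mem_termSeq {a : Atom L X} {t : L.Term X} : t ∈ a.termSeq ↔ ∃ i, a.args i = t := by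
  simp [termSeq, List.mem_ofFn]

/-- Dual atoms with equal term sequences are negations of each other. -/
theorem eq_neg_of_termSeq_eq (D : Duality L) {a b : Atom L X}
    (h : PredSym.IsDual D ⟨a.arity, a.pred⟩ ⟨b.arity, b.pred⟩) (ht : a.termSeq = b.termSeq) :
    b = a.neg D := by
  obtain ⟨n, P, ts⟩ := a
  obtain ⟨m, Q, us⟩ := b
  simp only [PredSym.IsDual, Sigma.mk.injEq] at h
  obtain ⟨rfl, h⟩ := h
  obtain rfl := eq_of_heq h
  obtain rfl := List.ofFn_injective ht
  rfl

end Atom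

section Lift

variable {L : FirstOrder.Language.{u, v}} {X Y Z : Type}

theorem liftSubst_var : liftSubst (Term.var : X → L.Term X) = Term.var := by
  funext o
  cases o <;> rfl

theorem liftSubst_subst (σ : X → L.Term Y) (τ : Y → L.Term Z) :
    (fun o => (liftSubst σ o).subst (liftSubst τ)) = liftSubst fun x => (σ x).subst τ := by
  funext o
  cases o with
  | none => rfl
  | some x =>
    simp only [liftSubst, term_relabel_eq_subst, term_subst_subst]
    simp only [Term.subst, liftSubst, term_relabel_eq_subst]

theorem liftSubst_inst (σ : X → L.Term Y) (t : L.Term Y) :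
    (fun o => (liftSubst σ o).subst fun o' => o'.elim t Term.var) = fun o => o.elim t σ := by
  funext o
  cases o with
  | none => rfl
  | some x => simp [liftSubst, term_relabel_eq_subst, term_subst_subst, Term.subst]

end Lift

/-! ### Formulas: free variables, finiteness, and leaves under substitution. -/

namespace Formula

variable {L : FirstOrder.Language.{u, v}} {X Y : Type}

theorem mem_freeVars_subst {A : Formula L X} {σ : X → L.Term Y} {y : Y} :
    y ∈ (A.subst σ).freeVars ↔ ∃ x ∈ A.freeVars, y ∈ termVars (σ x) := by
  induction A generalizing Y with
  | atom a => exact Atom.mem_vars_subst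
  | tensor A B ihA ihB | par A B ihA ihB =>
    simp only [freeVars, subst, Finset.mem_union, ihA, ihB, or_and_right, exists_or]
  | all A ih | ex A ih =>
    simp only [freeVars, subst, Finset.mem_eraseNone, ih]
    constructor
    · rintro ⟨o, ho, hy⟩
      cases o with
      | none => simp [liftSubst] at hy
      | some x =>
        simp only [liftSubst, mem_termVars_relabel] at hy
        obtain ⟨z, hz, h⟩ := hy
        cases h
        exact ⟨x, ho, hz⟩
    · rintro ⟨x, hx, hy⟩
      exact ⟨some x, hx, by simp [liftSubst, mem_termVars_relabel, hy]⟩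

theorem freeVars_neg (D : Duality L) (A : Formula L X) : (A.neg D).freeVars = A.freeVars := by
  induction A with
  | atom a => rfl
  | tensor A B ihA ihB | par A B ihA ihB => simp only [neg, freeVars, ihA, ihB]
  | all A ih | ex A ih => simp only [neg, freeVars, ih]

theorem mem_freeVars_exs {xs : List ℕ} {A : Formula L ℕ} {y : ℕ} :
    y ∈ (exs xs A).freeVars ↔ y ∈ A.freeVars ∧ y ∉ xs := by
  induction xs generalizing y with
  | nil => simp [exs]
  | cons x xs ih =>
    simp only [exs, bind, freeVars, Finset.mem_eraseNone, mem_freeVars_subst, ih, List.mem_cons,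
      not_or]
    constructor
    · rintro ⟨z, hz, h⟩
      split_ifs at h with hzx
      · simp at h
      · simp only [mem_termVars_var, Option.some.injEq] at h
        subst h
        exact ⟨hz.1, hzx, hz.2⟩
    · rintro ⟨h, h', h''⟩
      exact ⟨y, ⟨h, h''⟩, by simp [h']⟩

/-- The encoding of a cut is closed, so a cut never obstructs an eigenvariable condition and is
unchanged by substitution. -/
theorem freeVars_exs_sort (D : Duality L) (A : Formula L ℕ) :
    (exs (A.freeVars.sort (· ≤ ·)) (.tensor A (A.neg D))).freeVars = ∅ := by
  ext y
  simp [mem_freeVars_exs, freeVars, freeVars_neg]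

instance finite_vertex : {X : Type} → (A : Formula L X) → Finite A.Vertex
  | _, atom _ => inferInstanceAs (Finite Unit)
  | _, tensor A B | _, par A B =>
    have := finite_vertex A
    have := finite_vertex B
    inferInstanceAs (Finite (Option (A.Vertex ⊕ B.Vertex)))
  | _, all A | _, ex A =>
    have := finite_vertex A
    inferInstanceAs (Finite (Option A.Vertex))

instance finite_leaf : {X : Type} → (A : Formula L X) → Finite A.Leaf
  | _, atom _ => inferInstanceAs (Finite Unit)
  | _, tensor A B | _, par A B =>
    have := finite_leaf A
    have := finite_leaf B
    inferInstanceAs (Finite (A.Leaf ⊕ B.Leaf))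
  | _, all A | _, ex A => finite_leaf A

theorem leafPred_leafSubst (A : Formula L X) (σ : X → L.Term Y) (l : (A.subst σ).Leaf) :
    A.leafPred (A.leafSubst σ l) = (A.subst σ).leafPred l := by
  induction A generalizing Y with
  | atom a => rfl
  | tensor A B ihA ihB | par A B ihA ihB =>
    rcases l with l | l
    · exact ihA σ l
    · exact ihB σ l
  | all A ih | ex A ih => exact ih _ l

theorem leafPred_leafExs (xs : List ℕ) (A : Formula L ℕ) (l : A.Leaf) :
    (exs xs A).leafPred (leafExs xs A l) = A.leafPred l := by
  induction xs with
  | nil => rfl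
  | cons x xs ih =>
    rw [← ih, ← Equiv.apply_symm_apply (leafSubst (exs xs A) _) (leafExs xs A l),
      leafPred_leafSubst]
    rfl

theorem leafVertex_injective (A : Formula L X) : Function.Injective A.leafVertex := by
  induction A with
  | atom a => exact fun _ _ _ => rfl
  | tensor A B ihA ihB | par A B ihA ihB =>
    rintro (l | l) (m | m) h
    · exact congrArg Sum.inl (ihA (Sum.inl_injective (Option.some_injective _ h)))
    · cases Option.some_injective _ h
    · cases Option.some_injective _ h
    · exact congrArg Sum.inr (ihB (Sum.inr_injective (Option.some_injective _ h)))
  | all A ih | ex A ih => exact fun l m h => ih (Option.some_injective _ h)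

theorem kind_leafVertex (A : Formula L X) (l : A.Leaf) : A.kind (A.leafVertex l) = .atom := by
  induction A with
  | atom a => rfl
  | tensor A B ihA ihB | par A B ihA ihB =>
    rcases l with l | l
    · exact ihA l
    · exact ihB l
  | all A ih | ex A ih => exact ih l

theorem arity_leafAtom (A : Formula L X) (l : A.Leaf) :
    (⟨(A.leafAtom l).arity, (A.leafAtom l).pred⟩ : PredSym L) = A.leafPred l := by
  induction A with
  | atom a => rfl
  | tensor A B ihA ihB | par A B ihA ihB =>
    rcases l with l | l
    · exact ihA l
    · exact ihB l
  | all A ih | ex A ih => exact ih l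

end Formula

/-! ### Labelled formulas and their substitution calculus. -/

/-- Formulas whose leaves carry labels. -/
abbrev LForm (L : FirstOrder.Language.{u, v}) (Λ X : Type) := Σ A : Formula L X, A.Leaf → Λ

namespace LForm

variable {L : FirstOrder.Language.{u, v}} {Λ X Y Z : Type}

def atom (a : Atom L X) (l : Λ) : LForm L Λ X := ⟨.atom a, fun _ => l⟩

def tensor (x y : LForm L Λ X) : LForm L Λ X := ⟨.tensor x.1 y.1, Sum.elim x.2 y.2⟩

def par (x y : LForm L Λ X) : LForm L Λ X := ⟨.par x.1 y.1, Sum.elim x.2 y.2⟩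

def all (x : LForm L Λ (Option X)) : LForm L Λ X := ⟨.all x.1, x.2⟩

def ex (x : LForm L Λ (Option X)) : LForm L Λ X := ⟨.ex x.1, x.2⟩

/-- Substitution in a labelled formula. -/
def subst (x : LForm L Λ X) (σ : X → L.Term Y) : LForm L Λ Y :=
  ⟨x.1.subst σ, x.2 ∘ x.1.leafSubst σ⟩

/-- Instantiation of the bound variable of a labelled quantified formula. -/
def inst (x : LForm L Λ (Option X)) (t : L.Term X) : LForm L Λ X :=
  x.subst fun o => o.elim t Term.var

/-- Recursion on the formula that carries the labels along; the only content is that a labelling of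
a disjoint union is the `Sum.elim` of its two restrictions. -/
theorem induct {P : ∀ {X : Type}, LForm L Λ X → Prop}
    (atom : ∀ {X : Type} (a : Atom L X) (l : Λ), P (atom a l))
    (tensor : ∀ {X : Type} (x y : LForm L Λ X), P x → P y → P (x.tensor y))
    (par : ∀ {X : Type} (x y : LForm L Λ X), P x → P y → P (x.par y))
    (all : ∀ {X : Type} (x : LForm L Λ (Option X)), P x → P x.all)
    (ex : ∀ {X : Type} (x : LForm L Λ (Option X)), P x → P x.ex)
    {X : Type} (x : LForm L Λ X) : P x := by
  obtain ⟨A, lab⟩ := x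
  induction A with
  | atom a => exact atom a (lab ())
  | tensor A B ihA ihB =>
    have e : (⟨.tensor A B, lab⟩ : LForm L Λ _) =
        LForm.tensor ⟨A, fun l => lab (.inl l)⟩ ⟨B, fun l => lab (.inr l)⟩ := by
      refine Sigma.ext rfl (heq_of_eq ?_)
      funext l
      rcases l with l | l <;> rfl
    rw [e]
    exact tensor _ _ (ihA _) (ihB _)
  | par A B ihA ihB =>
    have e : (⟨.par A B, lab⟩ : LForm L Λ _) =
        LForm.par ⟨A, fun l => lab (.inl l)⟩ ⟨B, fun l => lab (.inr l)⟩ := by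
      refine Sigma.ext rfl (heq_of_eq ?_)
      funext l
      rcases l with l | l <;> rfl
    rw [e]
    exact par _ _ (ihA _) (ihB _)
  | all A ih => exact all ⟨A, lab⟩ (ih lab)
  | ex A ih => exact ex ⟨A, lab⟩ (ih lab)

theorem subst_atom (a : Atom L X) (l : Λ) (σ : X → L.Term Y) :
    (atom a l).subst σ = atom (a.subst σ) l := rfl

theorem subst_tensor (x y : LForm L Λ X) (σ : X → L.Term Y) :
    (x.tensor y).subst σ = (x.subst σ).tensor (y.subst σ) := by
  refine Sigma.ext rfl (heq_of_eq ?_)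
  funext l
  rcases l with l | l <;> rfl

theorem subst_par (x y : LForm L Λ X) (σ : X → L.Term Y) :
    (x.par y).subst σ = (x.subst σ).par (y.subst σ) := by
  refine Sigma.ext rfl (heq_of_eq ?_)
  funext l
  rcases l with l | l <;> rfl

theorem subst_all (x : LForm L Λ (Option X)) (σ : X → L.Term Y) :
    x.all.subst σ = (x.subst (liftSubst σ)).all := rfl

theorem subst_ex (x : LForm L Λ (Option X)) (σ : X → L.Term Y) :
    x.ex.subst σ = (x.subst (liftSubst σ)).ex := rfl

/-- An equation between labelled formulas also says that the two identifications of leaves agree.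
This is how later arguments avoid casts between leaf types. -/
theorem subst_subst (x : LForm L Λ X) (σ : X → L.Term Y) (τ : Y → L.Term Z) :
    (x.subst σ).subst τ = x.subst fun v => (σ v).subst τ := by
  induction x using induct generalizing Y Z with
  | atom a l => simp only [subst_atom, Atom.subst_subst]
  | tensor x y ihx ihy => simp only [subst_tensor, ihx, ihy]
  | par x y ihx ihy => simp only [subst_par, ihx, ihy]
  | all x ih => simp only [subst_all, ih, liftSubst_subst]
  | ex x ih => simp only [subst_ex, ih, liftSubst_subst]

theorem subst_var (x : LForm L Λ X) : x.subst Term.var = x := by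
  induction x using induct with
  | atom a l => simp only [subst_atom, Atom.subst_var]
  | tensor x y ihx ihy => simp only [subst_tensor, ihx, ihy]
  | par x y ihx ihy => simp only [subst_par, ihx, ihy]
  | all x ih => simp only [subst_all, ih, liftSubst_var]
  | ex x ih => simp only [subst_ex, ih, liftSubst_var]

theorem subst_congr {x : LForm L Λ X} {σ τ : X → L.Term Y}
    (h : ∀ y ∈ x.1.freeVars, σ y = τ y) : x.subst σ = x.subst τ := by
  induction x using induct generalizing Y with
  | atom a l => simp only [subst_atom, Atom.subst_congr h]
  | tensor x y ihx ihy =>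
    simp only [tensor, Formula.freeVars, Finset.mem_union] at h
    simp only [subst_tensor, ihx fun x hx => h x (.inl hx), ihy fun x hx => h x (.inr hx)]
  | par x y ihx ihy =>
    simp only [par, Formula.freeVars, Finset.mem_union] at h
    simp only [subst_par, ihx fun x hx => h x (.inl hx), ihy fun x hx => h x (.inr hx)]
  | all x ih =>
    simp only [all, Formula.freeVars, Finset.mem_eraseNone] at h
    rw [subst_all, subst_all, ih]
    rintro (_ | y) hy
    · rfl
    · simp only [liftSubst, h y hy]
  | ex x ih =>
    simp only [ex, Formula.freeVars, Finset.mem_eraseNone] at h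
    rw [subst_ex, subst_ex, ih]
    rintro (_ | y) hy
    · rfl
    · simp only [liftSubst, h y hy]

theorem inst_liftSubst (x : LForm L Λ (Option X)) (σ : X → L.Term Y) (t : L.Term Y) :
    (x.subst (liftSubst σ)).inst t = x.subst fun o => o.elim t σ := by
  rw [inst, subst_subst, liftSubst_inst]

end LForm

end FOMLL

/-! ### Graphs with switched vertices: empires and splitting. -/

namespace FOMLL

/-- A graph with switched vertices: of the edges `into · v` into a switched vertex `v`, a
switching keeps exactly one. -/
structure SwGraph (V : Type) where
  sw : V → Prop
  into : V → V → Prop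
  link : V → V → Prop

namespace SwGraph

variable {V : Type}

/-- A choice of an edge into every switched vertex. -/
def Valid (G : SwGraph V) (s : V → V) : Prop := ∀ v, G.sw v → G.into (s v) v

/-- The edges of the switching given by the choice `s`. -/
def Edge (G : SwGraph V) (s : V → V) (u v : V) : Prop :=
  G.link u v ∨ (G.into u v ∧ ¬ G.sw v) ∨ (G.sw v ∧ s v = u)

/-- The switching given by `s` is connected on `U`. -/
def Conn (G : SwGraph V) (s : V → V) (U : Set V) : Prop :=
  ∀ Q : Set V, (∀ u ∈ U, ∀ v ∈ U, G.Edge s u v → (u ∈ Q ↔ v ∈ Q)) →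
    ∀ u ∈ U, ∀ v ∈ U, u ∈ Q → v ∈ Q

theorem Edge.link {G : SwGraph V} {s : V → V} {u v : V} (h : G.link u v) : G.Edge s u v := .inl h

theorem Edge.kept {G : SwGraph V} {s : V → V} {u v : V} (h : G.into u v) (h' : ¬ G.sw v) :
    G.Edge s u v := .inr (.inl ⟨h, h'⟩)

theorem Edge.chosen {G : SwGraph V} {s : V → V} {v : V} (h : G.sw v) : G.Edge s (s v) v :=
  .inr (.inr ⟨h, rfl⟩)

theorem Edge.into_or_link {G : SwGraph V} {s : V → V} {u v : V} (h : G.Edge s u v)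
    (hs : G.Valid s) : G.into u v ∨ G.link u v := by
  rcases h with h | h | ⟨h, rfl⟩
  · exact .inr h
  · exact .inl h.1
  · exact .inl (hs v h)

/-- A subset of the vertices, closed under predecessors and links, on which all switchings are
connected. -/
structure IsModule (G : SwGraph V) (U : Set V) : Prop where
  into_closed : ∀ u v, G.into u v → v ∈ U → u ∈ U
  link_closed : ∀ u v, G.link u v → (u ∈ U ↔ v ∈ U)
  conn : ∀ s, G.Valid s → G.Conn s U

/-- Every edge into an unswitched vertex is a bridge of every switching. -/
def Bridges (G : SwGraph V) : Prop :=
  ∀ s, G.Valid s → ∀ c t, G.into c t → ¬ G.sw t →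
    ∃ P : Set V, c ∈ P ∧ t ∉ P ∧ ∀ u v, G.Edge s u v → (u, v) ≠ (c, t) → (u ∈ P ↔ v ∈ P)

/-- `X` is the empire of `c` in `U`, with respect to the edge from `c` to `t`. -/
structure Empire (G : SwGraph V) (U : Set V) (c t : V) (X : Set V) : Prop extends
    IsModule G X where
  subset : X ⊆ U
  mem : c ∈ X
  notMem : t ∉ X
  cut : ∃ s, G.Valid s ∧ ∀ u ∈ U, ∀ v ∈ U, G.Edge s u v → (u, v) ≠ (c, t) → (u ∈ X ↔ v ∈ X)

/-- Deleting the bridge from `c` to `t` from a switching leaves a side containing `c`. Such a side,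
over all switchings, is made as small as possible; if it missed a predecessor `q` of one of its
vertices `p`, then letting `p` choose `q` would give a strictly smaller side. -/
theorem exists_empire [Finite V] {G : SwGraph V} {U : Set V} (hU : G.IsModule U)
    (hB : G.Bridges) (hl : ∀ u v w, G.link u v → ¬ G.into w v) {s₀ : V → V} (hs₀ : G.Valid s₀)
    {c t : V} (hct : G.into c t) (ht : ¬ G.sw t) (htU : t ∈ U) : ∃ X, G.Empire U c t X := by
  classical
  have hcU := hU.into_closed c t hct htU
  have hlct : ∀ u v, G.link u v → (u, v) ≠ (c, t) := by
    rintro u v h ⟨⟩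
    exact hl _ _ _ h hct
  -- The candidates are nonempty because `Bridges` supplies one for the given choice `s₀`;
  -- intersecting with `U` keeps the boundary condition on edges inside `U`.
  obtain ⟨X, hX⟩ := Set.Finite.exists_minimal (Set.toFinite {P : Set V | P ⊆ U ∧ c ∈ P ∧ t ∉ P ∧
    ∃ s, G.Valid s ∧ ∀ u ∈ U, ∀ v ∈ U, G.Edge s u v → (u, v) ≠ (c, t) → (u ∈ P ↔ v ∈ P)}) (by
      obtain ⟨P, h1, h2, h3⟩ := hB s₀ hs₀ c t hct ht
      refine ⟨P ∩ U, Set.inter_subset_right, ⟨h1, hcU⟩, fun h => h2 h.1, s₀, hs₀, ?_⟩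
      intro u hu v hv h h'
      simpa [hu, hv] using h3 u v h h')
  obtain ⟨hXU, hcX, htX, s, hs, hsX⟩ := hX.prop
  have hin : ∀ u v, G.into u v → v ∈ X → u ∈ X := by
    intro q p hqp hp
    by_contra hq
    have hpU := hXU hp
    have hqU := hU.into_closed _ _ hqp hpU
    have hpsw : G.sw p := by
      by_contra hpsw
      refine hq ((hsX q hqU p hpU (.kept hqp hpsw) ?_).2 hp)
      rintro ⟨⟩
      exact htX hp
    -- Redirecting the choice at `p` to the missing predecessor `q` changes only the edge into `p`.
    have hs' : G.Valid (Function.update s p q) := by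
      intro v hv
      by_cases h : v = p
      · subst h
        simpa using hqp
      · simpa [h] using hs v hv
    obtain ⟨P, h1, h2, h3⟩ := hB _ hs' c t hct ht
    -- No edge of the switching `s` inside `U` crosses the boundary of `P \ X`: an edge with target
    -- in `X` has both ends in `X`, and one with target outside `X` is also an edge of the
    -- redirected switching or is the edge from `c` to `t`. Since `s` connects `U` and `c` is not in
    -- `P \ X`, that set misses `U`.
    have hPX : ∀ u ∈ U, u ∈ P → u ∈ X := by
      intro u hu huP
      by_contra huX
      refine (hU.conn s hs (P \ X) ?_ u hu c hcU ⟨huP, huX⟩).2 hcX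
      intro a ha b hb hab
      by_cases hne : (a, b) = (c, t)
      · cases hne
        simp [hcX, h2]
      · have h4 := hsX a ha b hb hab hne
        by_cases hbX : b ∈ X
        · simp [hbX, h4.2 hbX]
        · have : G.Edge (Function.update s p q) a b := by
            rcases hab with h | h | ⟨h, h'⟩
            · exact .inl h
            · exact .inr (.inl h)
            · refine .inr (.inr ⟨h, ?_⟩)
              have : b ≠ p := fun h => hbX (h ▸ hp)
              simpa [this] using h'
          simp [hbX, mt h4.1 hbX, h3 a b this hne]
    have hpP : p ∉ P := by
      intro hpP
      have h5 : G.Edge (Function.update s p q) q p := .inr (.inr ⟨hpsw, by simp⟩)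
      refine hq (hPX q hqU ((h3 q p h5 ?_).2 hpP))
      rintro ⟨⟩
      exact htX hp
    -- `P ∩ U` is a candidate inside `X` that omits `p`, against minimality.
    have := hX.le_of_le (y := P ∩ U) ⟨Set.inter_subset_right, ⟨h1, hcU⟩, fun h => h2 h.1, _, hs',
      fun u hu v hv h h' => by simpa [hu, hv] using h3 u v h h'⟩ fun u hu => hPX u hu.2 hu.1
    exact hpP (this hp).1
  have hlink : ∀ u v, G.link u v → (u ∈ X ↔ v ∈ X) := by
    intro u v h
    by_cases hu : u ∈ U
    · exact hsX u hu v ((hU.link_closed u v h).1 hu) (.link h) (hlct u v h)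
    · have hv : v ∉ U := mt (hU.link_closed u v h).2 hu
      exact iff_of_false (fun h => hu (hXU h)) fun h => hv (hXU h)
  refine ⟨X, ⟨⟨hin, hlink, ?_⟩, hXU, hcX, htX, s, hs, hsX⟩⟩
  intro s' hs' Q hQ x hx y hy hxQ
  -- The mixed choice is `s'` inside `X` and `s` outside. Its only edge leaving `X` starts at `c`,
  -- so giving all outside vertices the status of `c` turns connectivity of `U` into connectivity of
  -- `X` under `s'`.
  set s₃ : V → V := fun z => if z ∈ X then s' z else s z with hs₃
  have hv₃ : G.Valid s₃ := by
    intro v hv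
    by_cases h : v ∈ X
    · simpa [hs₃, h] using hs' v hv
    · simpa [hs₃, h] using hs v hv
  have key := hU.conn s₃ hv₃ {u | (u ∈ X ∧ u ∈ Q) ∨ (u ∉ X ∧ c ∈ Q)} ?_ x (hXU hx) y (hXU hy)
    (.inl ⟨hx, hxQ⟩)
  · rcases key with h | h
    · exact h.2
    · exact absurd hy h.1
  · intro u hu v hv huv
    by_cases hvX : v ∈ X
    · have huX : u ∈ X := by
        rcases huv.into_or_link hv₃ with h | h
        · exact hin u v h hvX
        · exact (hlink u v h).2 hvX
      have : G.Edge s' u v := by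
        rcases huv with h | h | ⟨h, h'⟩
        · exact .inl h
        · exact .inr (.inl h)
        · exact .inr (.inr ⟨h, by simpa [hs₃, hvX] using h'⟩)
      simpa [hvX, huX] using hQ u huX v hvX this
    · have h6 : G.Edge s u v := by
        rcases huv with h | h | ⟨h, h'⟩
        · exact .inl h
        · exact .inr (.inl h)
        · exact .inr (.inr ⟨h, by simpa [hs₃, hvX] using h'⟩)
      by_cases hne : (u, v) = (c, t)
      · cases hne
        simp [hcX, htX]
      · have huX : u ∉ X := mt (hsX u hu v hv h6 hne).1 hvX
        simp [huX, hvX]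

/-- Take the switching that isolates `X'` up to the edge from `c'` to `t'`. It connects `X`, and
that edge does not lie in `X`, so a connected `X` meeting `X'` cannot leave `X'`. -/
theorem Empire.subset_of_mem {G : SwGraph V} {U X X' : Set V} {c t c' t' x : V}
    (h : G.Empire U c t X) (h' : G.Empire U c' t' X') (hx : x ∈ X) (hx' : x ∈ X')
    (ht' : t' ∉ X) : X ⊆ X' := by
  intro y hy
  obtain ⟨s, hs, hsX⟩ := h'.cut
  refine h.conn s hs X' ?_ x hx y hy hx'
  intro u hu v hv huv
  refine hsX u (h.subset hu) v (h.subset hv) huv ?_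
  rintro ⟨⟩
  exact ht' hv

/-- If no switched vertex is terminal in the module `U`, then the target `t` of some edge into an
unswitched vertex is terminal, and deleting this edge separates an empire from the rest. -/
theorem exists_splitting [Finite V] {G : SwGraph V} {U : Set V} (hU : G.IsModule U)
    (hB : G.Bridges) (hl : ∀ u v w, G.link u v → ¬ G.into w v) {s₀ : V → V} (hs₀ : G.Valid s₀)
    (depth : V → ℕ)
    (hdesc : ∀ v ∈ U, G.sw v → ∃ u ∈ U, G.into v u ∧ depth u < depth v)
    (hex : ∃ c, ∃ t ∈ U, G.into c t ∧ ¬ G.sw t) :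
    ∃ c t X, t ∈ U ∧ G.into c t ∧ ¬ G.sw t ∧ (∀ u ∈ U, ¬ G.into t u) ∧ G.Empire U c t X ∧
      ∀ x ∈ X, ∀ v ∈ U, v ∉ X → G.into x v → x = c ∧ v = t := by
  -- Following depth-decreasing edges out of switched vertices ends at an unswitched `t`, entered
  -- from some `c`. That `v` is above `c` is expressed by predecessor-closed sets, which is all that
  -- empires require.
  have descend : ∀ n, ∀ v ∈ U, depth v = n → G.sw v → ∃ c t, t ∈ U ∧ G.into c t ∧ ¬ G.sw t ∧
      ∀ Z : Set V, (∀ u v, G.into u v → v ∈ Z → u ∈ Z) → c ∈ Z → v ∈ Z := by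
    intro n
    induction n using Nat.strong_induction_on with
    | _ n ih =>
      intro v hv hn hsw
      obtain ⟨u, hu, hvu, hd⟩ := hdesc v hv hsw
      by_cases hu' : G.sw u
      · obtain ⟨c, t, ht, hct, hts, hZ⟩ := ih (depth u) (hn ▸ hd) u hu rfl hu'
        exact ⟨c, t, ht, hct, hts, fun Z h hc => h v u hvu (hZ Z h hc)⟩
      · exact ⟨v, u, hu, hvu, hu', fun Z _ h => h⟩
  obtain ⟨c₀, t₀, ht₀U, hct₀, ht₀⟩ := hex
  obtain ⟨X₀, hX₀⟩ := exists_empire hU hB hl hs₀ hct₀ ht₀ ht₀U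
  obtain ⟨X, hX⟩ := Set.Finite.exists_maximal
    (Set.toFinite {X : Set V | ∃ c t, t ∈ U ∧ G.into c t ∧ ¬ G.sw t ∧ G.Empire U c t X})
    ⟨X₀, c₀, t₀, ht₀U, hct₀, ht₀, hX₀⟩
  obtain ⟨c, t, htU, hct, ht, hE⟩ := hX.prop
  have hterm : ∀ x ∈ X, ∀ v ∈ U, v ∉ X → G.into x v →
      ¬ G.sw v ∧ ∀ u ∈ U, ¬ G.into v u := by
    intro x hx v hv hvX hxv
    -- If `v` lay above such an edge, the empire of `c'` would contain `v`, hence also `x`, hence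
    -- all of `X`, and would be strictly larger than the maximal `X`.
    have aux : ∀ c' t', t' ∈ U → G.into c' t' → ¬ G.sw t' →
        (∀ Z : Set V, (∀ u v, G.into u v → v ∈ Z → u ∈ Z) → c' ∈ Z → v ∈ Z) → False := by
      intro c' t' ht' hct' hts' hZ
      obtain ⟨X', hX'⟩ := exists_empire hU hB hl hs₀ hct' hts' ht'
      have hvX' := hZ X' hX'.into_closed hX'.mem
      have hsub := hE.subset_of_mem hX' hx (hX'.into_closed x v hxv hvX')
        fun h => hvX (hZ X hE.into_closed (hE.into_closed _ _ hct' h))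
      exact hvX (hX.le_of_ge (y := X') ⟨c', t', ht', hct', hts', hX'⟩ hsub hvX')
    refine ⟨fun hsw => ?_, fun u hu hvu => ?_⟩
    · obtain ⟨c', t', h1, h2, h3, h4⟩ := descend _ v hv rfl hsw
      exact aux c' t' h1 h2 h3 h4
    · by_cases hsw : G.sw u
      · obtain ⟨c', t', h1, h2, h3, h4⟩ := descend _ u hu rfl hsw
        exact aux c' t' h1 h2 h3 fun Z h hc => h v u hvu (h4 Z h hc)
      · exact aux v u hu hvu hsw fun Z _ h => h
  refine ⟨c, t, X, htU, hct, ht, (hterm c hE.mem t htU hE.notMem hct).2, hE, ?_⟩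
  intro x hx v hv hvX hxv
  -- Every vertex that `X` enters from inside is unswitched, so the crossing edge is present in the
  -- switching that isolates `X`; the only edge allowed there is the one from `c` to `t`.
  obtain ⟨s, hs, hsX⟩ := hE.cut
  by_contra hne
  refine hvX ((hsX x (hE.subset hx) v hv (.kept hxv (hterm x hx v hv hvX hxv).1) ?_).1 hx)
  rintro ⟨⟩
  exact hne ⟨rfl, rfl⟩

end SwGraph

end FOMLL

/-! ### Removing vertices from modules and adding vertices to correct graphs. -/

namespace FOMLL

namespace SwGraph

variable {V V₁ V₂ V' : Type}

/-- In each switching a terminal `z` that is switched, or has at most one possible premise, touches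
at most one vertex. It can be given the status of that vertex, so its removal disconnects nothing.
-/
theorem IsModule.erase {G : SwGraph V} {U : Set V} (hU : G.IsModule U) {z : V}
    (hz : ∀ u ∈ U, ¬ G.into z u) (hzU : z ∈ U) (hlink : ∀ u, ¬ G.link z u ∧ ¬ G.link u z)
    (h : G.sw z ∨ ∃ a, ∀ u, G.into u z → u = a) : G.IsModule (U \ {z}) where
  into_closed u v huv hv := ⟨hU.into_closed u v huv hv.1, by rintro rfl; exact hz v hv.1 huv⟩
  link_closed u v huv := by
    have hu : u ≠ z := by rintro rfl; exact (hlink v).1 huv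
    have hv : v ≠ z := by rintro rfl; exact (hlink u).2 huv
    simpa [hu, hv] using hU.link_closed u v huv
  conn s hs Q hQ x hx y hy hxQ := by
    obtain ⟨a, ha⟩ : ∃ a, ∀ u, G.Edge s u z → u = a := by
      rcases h with h | ⟨a, ha⟩
      · refine ⟨s z, fun u hu => ?_⟩
        rcases hu with hu | hu | hu
        · exact absurd hu (hlink u).2
        · exact absurd h hu.2
        · exact hu.2.symm
      · refine ⟨a, fun u hu => ?_⟩
        rcases hu.into_or_link hs with hu | hu
        · exact ha u hu
        · exact absurd hu (hlink u).2
    have key := hU.conn s hs {u | (u ≠ z ∧ u ∈ Q) ∨ (u = z ∧ a ∈ Q)} ?_ x hx.1 y hy.1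
      (.inl ⟨hx.2, hxQ⟩)
    · rcases key with h | h
      · exact h.2
      · exact absurd h.1 hy.2
    · intro u hu v hv huv
      have hu' : u ≠ z := by
        rintro rfl
        rcases huv.into_or_link hs with h | h
        · exact hz v hv h
        · exact (hlink v).1 h
      by_cases hv' : v = z
      · subst hv'
        obtain rfl := ha u huv
        simp [hu']
      · simpa [hu', hv'] using hQ u ⟨hu, hu'⟩ v ⟨hv, hv'⟩ huv

/-- The part of a module that is separated from the empire `X` by a terminal vertex `t` with
exactly two premises. -/
theorem IsModule.diff_empire {G : SwGraph V} {U X : Set V} (hU : G.IsModule U) {c d t : V}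
    (hX : G.Empire U c t X) (ht : ∀ u ∈ U, ¬ G.into t u)
    (hlink : ∀ u, ¬ G.link t u ∧ ¬ G.link u t) (hd : ∀ u, G.into u t → u = c ∨ u = d)
    (hcross : ∀ x ∈ X, ∀ v ∈ U, v ∉ X → G.into x v → x = c ∧ v = t) :
    G.IsModule ((U \ X) \ {t}) where
  into_closed u v huv hv := by
    refine ⟨⟨hU.into_closed u v huv hv.1.1, fun hu => ?_⟩, ?_⟩
    · exact hv.2 (hcross u hu v hv.1.1 hv.1.2 huv).2
    · rintro rfl
      exact ht v hv.1.1 huv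
  link_closed u v huv := by
    have hu : u ≠ t := by rintro rfl; exact (hlink v).1 huv
    have hv : v ≠ t := by rintro rfl; exact (hlink u).2 huv
    simp [hu, hv, hU.link_closed u v huv, hX.link_closed u v huv]
  conn s hs Q hQ x hx y hy hxQ := by
    -- The empire and `t` are contracted to the other premise `d`: after `X` is cut off, they reach
    -- the rest only through `d`.
    have key := hU.conn s hs {u | (u ∉ X ∧ u ≠ t ∧ u ∈ Q) ∨ ((u ∈ X ∨ u = t) ∧ d ∈ Q)} ?_
      x hx.1.1 y hy.1.1 (.inl ⟨hx.1.2, hx.2, hxQ⟩)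
    · rcases key with h | h
      · exact h.2.2
      · exact absurd h.1 (not_or.2 ⟨hy.1.2, hy.2⟩)
    · intro u hu v hv huv
      have hut : u ≠ t := by
        rintro rfl
        rcases huv.into_or_link hs with h | h
        · exact ht v hv h
        · exact (hlink v).1 h
      rcases huv.into_or_link hs with h | h
      · by_cases hvX : v ∈ X
        · simp [hvX, hX.into_closed u v h hvX]
        by_cases hvt : v = t
        · subst hvt
          by_cases huX : u ∈ X
          · simp [huX]
          · rcases hd u h with rfl | rfl
            · exact absurd hX.mem huX
            · simp [huX, hut]
        · have huX : u ∉ X := fun huX => hvt (hcross u huX v hv hvX h).2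
          simpa [huX, hut, hvX, hvt] using hQ u ⟨⟨hu, huX⟩, hut⟩ v ⟨⟨hv, hvX⟩, hvt⟩ huv
      · have hvt : v ≠ t := by rintro rfl; exact (hlink u).2 h
        by_cases hvX : v ∈ X
        · simp [hvX, (hX.link_closed u v h).2 hvX]
        · have huX : u ∉ X := mt (hX.link_closed u v h).1 hvX
          simpa [huX, hut, hvX, hvt] using hQ u ⟨⟨hu, huX⟩, hut⟩ v ⟨⟨hv, hvX⟩, hvt⟩ huv

/-- All switchings are connected, and have fewer edges than vertices if the number of links is at
most `m`. -/
structure Correct (G : SwGraph V) (m : ℕ) : Prop where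
  conn : ∀ s, G.Valid s → G.Conn s Set.univ
  count : {p : V × V | G.into p.1 p.2 ∧ ¬ G.sw p.2}.ncard + {v | G.sw v}.ncard + m + 1 ≤
    Nat.card V

theorem Correct.pendant [Finite V] [Finite V'] {G : SwGraph V} {G' : SwGraph V'} {m : ℕ}
    (hG : G.Correct m) (f : V → V') (hf : Function.Injective f) (z : V') (a : V)
    (hz : ∀ w, w = z ∨ ∃ v, w = f v) (hfz : ∀ v, f v ≠ z)
    (hsw : ∀ v, G'.sw (f v) ↔ G.sw v) (hinto : ∀ u v, G'.into (f u) (f v) ↔ G.into u v)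
    (hlink : ∀ u v, G.link u v → G'.link (f u) (f v)) (hzt : ∀ u, ¬ G'.into z u)
    (ha : G'.into (f a) z) (hu : ¬ G'.sw z → ∀ u, G'.into u z → u = f a) : G'.Correct m where
  conn s' hs' := by
    have hex : ∀ w, G'.sw w → ∃ u, s' w = f u := fun w hw =>
      (hz (s' w)).resolve_left fun h => hzt w (h ▸ hs' w hw)
    have : ∀ v, ∃ u, G.sw v → s' (f v) = f u := fun v => by
      by_cases h : G.sw v
      · obtain ⟨u, hu⟩ := hex (f v) ((hsw v).2 h)
        exact ⟨u, fun _ => hu⟩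
      · exact ⟨v, fun h' => absurd h' h⟩
    choose s hs using this
    have hv : G.Valid s := fun v hv => by
      rw [← hinto, ← hs v hv]
      exact hs' _ ((hsw v).2 hv)
    intro Q hQ
    have hf' : ∀ u v, f u ∈ Q → f v ∈ Q := fun u v =>
      hG.conn s hv (f ⁻¹' Q) (fun u _ v _ huv => by
        refine hQ (f u) trivial (f v) trivial ?_
        rcases huv with h | h | ⟨h, rfl⟩
        · exact .inl (hlink u v h)
        · exact .inr (.inl ⟨(hinto u v).2 h.1, mt (hsw v).1 h.2⟩)
        · exact .inr (.inr ⟨(hsw v).2 h, hs v h⟩)) u trivial v trivial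
    -- When `z` is switched the attaching vertex `b` is the one chosen, which may differ from `a`.
    obtain ⟨b, hb⟩ : ∃ b, f b ∈ Q ↔ z ∈ Q := by
      by_cases h : G'.sw z
      · obtain ⟨b, hb⟩ := hex z h
        exact ⟨b, hQ _ trivial _ trivial (.inr (.inr ⟨h, hb⟩))⟩
      · exact ⟨a, hQ _ trivial _ trivial (.kept ha h)⟩
    intro u _ v _ huQ
    have hbQ : f b ∈ Q := by
      rcases hz u with rfl | ⟨u, rfl⟩
      · exact hb.2 huQ
      · exact hf' u b huQ
    rcases hz v with rfl | ⟨v, rfl⟩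
    · exact hb.1 hbQ
    · exact hf' b v hbQ
  count := by
    have hV : Nat.card V + 1 ≤ Nat.card V' := by
      rw [← Finite.card_option]
      refine Nat.card_le_card_of_injective (fun o : Option V => o.elim z f) ?_
      rintro (_ | u) (_ | v) h
      · rfl
      · exact absurd h.symm (hfz v)
      · exact absurd h (hfz u)
      · exact congrArg some (hf h)
    have h1 := hG.count
    have h2 := Set.ncard_image_of_injective {p : V × V | G.into p.1 p.2 ∧ ¬ G.sw p.2}
      (hf.prodMap hf)
    have h3 := Set.ncard_image_of_injective {v | G.sw v} hf
    by_cases h : G'.sw z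
    · have h4 : {p : V' × V' | G'.into p.1 p.2 ∧ ¬ G'.sw p.2} ⊆
          Prod.map f f '' {p : V × V | G.into p.1 p.2 ∧ ¬ G.sw p.2} := by
        rintro ⟨u, v⟩ ⟨huv, hv⟩
        obtain ⟨v, rfl⟩ := (hz v).resolve_left (by rintro rfl; exact hv h)
        obtain ⟨u, rfl⟩ := (hz u).resolve_left (by rintro rfl; exact hzt _ huv)
        exact ⟨(u, v), ⟨(hinto u v).1 huv, mt (hsw v).2 hv⟩, rfl⟩
      have h5 : {v | G'.sw v} ⊆ insert z (f '' {v | G.sw v}) := by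
        intro v hv
        rcases hz v with rfl | ⟨v, rfl⟩
        · exact .inl rfl
        · exact .inr ⟨v, (hsw v).1 hv, rfl⟩
      have h6 := Set.ncard_le_ncard h4
      have h7 := Set.ncard_le_ncard h5
      have h8 := Set.ncard_insert_le z (f '' {v | G.sw v})
      omega
    · have h4 : {p : V' × V' | G'.into p.1 p.2 ∧ ¬ G'.sw p.2} ⊆
          insert (f a, z) (Prod.map f f '' {p : V × V | G.into p.1 p.2 ∧ ¬ G.sw p.2}) := by
        rintro ⟨u, v⟩ ⟨huv, hv⟩
        rcases hz v with rfl | ⟨v, rfl⟩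
        · exact .inl (Prod.ext (hu h u huv) rfl)
        · obtain ⟨u, rfl⟩ := (hz u).resolve_left (by rintro rfl; exact hzt _ huv)
          exact .inr ⟨(u, v), ⟨(hinto u v).1 huv, mt (hsw v).2 hv⟩, rfl⟩
      have h5 : {v | G'.sw v} ⊆ f '' {v | G.sw v} := by
        intro v hv
        rcases hz v with rfl | ⟨v, rfl⟩
        · exact absurd hv h
        · exact ⟨v, (hsw v).1 hv, rfl⟩
      have h6 := Set.ncard_le_ncard h4
      have h7 := Set.ncard_le_ncard h5
      have h8 := Set.ncard_insert_le (f a, z)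
        (Prod.map f f '' {p : V × V | G.into p.1 p.2 ∧ ¬ G.sw p.2})
      omega

/-- The disjoint union of two graphs. -/
def sum (G₁ : SwGraph V₁) (G₂ : SwGraph V₂) : SwGraph (V₁ ⊕ V₂) where
  sw := Sum.elim G₁.sw G₂.sw
  into := Sum.LiftRel G₁.into G₂.into
  link := Sum.LiftRel G₁.link G₂.link

/-- The two kept edges into `z` connect the two pieces through `z`. They cost two edges for one
vertex, and the second edge is paid for by merging the two slack terms `+ 1` into one. -/
theorem Correct.join [Finite V₁] [Finite V₂] [Finite V'] {G₁ : SwGraph V₁} {G₂ : SwGraph V₂}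
    {G' : SwGraph V'} {m₁ m₂ m : ℕ} (hG₁ : G₁.Correct m₁) (hG₂ : G₂.Correct m₂)
    (hm : m ≤ m₁ + m₂) (f : V₁ ⊕ V₂ → V') (hf : Function.Injective f) (z : V') (a : V₁) (b : V₂)
    (hz : ∀ w, w = z ∨ ∃ v, w = f v) (hfz : ∀ v, f v ≠ z)
    (hsw : ∀ v, G'.sw (f v) ↔ (G₁.sum G₂).sw v)
    (hinto : ∀ u v, G'.into (f u) (f v) ↔ (G₁.sum G₂).into u v)
    (hlink : ∀ u v, (G₁.sum G₂).link u v → G'.link (f u) (f v)) (hzt : ∀ u, ¬ G'.into z u)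
    (hzs : ¬ G'.sw z) (ha : G'.into (f (.inl a)) z) (hb : G'.into (f (.inr b)) z)
    (hu : ∀ u, G'.into u z → u = f (.inl a) ∨ u = f (.inr b)) : G'.Correct m where
  conn s' hs' := by
    have hex : ∀ v, G'.sw (f v) → ∃ u, s' (f v) = f u ∧ (G₁.sum G₂).into u v := fun v hv => by
      obtain ⟨u, hu⟩ := (hz (s' (f v))).resolve_left fun h => hzt _ (h ▸ hs' _ hv)
      exact ⟨u, hu, (hinto u v).1 (hu ▸ hs' _ hv)⟩
    have h₁ : ∀ v, ∃ u, G₁.sw v → s' (f (.inl v)) = f (.inl u) ∧ G₁.into u v := fun v => by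
      by_cases h : G₁.sw v
      · obtain ⟨u, hu, hi⟩ := hex (.inl v) ((hsw _).2 h)
        cases hi with
        | inl hi => exact ⟨_, fun _ => ⟨hu, hi⟩⟩
      · exact ⟨v, fun h' => absurd h' h⟩
    have h₂ : ∀ v, ∃ u, G₂.sw v → s' (f (.inr v)) = f (.inr u) ∧ G₂.into u v := fun v => by
      by_cases h : G₂.sw v
      · obtain ⟨u, hu, hi⟩ := hex (.inr v) ((hsw _).2 h)
        cases hi with
        | inr hi => exact ⟨_, fun _ => ⟨hu, hi⟩⟩
      · exact ⟨v, fun h' => absurd h' h⟩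
    choose s₁ hs₁ using h₁
    choose s₂ hs₂ using h₂
    intro Q hQ
    have hf₁ : ∀ u v, f (.inl u) ∈ Q → f (.inl v) ∈ Q := fun u v =>
      hG₁.conn s₁ (fun v hv => (hs₁ v hv).2) ((fun v => f (.inl v)) ⁻¹' Q) (fun u _ v _ huv => by
        refine hQ _ trivial _ trivial ?_
        rcases huv with h | h | ⟨h, rfl⟩
        · exact .inl (hlink _ _ (.inl h))
        · exact .inr (.inl ⟨(hinto _ _).2 (.inl h.1), mt (hsw _).1 h.2⟩)
        · exact .inr (.inr ⟨(hsw _).2 h, (hs₁ v h).1⟩)) u trivial v trivial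
    have hf₂ : ∀ u v, f (.inr u) ∈ Q → f (.inr v) ∈ Q := fun u v =>
      hG₂.conn s₂ (fun v hv => (hs₂ v hv).2) ((fun v => f (.inr v)) ⁻¹' Q) (fun u _ v _ huv => by
        refine hQ _ trivial _ trivial ?_
        rcases huv with h | h | ⟨h, rfl⟩
        · exact .inl (hlink _ _ (.inr h))
        · exact .inr (.inl ⟨(hinto _ _).2 (.inr h.1), mt (hsw _).1 h.2⟩)
        · exact .inr (.inr ⟨(hsw _).2 h, (hs₂ v h).1⟩)) u trivial v trivial
    have ha' := hQ _ trivial _ trivial (.kept (s := s') ha hzs)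
    have hb' := hQ _ trivial _ trivial (.kept (s := s') hb hzs)
    intro u _ v _ huQ
    have hzQ : z ∈ Q := by
      rcases hz u with rfl | ⟨u | u, rfl⟩
      · exact huQ
      · exact ha'.1 (hf₁ u a huQ)
      · exact hb'.1 (hf₂ u b huQ)
    rcases hz v with rfl | ⟨v | v, rfl⟩
    · exact hzQ
    · exact hf₁ a v (ha'.2 hzQ)
    · exact hf₂ b v (hb'.2 hzQ)
  count := by
    have hV : Nat.card V₁ + Nat.card V₂ + 1 ≤ Nat.card V' := by
      rw [← Nat.card_sum, ← Finite.card_option]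
      refine Nat.card_le_card_of_injective (fun o : Option (V₁ ⊕ V₂) => o.elim z f) ?_
      rintro (_ | u) (_ | v) h
      · rfl
      · exact absurd h.symm (hfz v)
      · exact absurd h (hfz u)
      · exact congrArg some (hf h)
    have hf₁ : Function.Injective fun v => f (.inl v) := hf.comp Sum.inl_injective
    have hf₂ : Function.Injective fun v => f (.inr v) := hf.comp Sum.inr_injective
    have h1 := hG₁.count
    have h1' := hG₂.count
    set K₁ := {p : V₁ × V₁ | G₁.into p.1 p.2 ∧ ¬ G₁.sw p.2} with hK₁
    set K₂ := {p : V₂ × V₂ | G₂.into p.1 p.2 ∧ ¬ G₂.sw p.2} with hK₂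
    have h2 := Set.ncard_image_of_injective K₁ (hf₁.prodMap hf₁)
    have h2' := Set.ncard_image_of_injective K₂ (hf₂.prodMap hf₂)
    have h3 := Set.ncard_image_of_injective {v | G₁.sw v} hf₁
    have h3' := Set.ncard_image_of_injective {v | G₂.sw v} hf₂
    set I := Prod.map (fun v => f (.inl v)) (fun v => f (.inl v)) '' K₁ ∪
      Prod.map (fun v => f (.inr v)) (fun v => f (.inr v)) '' K₂ with hI
    have h4 : {p : V' × V' | G'.into p.1 p.2 ∧ ¬ G'.sw p.2} ⊆
        insert (f (.inl a), z) (insert (f (.inr b), z) I) := by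
      rintro ⟨u, v⟩ ⟨huv, hv⟩
      rcases hz v with rfl | ⟨v, rfl⟩
      · rcases hu u huv with rfl | rfl
        · exact .inl rfl
        · exact .inr (.inl rfl)
      · obtain ⟨u, rfl⟩ := (hz u).resolve_left (by rintro rfl; exact hzt _ huv)
        have hv' := mt (hsw v).2 hv
        cases (hinto u v).1 huv with
        | inl h => exact .inr (.inr (.inl ⟨(_, _), ⟨h, hv'⟩, rfl⟩))
        | inr h => exact .inr (.inr (.inr ⟨(_, _), ⟨h, hv'⟩, rfl⟩))
    have h5 : {v | G'.sw v} ⊆ (fun v => f (.inl v)) '' {v | G₁.sw v} ∪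
        (fun v => f (.inr v)) '' {v | G₂.sw v} := by
      intro v hv
      rcases hz v with rfl | ⟨v | v, rfl⟩
      · exact absurd hv hzs
      · exact .inl ⟨v, (hsw _).1 hv, rfl⟩
      · exact .inr ⟨v, (hsw _).1 hv, rfl⟩
    have h6 := Set.ncard_le_ncard h4
    have h7 := Set.ncard_le_ncard h5
    have h8 := Set.ncard_insert_le (f (.inl a), z) (insert (f (.inr b), z) I)
    have h9 := Set.ncard_insert_le (f (.inr b), z) I
    have h10 := Set.ncard_union_le (Prod.map (fun v => f (.inl v)) (fun v => f (.inl v)) '' K₁)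
      (Prod.map (fun v => f (.inr v)) (fun v => f (.inr v)) '' K₂)
    rw [← hI] at h10
    have h11 := Set.ncard_union_le ((fun v => f (.inl v)) '' {v | G₁.sw v})
      ((fun v => f (.inr v)) '' {v | G₂.sw v})
    omega

end SwGraph

end FOMLL

/-! ### Most general unifiers by least general generalization. -/

namespace FOMLL

open FirstOrder.Language (Term)

section Generalization

variable {L : FirstOrder.Language.{u, v}} {α Y : Type} {I : Type u}

open Classical in
/-- The least general generalization of a family `F` of terms, by recursion on one of them. Names
in `K` are constants, and `e G` is the variable that stands for the family `G` of terms without a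
common head. -/
noncomputable def lgg (K : Set α) (e : (I → L.Term α) → α) :
    L.Term α → (I → L.Term α) → L.Term α
  | .var a, F => if a ∈ K ∧ ∀ i, F i = .var a then .var a else .var (e F)
  | .func f ts, F =>
    if h : ∀ i, ∃ us, F i = .func f us then
      .func f fun k => lgg K e (ts k) fun i => (h i).choose k
    else .var (e F)

open Classical in
/-- The families of terms which are replaced by variables in `lgg`. -/
noncomputable def lggFamilies : L.Term α → (I → L.Term α) → Set (I → L.Term α)
  | .var _, F => {F}
  | .func f ts, F =>
    if h : ∀ i, ∃ us, F i = .func f us then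
      ⋃ k, lggFamilies (ts k) fun i => (h i).choose k
    else {F}

theorem lggFamilies_finite (t : L.Term α) (F : I → L.Term α) : (lggFamilies t F).Finite := by
  induction t generalizing F with
  | var a => exact Set.finite_singleton F
  | func f ts ih =>
    rw [lggFamilies]
    split_ifs with h
    · exact Set.finite_iUnion fun k => ih k _
    · exact Set.finite_singleton F

/-- Each member of the family is an instance of the generalization: replace the variable standing
for a family by that family's `i`-th member. Only the families that actually occur have to be named
consistently, and these are finitely many. -/
theorem lgg_recover {K : Set α} {e : (I → L.Term α) → α} {ρ : α → L.Term α} {i : I}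
    (hK : ∀ a ∈ K, ρ a = .var a) (t : L.Term α) (F : I → L.Term α)
    (h : ∀ G ∈ lggFamilies t F, ρ (e G) = G i) : (lgg K e t F).subst ρ = F i := by
  induction t generalizing F with
  | var a =>
    rw [lgg]
    split_ifs with h'
    · rw [h'.2 i]
      exact hK a h'.1
    · exact h F rfl
  | func f ts ih =>
    rw [lgg]
    rw [lggFamilies] at h
    split_ifs at h ⊢ with h'
    · rw [(h' i).choose_spec]
      simp only [Term.subst]
      congr 1
      funext k
      exact ih k _ fun G hG => h G (Set.mem_iUnion.2 ⟨k, hG⟩)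
    · exact h F rfl

theorem mem_termVars_lgg {K : Set α} {e : (I → L.Term α) → α} {t : L.Term α} {F : I → L.Term α}
    {a : α} (h : a ∈ termVars (lgg K e t F)) : a ∈ K ∨ ∃ G, a = e G := by
  induction t generalizing F with
  | var b =>
    rw [lgg] at h
    split_ifs at h with h'
    · rw [mem_termVars_var] at h
      exact .inl (h ▸ h'.1)
    · exact .inr ⟨F, by simpa using h⟩
  | func f ts ih =>
    rw [lgg] at h
    split_ifs at h with h'
    · rw [mem_termVars_func] at h
      obtain ⟨k, hk⟩ := h
      exact ih k hk
    · exact .inr ⟨F, by simpa using h⟩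

/-- Generalization sees the common head of the instances `s.subst (τ i)` and descends through `s`,
so it commutes with substitution. This is why the generalization of all unifiers is again a unifier.
-/
theorem lgg_subst (K : Set α) (e : (I → L.Term α) → α) (s : L.Term Y) (i₀ : I)
    (τ : I → Y → L.Term α) :
    lgg K e (s.subst (τ i₀)) (fun i => s.subst (τ i)) =
      s.subst fun y => lgg K e (τ i₀ y) fun i => τ i y := by
  induction s with
  | var y => rfl
  | func f ts ih =>
    simp only [Term.subst]
    rw [lgg]
    have h : ∀ i : I, ∃ us, (Term.func f fun k => (ts k).subst (τ i)) = Term.func f us :=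
      fun i => ⟨_, rfl⟩
    rw [dif_pos h]
    congr 1
    funext k
    rw [← ih k]
    congr 1
    funext i
    have := (h i).choose_spec
    rw [Term.func.injEq] at this
    exact (congrFun (eq_of_heq this.2.2) k).symm

theorem lgg_const {K : Set α} (e : (I → L.Term α) → α) {a : α} (h : a ∈ K) :
    lgg K e (Term.var a) (fun _ => Term.var a) = Term.var a := by
  rw [lgg, if_pos ⟨h, fun _ => rfl⟩]

end Generalization

/-- Equalities holding for every index give an equality of families, hence of any function of the
families. The index `i₀` serves to exclude lists of different lengths. -/
theorem list_map_eq_of_forall {I : Type*} {S T R : Type*} {g : I → S → T} {Φ : (I → T) → R}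
    {as bs : List S} (i₀ : I) (h : ∀ i, as.map (g i) = bs.map (g i)) :
    (as.map fun t => Φ fun i => g i t) = bs.map fun t => Φ fun i => g i t := by
  induction as generalizing bs with
  | nil =>
    cases bs with
    | nil => rfl
    | cons b bs => exact absurd (h i₀) (by simp)
  | cons a as ih =>
    cases bs with
    | nil => exact absurd (h i₀) (by simp)
    | cons b bs =>
      simp only [List.map_cons, List.cons.injEq] at h ⊢
      exact ⟨congrArg Φ (funext fun i => (h i).1), ih fun i => (h i).2⟩

namespace Formula

variable {L : FirstOrder.Language.{u, v}} {X : Type}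

theorem mem_freeVars_of_mem_leafAtom {A : Formula L X} {l : A.Leaf} {x : X}
    (h : Sum.inl x ∈ (A.leafAtom l).vars) : x ∈ A.freeVars := by
  induction A with
  | atom a =>
    obtain ⟨y, hy, h⟩ := Atom.mem_vars_relabel.1 h
    exact Sum.inl_injective h ▸ hy
  | tensor A B ihA ihB | par A B ihA ihB =>
    simp only [freeVars, Finset.mem_union]
    rcases l with l | l
    · obtain ⟨y | y, hy, h⟩ := Atom.mem_vars_relabel.1 h
      · cases h
        exact .inl (ihA hy)
      · cases h
    · obtain ⟨y | y, hy, h⟩ := Atom.mem_vars_relabel.1 h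
      · cases h
        exact .inr (ihB hy)
      · cases h
  | all A ih | ex A ih =>
    simp only [freeVars, Finset.mem_eraseNone]
    obtain ⟨(_ | y) | y, hy, h⟩ := Atom.mem_vars_relabel.1 h
    · cases h
    · cases h
      exact ih hy
    · cases h

theorem kind_of_mem_leafAtom {A : Formula L X} {l : A.Leaf} {w : A.Vertex}
    (h : Sum.inr w ∈ (A.leafAtom l).vars) : A.kind w = .ex ∨ A.kind w = .all := by
  induction A with
  | atom a =>
    obtain ⟨y, hy, h⟩ := Atom.mem_vars_relabel.1 h
    cases h
  | tensor A B ihA ihB | par A B ihA ihB =>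
    rcases l with l | l
    · obtain ⟨y | y, hy, h⟩ := Atom.mem_vars_relabel.1 h
      · cases h
      · cases h
        exact ihA hy
    · obtain ⟨y | y, hy, h⟩ := Atom.mem_vars_relabel.1 h
      · cases h
      · cases h
        exact ihB hy
  | all A ih | ex A ih =>
    obtain ⟨(_ | y) | y, hy, h⟩ := Atom.mem_vars_relabel.1 h
    · cases h
      simp [kind]
    · cases h
    · cases h
      exact ih hy

end Formula

namespace Sequent

variable {L : FirstOrder.Language.{u, v}} {ι : Type} {Γ : Sequent L ι} {θ : Set (Sym2 Γ.Leaf)}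

theorem mem_freeVars_of_mem_leafAtom {l : Γ.Leaf} {x : ℕ}
    (h : Sum.inl x ∈ (Γ.leafAtom l).vars) : x ∈ (Γ l.1).freeVars := by
  obtain ⟨y | y, hy, h⟩ := Atom.mem_vars_relabel.1 h
  · cases h
    exact Formula.mem_freeVars_of_mem_leafAtom hy
  · cases h

theorem kind_of_mem_leafAtom {l : Γ.Leaf} {w : Γ.Vertex}
    (h : Sum.inr w ∈ (Γ.leafAtom l).vars) : Γ.kind w = .ex ∨ Γ.kind w = .all := by
  obtain ⟨y | y, hy, h⟩ := Atom.mem_vars_relabel.1 h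
  · cases h
  · cases h
    exact Formula.kind_of_mem_leafAtom hy

/-- The generalization of the family of all unifiers equalizes the links, and every unifier is an
instance of it. Free variables of the sequent and universal vertices are kept as constants. -/
theorem exists_isMGU [Finite ι] (h : Γ.Unifiable θ) : ∃ σ, Γ.IsMGU θ σ := by
  classical
  have := Fintype.ofFinite ι
  let I := {σ // Γ.IsUnifier θ σ}
  obtain ⟨σ₀, hσ₀⟩ := h
  let i₀ : I := ⟨σ₀, hσ₀⟩
  let fam : Γ.Vertex → I → L.Term (ℕ ⊕ Γ.Vertex) := fun w i => i.1 w
  let Fs : Set (I → L.Term (ℕ ⊕ Γ.Vertex)) := ⋃ w, lggFamilies (σ₀ w) (fam w)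
  have hFs : Fs.Finite := Set.finite_iUnion fun w => lggFamilies_finite _ _
  obtain ⟨g, hg⟩ := Set.countable_iff_exists_injOn.1 hFs.countable
  let fv : Finset ℕ := Finset.univ.biUnion fun i => (Γ i).freeVars
  have hfv : ∀ i, ∀ x ∈ (Γ i).freeVars, x ∈ fv := fun i x hx =>
    Finset.mem_biUnion.2 ⟨i, Finset.mem_univ i, hx⟩
  -- The shift by `fv.sup id + 1` puts the new variables beyond all free variables of the sequent,
  -- and `g` keeps distinct families of `Fs` apart.
  let n : (I → L.Term (ℕ ⊕ Γ.Vertex)) → ℕ := fun F => g F + fv.sup id + 1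
  have hn : ∀ F, n F ∉ fv := fun F hF => by
    have := Finset.le_sup (f := id) hF
    simp only [id, n] at this
    omega
  let K : Set (ℕ ⊕ Γ.Vertex) := {a | (∃ x ∈ fv, a = .inl x) ∨ ∃ w, Γ.kind w = .all ∧ a = .inr w}
  let e : (I → L.Term (ℕ ⊕ Γ.Vertex)) → ℕ ⊕ Γ.Vertex := fun F => .inl (n F)
  let μ : Γ.Vertex → L.Term (ℕ ⊕ Γ.Vertex) := fun w =>
    if Γ.IsEssentialEx w then lgg K e (σ₀ w) (fam w) else .var (.inr w)
  -- Applying `μ` to a term at a leaf is the same as generalizing the family of its instances. All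
  -- non-existential names occurring at leaves belong to `K`, so they are left alone.
  have hμ : ∀ l, ∀ t ∈ (Γ.leafAtom l).termSeq,
      t.subst (Sum.elim (fun x => .var (Sum.inl x)) μ) =
        lgg K e (t.subst (Sum.elim (fun x => .var (Sum.inl x)) σ₀))
          fun i : I => t.subst (Sum.elim (fun x => .var (Sum.inl x)) i.1) := by
    intro l t ht
    rw [lgg_subst K e t i₀ fun i : I => Sum.elim (fun x => .var (Sum.inl x)) i.1]
    refine term_subst_congr fun y hy => ?_
    obtain ⟨k, rfl⟩ := Atom.mem_termSeq.1 ht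
    have hy' := Atom.mem_vars.2 ⟨k, hy⟩
    rcases y with x | w
    · refine (lgg_const e ?_).symm
      exact .inl ⟨x, hfv _ _ (mem_freeVars_of_mem_leafAtom hy'), rfl⟩
    · by_cases hw : Γ.IsEssentialEx w
      · simp [μ, hw, fam, i₀]
      · have hk : Γ.kind w = .all :=
          (kind_of_mem_leafAtom hy').resolve_left fun h => hw ⟨h, l, hy'⟩
        simp only [μ, hw, if_false, Sum.elim_inr]
        have : ∀ i : I, i.1 w = .var (.inr w) := fun i => i.2.eq_var w hw
        simp only [this]
        exact (lgg_const e (.inr ⟨w, hk, rfl⟩)).symm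
  refine ⟨μ, ⟨fun w hw => by simp [μ, hw], ?_, ?_⟩, ?_⟩
  · intro w hw y hy
    simp only [μ, hw, if_true] at hy
    rcases mem_termVars_lgg hy with (⟨x, _, h⟩ | ⟨w, hw, h⟩) | ⟨G, h⟩
    · cases h
    · cases h
      exact hw
    · cases h
  · intro l l' hll
    rw [Atom.termSeq_subst, Atom.termSeq_subst, List.map_congr_left (hμ l),
      List.map_congr_left (hμ l')]
    refine list_map_eq_of_forall (g := fun (i : I) (t : L.Term (ℕ ⊕ Γ.Vertex)) =>
      t.subst (Sum.elim (fun x => .var (Sum.inl x)) i.1)) (Φ := fun F => lgg K e (F i₀) F) i₀ ?_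
    intro i
    have := i.2.equalizes l l' hll
    rwa [Atom.termSeq_subst, Atom.termSeq_subst] at this
  · intro τ hτ
    let i : I := ⟨τ, hτ⟩
    -- A number that names a family in `Fs` goes to the value of this family at `τ`; every other
    -- variable, in particular every free variable of the sequent, stays fixed.
    let ρ : ℕ → L.Term (ℕ ⊕ Γ.Vertex) := fun m =>
      if h : m ∉ fv ∧ ∃ G ∈ Fs, n G = m then h.2.choose i else .var (.inl m)
    refine ⟨ρ, fun j x hx => by simp [ρ, hfv j x hx], fun w hw => ?_⟩
    simp only [μ, hw, if_true]
    refine (lgg_recover (i := i) ?_ (σ₀ w) (fam w) ?_).symm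
    · rintro a (⟨x, hx, rfl⟩ | ⟨w, _, rfl⟩)
      · simp [ρ, hx]
      · rfl
    · intro G hG
      have hG' : G ∈ Fs := Set.mem_iUnion.2 ⟨w, hG⟩
      have h : n G ∉ fv ∧ ∃ G' ∈ Fs, n G' = n G := ⟨hn G, G, hG', rfl⟩
      have hc := h.2.choose_spec
      have : h.2.choose = G := hg hc.1 hG' (by simpa [n] using hc.2)
      simp only [e, Sum.elim_inl, ρ]
      rw [dif_pos h, this]

end Sequent

end FOMLL

/-! ### Witnesses, and correctness in terms of their graphs. -/

namespace FOMLL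

open FirstOrder.Language (Term)

namespace Formula

variable {L : FirstOrder.Language.{u, v}} {X : Type}

/-- The root of the parse tree of a formula. -/
def root : {X : Type} → (A : Formula L X) → A.Vertex
  | _, atom _ => ()
  | _, tensor _ _ => none
  | _, par _ _ => none
  | _, all _ => none
  | _, ex _ => none

theorem parent_eq_none_iff {A : Formula L X} {w : A.Vertex} : A.parent w = none ↔ w = A.root := by
  cases A with
  | atom a => exact iff_of_true rfl rfl
  | tensor A B | par A B =>
    rcases w with _ | w | w
    · exact iff_of_true rfl rfl
    · exact iff_of_false nofun nofun
    · exact iff_of_false nofun nofun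
  | all A | ex A =>
    rcases w with _ | w
    · exact iff_of_true rfl rfl
    · exact iff_of_false nofun nofun

theorem exists_parent_eq {A : Formula L X} {w : A.Vertex} (h : A.kind w ≠ .atom) :
    ∃ c, A.parent c = some w := by
  induction A with
  | atom a => exact absurd rfl h
  | tensor A B ihA ihB | par A B ihA ihB =>
    rcases w with _ | w | w
    · exact ⟨some (.inl A.root), by simp [parent, parent_eq_none_iff.2 rfl]⟩
    · obtain ⟨c, hc⟩ := ihA h
      exact ⟨some (.inl c), by simp [parent, hc]⟩
    · obtain ⟨c, hc⟩ := ihB h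
      exact ⟨some (.inr c), by simp [parent, hc]⟩
  | all A ih | ex A ih =>
    rcases w with _ | w
    · exact ⟨some A.root, by simp [parent, parent_eq_none_iff.2 rfl]⟩
    · obtain ⟨c, hc⟩ := ih h
      exact ⟨some c, by simp [parent, hc]⟩

end Formula

namespace Sequent

variable {L : FirstOrder.Language.{u, v}} {ι : Type} {Γ : Sequent L ι} {θ : Set (Sym2 Γ.Leaf)}
  {σ : Γ.Vertex → L.Term (ℕ ⊕ Γ.Vertex)}

/-- An assignment to all existential variables, vacuous or not, which equalizes all links. -/
structure Witness (Γ : Sequent L ι) (θ : Set (Sym2 Γ.Leaf))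
    (σ : Γ.Vertex → L.Term (ℕ ⊕ Γ.Vertex)) : Prop where
  eq_var : ∀ w, Γ.kind w ≠ .ex → σ w = .var (.inr w)
  universal : ∀ w, Γ.kind w = .ex → ∀ y, Sum.inr y ∈ termVars (σ w) → Γ.kind y = .all
  equalizes : ∀ l l', s(l, l') ∈ θ →
    ((Γ.leafAtom l).subst (Sum.elim (fun x => .var (Sum.inl x)) σ)).termSeq =
      ((Γ.leafAtom l').subst (Sum.elim (fun x => .var (Sum.inl x)) σ)).termSeq

/-- The leaps given by an assignment. -/
def Leap (Γ : Sequent L ι) (σ : Γ.Vertex → L.Term (ℕ ⊕ Γ.Vertex)) (x y : Γ.Vertex) : Prop :=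
  Γ.kind x = .ex ∧ Sum.inr y ∈ termVars (σ x)

/-- The graph of a linking with the leaps given by an assignment. -/
def netGraph (Γ : Sequent L ι) (θ : Set (Sym2 Γ.Leaf)) (σ : Γ.Vertex → L.Term (ℕ ⊕ Γ.Vertex)) :
    SwGraph Γ.Vertex where
  sw := Γ.IsSwitched
  into u v := Γ.parent u = some v ∨ Γ.Leap σ u v
  link u v := ∃ l l', s(l, l') ∈ θ ∧ Γ.leafVertex l = u ∧ Γ.leafVertex l' = v

open Classical in
theorem Witness.isUnifier (hσ : Γ.Witness θ σ) :
    Γ.IsUnifier θ fun w => if Γ.IsEssentialEx w then σ w else .var (.inr w) := by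
  refine ⟨fun w hw => by simp [hw], fun w hw y hy => ?_, fun l l' hl => ?_⟩
  · simp only [hw, if_true] at hy
    exact hσ.universal w hw.1 y hy
  · have : ∀ l, (Γ.leafAtom l).subst (Sum.elim (fun x => .var (Sum.inl x))
        fun w => if Γ.IsEssentialEx w then σ w else .var (.inr w)) =
        (Γ.leafAtom l).subst (Sum.elim (fun x => .var (Sum.inl x)) σ) := by
      intro l
      refine Atom.subst_congr ?_
      rintro (x | w) hw
      · rfl
      · by_cases hwe : Γ.IsEssentialEx w
        · simp [hwe]
        · simp only [Sum.elim_inr, hwe, if_false]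
          exact (hσ.eq_var w fun h => hwe ⟨h, l, hw⟩).symm
    rw [this, this]
    exact hσ.equalizes l l' hl

/-- The witness is an instance of the most general unifier by a substitution that fixes universal
variables, so a universal variable occurring in the latter also occurs in the witness. Thus any
witness has at least the leaps of the linking. -/
theorem Precedes.leap (hσ : Γ.Witness θ σ) {x y : Γ.Vertex} (h : Γ.Precedes θ x y) :
    Γ.Leap σ x y := by
  obtain ⟨hx, hy, σ₀, hσ₀, hxy⟩ := h
  refine ⟨hx, ?_⟩
  have hxe : Γ.IsEssentialEx x := by
    by_contra hxe
    rw [hσ₀.1.eq_var x hxe, mem_termVars_var, Sum.inr.injEq] at hxy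
    subst hxy
    rw [hx] at hy
    cases hy
  obtain ⟨ρ, -, hρ⟩ := hσ₀.2 _ hσ.isUnifier
  have := hρ x hxe
  simp only [hxe, if_true] at this
  rw [this, mem_termVars_subst]
  exact ⟨_, hxy, by simp⟩

theorem Witness.unifiable (hσ : Γ.Witness θ σ) : Γ.Unifiable θ := ⟨_, hσ.isUnifier⟩

/-- A linking is good if it has a witness whose graph is correct. -/
def Good (Γ : Sequent L ι) (θ : Set (Sym2 Γ.Leaf)) : Prop :=
  ∃ σ, Γ.Witness θ σ ∧ (Γ.netGraph θ σ).Correct θ.ncard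

/-- A switching of the linking is connected because it realizes a switching of the larger graph of
the witness. Counting its edges then bounds |V| on both sides, and equality throughout excludes
loops, parallel edges and cycles. -/
theorem isTree_of_correct [Finite ι] (hσ : Γ.Witness θ σ)
    (hG : (Γ.netGraph θ σ).Correct θ.ncard) {S : Set Γ.Edge} (hS : Γ.IsSwitching θ S) :
    Γ.IsTree S := by
  classical
  have hch : ∀ z, ∃ u, Γ.IsSwitched z → (Γ.netGraph θ σ).into u z ∧
      ∃ e ∈ S, e.Into z ∧ e.ends = s(u, z) := by
    intro z
    by_cases hz : Γ.IsSwitched z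
    · obtain ⟨e, ⟨heS, hez⟩, -⟩ := hS.choose z hz
      have heg := hS.subset heS
      rcases e with ⟨w, p⟩ | e | ⟨x, y⟩
      · cases hez
        exact ⟨w, fun _ => ⟨.inl heg, _, heS, rfl, rfl⟩⟩
      · exact hez.elim
      · cases hez
        exact ⟨x, fun _ => ⟨.inr (Precedes.leap hσ heg), _, heS, rfl, rfl⟩⟩
    · exact ⟨z, fun h => absurd h hz⟩
  choose s hs using hch
  have hedge : ∀ u v, (Γ.netGraph θ σ).Edge s u v → ∃ e ∈ S, e.ends = s(u, v) := by
    rintro u v (⟨l, l', hl, rfl, rfl⟩ | ⟨h | h, hv⟩ | ⟨h, rfl⟩)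
    · exact ⟨.link s(l, l'), hS.keep _ hl fun z _ h => h, rfl⟩
    · refine ⟨.tree u v, hS.keep _ h ?_, rfl⟩
      rintro z hz rfl
      exact hv hz
    · exact absurd (.inr (hσ.universal u h.1 v h.2)) hv
    · obtain ⟨-, e, he, -, h'⟩ := hs v h
      exact ⟨e, he, h'⟩
  set H := SimpleGraph.fromEdgeSet (Edge.ends '' S) with hH
  have hpre : H.Preconnected := by
    intro u v
    refine hG.conn s (fun v hv => (hs v hv).1) {w | H.Reachable u w} ?_ u trivial v trivial
      (SimpleGraph.Reachable.refl u)
    intro a _ b _ hab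
    obtain ⟨e, he, hee⟩ := hedge a b hab
    have : H.Reachable a b := by
      by_cases hne : a = b
      · subst hne
        exact SimpleGraph.Reachable.refl a
      · refine SimpleGraph.Adj.reachable ?_
        rw [hH, SimpleGraph.fromEdgeSet_adj]
        exact ⟨⟨e, he, hee⟩, hne⟩
    exact ⟨fun h => h.trans this, fun h => h.trans this.symm⟩
  have hcount := hG.count
  set Kp := {p : Γ.Vertex × Γ.Vertex | (Γ.netGraph θ σ).into p.1 p.2 ∧
    ¬ (Γ.netGraph θ σ).sw p.2} with hKp
  set W := {v | (Γ.netGraph θ σ).sw v} with hW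
  have hce : ∀ z, ∃ e : Γ.Edge, Γ.IsSwitched z → ∀ e' ∈ S, e'.Into z → e' = e := by
    intro z
    by_cases hz : Γ.IsSwitched z
    · obtain ⟨e, -, he⟩ := hS.choose z hz
      exact ⟨e, fun _ e' h h' => he e' ⟨h, h'⟩⟩
    · exact ⟨.leap z z, fun h => absurd h hz⟩
  choose ce hce using hce
  -- The three parts match the three terms of the count: kept tree edges, one edge for each switched
  -- vertex, and links.
  have hsub : S ⊆ (fun p : Γ.Vertex × Γ.Vertex => Edge.tree p.1 p.2) '' Kp ∪ ce '' W ∪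
      Edge.link '' θ := by
    intro e he
    have heg := hS.subset he
    rcases e with ⟨w, p⟩ | e | ⟨x, y⟩
    · by_cases hp : Γ.IsSwitched p
      · exact .inl (.inr ⟨p, hp, (hce p hp _ he rfl).symm⟩)
      · exact .inl (.inl ⟨(w, p), ⟨.inl heg, hp⟩, rfl⟩)
    · exact .inr ⟨e, heg, rfl⟩
    · have hy : Γ.IsSwitched y := .inr heg.2.1
      exact .inl (.inr ⟨y, hy, (hce y hy _ he rfl).symm⟩)
  have hfin : ((fun p : Γ.Vertex × Γ.Vertex => Edge.tree p.1 p.2) '' Kp ∪ ce '' W ∪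
      (Edge.link '' θ : Set Γ.Edge)).Finite :=
    (((Set.toFinite _).image _).union ((Set.toFinite _).image _)).union ((Set.toFinite _).image _)
  have hSfin := hfin.subset hsub
  have h1 := Set.ncard_le_ncard hsub hfin
  have h2 := Set.ncard_union_le ((fun p : Γ.Vertex × Γ.Vertex => (Edge.tree p.1 p.2 : Γ.Edge)) '' Kp ∪
    ce '' W) (Edge.link '' θ)
  have h3 := Set.ncard_union_le
    ((fun p : Γ.Vertex × Γ.Vertex => (Edge.tree p.1 p.2 : Γ.Edge)) '' Kp) (ce '' W)
  have h4 := Set.ncard_image_le (f := fun p : Γ.Vertex × Γ.Vertex => (Edge.tree p.1 p.2 : Γ.Edge))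
    (Set.toFinite Kp)
  have h5 := Set.ncard_image_le (f := ce) (Set.toFinite W)
  have h6 := Set.ncard_image_le (f := (Edge.link : _ → Γ.Edge)) (Set.toFinite θ)
  have hne : Nonempty Γ.Vertex := Finite.card_pos_iff.1 (by omega)
  have hconn : H.Connected := ⟨hpre⟩
  have h7 := hconn.card_vert_le_card_edgeSet_add_one
  have h8 : H.edgeSet ⊆ Edge.ends '' S := by
    rw [hH, SimpleGraph.edgeSet_fromEdgeSet]
    exact Set.sdiff_subset
  have h9 := Set.ncard_le_ncard h8 (Set.toFinite _)
  have h10 := Set.ncard_image_le (f := (Edge.ends : Γ.Edge → _)) hSfin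
  rw [Nat.card_coe_set_eq] at h7
  -- The chain |V| ≤ |E(H)| + 1 ≤ |ends '' S| + 1 ≤ |S| + 1 ≤ |V| collapses. Passing to the simple
  -- graph `H` loses no edge, so there are no loops.
  have h11 : H.edgeSet = Edge.ends '' S := Set.eq_of_subset_of_ncard_le h8 (by omega)
  refine ⟨?_, (Set.ncard_image_iff hSfin).1 (by omega), ?_⟩
  · intro e he
    exact H.not_isDiag_of_mem_edgeSet (h11 ▸ ⟨e, he, rfl⟩)
  · rw [← hH, SimpleGraph.isTree_iff_connected_and_card]
    refine ⟨hconn, ?_⟩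
    rw [Nat.card_coe_set_eq]
    omega

theorem Good.correct [Finite ι] (h : Γ.Good θ) : Γ.Correct θ := by
  obtain ⟨σ, hσ, hG⟩ := h
  exact ⟨hσ.unifiable, fun S hS => isTree_of_correct hσ hG hS⟩

theorem exists_parent_eq {w : Γ.Vertex} (h : Γ.IsSwitched w) : ∃ c, Γ.parent c = some w := by
  obtain ⟨i, w⟩ := w
  obtain ⟨c, hc⟩ := Formula.exists_parent_eq (A := Γ i) (w := w) (by
    rintro h'
    rcases h with h | h <;> exact absurd (h.symm.trans h') (by simp))
  exact ⟨⟨i, c⟩, by simp [parent, hc]⟩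

theorem exists_valid (Γ : Sequent L ι) (θ : Set (Sym2 Γ.Leaf))
    (σ : Γ.Vertex → L.Term (ℕ ⊕ Γ.Vertex)) : ∃ s, (Γ.netGraph θ σ).Valid s := by
  have : ∀ z, ∃ c, Γ.IsSwitched z → Γ.parent c = some z := fun z => by
    by_cases h : Γ.IsSwitched z
    · obtain ⟨c, hc⟩ := exists_parent_eq h
      exact ⟨c, fun _ => hc⟩
    · exact ⟨z, fun h' => absurd h' h⟩
  choose s hs using this
  exact ⟨s, fun v hv => .inl (hs v hv)⟩

/-- For a witness with exactly the leaps of the linking, a choice of predecessors is a switching.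
The tree property is then kept in the two forms used by sequentialization: connectivity, and the
bridge property of edges into unswitched vertices. -/
theorem exists_witness_of_correct [Finite ι] (h : Γ.Correct θ) : ∃ σ, Γ.Witness θ σ ∧
    (∀ s, (Γ.netGraph θ σ).Valid s → (Γ.netGraph θ σ).Conn s Set.univ) ∧
    (Γ.netGraph θ σ).Bridges ∧ Nonempty Γ.Vertex := by
  classical
  obtain ⟨hu, hS⟩ := h
  obtain ⟨μ, hμ⟩ := exists_isMGU hu
  -- Vacuous existentials also need a term; a free variable creates no leap, and which one is
  -- immaterial.
  set σ : Γ.Vertex → L.Term (ℕ ⊕ Γ.Vertex) := fun w =>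
    if Γ.kind w = .ex ∧ ¬ Γ.IsEssentialEx w then .var (.inl 0) else μ w with hσ
  have hess : ∀ w, Γ.IsEssentialEx w → σ w = μ w := fun w hw => by simp [hσ, hw]
  have hW : Γ.Witness θ σ := by
    refine ⟨fun w hw => ?_, fun w hw y hy => ?_, fun l l' hl => ?_⟩
    · simp only [hσ, hw, false_and, if_false]
      exact hμ.1.eq_var w fun h => hw h.1
    · by_cases he : Γ.IsEssentialEx w
      · rw [hess w he] at hy
        exact hμ.1.universal w he y hy
      · simp [hσ, hw, he] at hy
    · have : ∀ l, (Γ.leafAtom l).subst (Sum.elim (fun x => .var (Sum.inl x)) σ) =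
          (Γ.leafAtom l).subst (Sum.elim (fun x => .var (Sum.inl x)) μ) := by
        intro l
        refine Atom.subst_congr ?_
        rintro (x | w) hw
        · rfl
        · by_cases hwk : Γ.kind w = .ex
          · exact hess w ⟨hwk, l, hw⟩
          · simp [hσ, hwk]
      rw [this, this]
      exact hμ.1.equalizes l l' hl
  have hleap : ∀ x y, Γ.Leap σ x y → Γ.Precedes θ x y := by
    intro x y h
    refine ⟨h.1, hW.universal x h.1 y h.2, μ, hμ, ?_⟩
    by_cases he : Γ.IsEssentialEx x
    · exact hess x he ▸ h.2
    · have := h.2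
      simp [hσ, h.1, he] at this
  have hsw : ∀ s, (Γ.netGraph θ σ).Valid s → ∃ S, Γ.IsTree S ∧
      (∀ u v, (Γ.netGraph θ σ).Edge s u v →
        ∃ e ∈ S, e.ends = s(u, v) ∧ ∀ c t, e = .tree c t → (u, v) = (c, t)) ∧
      (∀ e ∈ S, ∃ u v, e.ends = s(u, v) ∧ (Γ.netGraph θ σ).Edge s u v) ∧
      ∀ c t, Γ.parent c = some t → ¬ Γ.IsSwitched t → .tree c t ∈ S := by
    intro s hs
    -- An existential directly above a universal may have both a tree edge and a leap to it. A
    -- choice of vertices does not distinguish the two, so the tree edge is preferred.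
    let ce : Γ.Vertex → Γ.Edge := fun z =>
      if Γ.parent (s z) = some z then .tree (s z) z else .leap (s z) z
    have hce : ∀ z, Γ.IsSwitched z → ce z ∈ Γ.graph θ := by
      intro z hz
      by_cases hp : Γ.parent (s z) = some z
      · simp only [ce, hp, if_true]
        exact hp
      · simp only [ce, hp, if_false]
        exact hleap _ _ ((hs z hz).resolve_left hp)
    have hce' : ∀ z y, (ce z).Into y ↔ z = y := by
      intro z y
      by_cases hp : Γ.parent (s z) = some z <;> simp [ce, hp, Edge.Into]
    let S : Set Γ.Edge := {e | e ∈ Γ.graph θ ∧ ∀ z, Γ.IsSwitched z → e.Into z → e = ce z}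
    have hceS : ∀ z, Γ.IsSwitched z → ce z ∈ S := fun z hz =>
      ⟨hce z hz, fun y _ h' => by rw [(hce' z y).1 h']⟩
    refine ⟨S, hS S ⟨fun e he => he.1, fun e he h => ⟨he, fun z hz h' => absurd h' (h z hz)⟩,
      fun z hz => ⟨ce z, ⟨hceS z hz, (hce' z z).2 rfl⟩, fun e he => he.1.2 z hz he.2⟩⟩, ?_, ?_,
      fun c t hct ht => ⟨hct, by rintro z hz rfl; exact absurd hz ht⟩⟩
    rotate_left
    · rintro e ⟨heg, hec⟩
      have hcs : ∀ z, Γ.IsSwitched z → (ce z).ends = s(s z, z) := fun z hz => by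
        by_cases hp : Γ.parent (s z) = some z <;> simp [ce, hp, Edge.ends]
      rcases e with ⟨w, p⟩ | e | ⟨x, y⟩
      · by_cases hp : Γ.IsSwitched p
        · exact ⟨s p, p, hec p hp rfl ▸ hcs p hp, .chosen hp⟩
        · exact ⟨w, p, rfl, .kept (.inl heg) hp⟩
      · induction e using Sym2.ind with
        | _ l l' => exact ⟨_, _, rfl, .link ⟨l, l', heg, rfl, rfl⟩⟩
      · have hy : Γ.IsSwitched y := .inr heg.2.1
        exact ⟨s y, y, hec y hy rfl ▸ hcs y hy, .chosen hy⟩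
    rintro u v (⟨l, l', hl, rfl, rfl⟩ | ⟨h | h, hv⟩ | ⟨h, rfl⟩)
    · exact ⟨.link s(l, l'), ⟨hl, fun z _ h => h.elim⟩, rfl, fun c t h => by cases h⟩
    · refine ⟨.tree u v, ⟨h, ?_⟩, rfl, fun c t h => by cases h; rfl⟩
      rintro z hz rfl
      exact absurd hz hv
    · exact absurd (.inr (hW.universal u h.1 v h.2)) hv
    · refine ⟨ce v, hceS v h, ?_, fun c t => ?_⟩
      · by_cases hp : Γ.parent (s v) = some v <;> simp [ce, hp, Edge.ends]
      · by_cases hp : Γ.parent (s v) = some v <;> simp [ce, hp]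
  obtain ⟨s₀, hs₀⟩ := exists_valid Γ θ σ
  obtain ⟨S₀, hS₀, -⟩ := hsw s₀ hs₀
  refine ⟨σ, hW, ?_, ?_, hS₀.2.2.connected.nonempty⟩
  · intro s hs Q hQ u _ v _ huQ
    obtain ⟨S, hS, -, hedge, -⟩ := hsw s hs
    obtain ⟨p⟩ := hS.2.2.connected.preconnected u v
    induction p with
    | nil => exact huQ
    | cons hadj _ ih =>
      refine ih trivial trivial ?_
      rw [SimpleGraph.fromEdgeSet_adj] at hadj
      obtain ⟨⟨e, he, hee⟩, -⟩ := hadj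
      obtain ⟨a, b, hab, hE⟩ := hedge e he
      have hQab := hQ a trivial b trivial hE
      rcases Sym2.eq_iff.1 (hab.symm.trans hee) with ⟨rfl, rfl⟩ | ⟨rfl, rfl⟩
      · exact hQab.1 huQ
      · exact hQab.2 huQ
  · intro s hs c t hct ht
    obtain ⟨S, hS, hedge, -, htree⟩ := hsw s hs
    set H := SimpleGraph.fromEdgeSet (Edge.ends '' S) with hH
    have he₀ := htree c t
      (hct.resolve_right fun h => ht (.inr (hW.universal c h.1 t h.2))) ht
    have hadj : H.Adj c t := by
      rw [hH, SimpleGraph.fromEdgeSet_adj]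
      refine ⟨⟨_, he₀, rfl⟩, fun h => hS.1 _ he₀ ?_⟩
      rw [h]
      exact rfl
    have hbr := SimpleGraph.isBridge_iff.1
      (SimpleGraph.isAcyclic_iff_forall_adj_isBridge.1 hS.2.2.isAcyclic hadj)
    refine ⟨{w | (H.deleteEdges {s(c, t)}).Reachable c w}, SimpleGraph.Reachable.refl c, hbr, ?_⟩
    intro a b hab hne
    obtain ⟨e, he, hee, hnt⟩ := hedge a b hab
    have : (H.deleteEdges {s(c, t)}).Reachable a b := by
      by_cases hab' : a = b
      · subst hab'
        exact SimpleGraph.Reachable.refl a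
      · refine SimpleGraph.Adj.reachable ?_
        rw [SimpleGraph.deleteEdges_adj, hH, SimpleGraph.fromEdgeSet_adj]
        -- An edge with the ends `c`, `t` would be the tree edge itself, since a switching has no
        -- parallel edges; and that edge comes only from the pair `(c, t)`.
        refine ⟨⟨⟨e, he, hee⟩, hab'⟩, fun h => hne (hnt c t (hS.2.1 he he₀ (hee.trans h)))⟩
    exact ⟨fun h => h.trans this, fun h => h.trans this.symm⟩

end Sequent

end FOMLL

/-! ### Provability of labelled sequents, and formulas standing for cuts. -/

namespace FOMLL

open FirstOrder.Language (Term)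

namespace LForm

variable {L : FirstOrder.Language.{u, v}} {Λ X : Type}

theorem tensor_injective {x y x' y' : LForm L Λ X} (h : x.tensor y = x'.tensor y') :
    x = x' ∧ y = y' := by
  obtain ⟨A, a⟩ := x
  obtain ⟨B, b⟩ := y
  obtain ⟨A', a'⟩ := x'
  obtain ⟨B', b'⟩ := y'
  have h₁ : Formula.tensor A B = .tensor A' B' := congrArg Sigma.fst h
  obtain ⟨rfl, rfl⟩ := Formula.tensor.inj h₁
  have h : (Sum.elim a b : A.Leaf ⊕ B.Leaf → Λ) = Sum.elim a' b' := eq_of_heq (Sigma.mk.inj h).2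
  refine ⟨Sigma.ext rfl (heq_of_eq (funext fun l => congrFun h (.inl l))),
    Sigma.ext rfl (heq_of_eq (funext fun l => congrFun h (.inr l)))⟩

theorem ex_injective {x x' : LForm L Λ (Option X)} (h : x.ex = x'.ex) : x = x' := by
  obtain ⟨A, a⟩ := x
  obtain ⟨A', a'⟩ := x'
  have h₁ : Formula.ex A = .ex A' := congrArg Sigma.fst h
  obtain rfl := Formula.ex.inj h₁
  exact Sigma.ext rfl (Sigma.mk.inj h).2

end LForm

/-- Components of a cut sequent whose leaves carry labels. -/
abbrev LItem {L : FirstOrder.Language.{u, v}} (D : Duality L) (Λ : Type) :=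
  Σ I : Item L, I.Leaf D → Λ

section Prov

variable {L : FirstOrder.Language.{u, v}} {D : Duality L} {Λ ι κ : Type}

def LItem.formula (x : LForm L Λ ℕ) : LItem D Λ := ⟨.formula x.1, x.2⟩

def LItem.cut (A : Formula L ℕ) (lab : A.Leaf ⊕ (A.neg D).Leaf → Λ) : LItem D Λ := ⟨.cut A, lab⟩

/-- The family `x, K`. -/
def lcons {T : Type*} (x : T) (K : ι → T) : Option ι → T
  | none => x
  | some i => K i

/-- The set `Θ` of pairs of labels is the translation of some proof. -/
def Prov (K : ι → LItem D Λ) (Θ : Set (Sym2 Λ)) : Prop :=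
  ∃ π : Proof D fun i => (K i).1, Sym2.map (fun l => (K l.1).2 l.2) '' π.translate = Θ

/-- Separates a labelled family into shapes and labels. With shapes of the form `CutSequent.cons`
and `CutSequent.append`, the rules of `Proof` apply without casts. -/
theorem prov_iff {K : ι → LItem D Λ} {Θ : Set (Sym2 Λ)} (Γ : CutSequent L ι)
    (lab : ∀ i, (Γ i).Leaf D → Λ) (h : ∀ i, K i = ⟨Γ i, lab i⟩) :
    Prov K Θ ↔ ∃ π : Proof D Γ,
      Sym2.map (fun l : Γ.Leaf D => lab l.1 l.2) '' π.translate = Θ := by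
  obtain rfl : K = fun i => ⟨Γ i, lab i⟩ := funext h
  exact Iff.rfl

theorem image_sym2_map_comp {S T : Type*} (f : S → T) (g : T → Λ) (h : S → Λ)
    (hfg : ∀ s, g (f s) = h s) (A : Set (Sym2 S)) :
    Sym2.map g '' (Sym2.map f '' A) = Sym2.map h '' A := by
  rw [← Set.image_comp, ← Sym2.map_comp, show g ∘ f = h from funext hfg]

theorem Prov.reindex {K : κ → LItem D Λ} {Θ : Set (Sym2 Λ)} (f : ι → κ)
    (hf : Function.Bijective f) (h : Prov (fun i => K (f i)) Θ) : Prov K Θ := by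
  obtain ⟨π, hπ⟩ := h
  refine ⟨.reindex (Equiv.ofBijective f hf) (fun j => (K j).1) π, ?_⟩
  rw [← hπ]
  exact image_sym2_map_comp _ _ _ (fun _ => rfl) _

theorem Prov.ax (a : Atom L ℕ) (u v : Λ) :
    Prov (lcons (LItem.formula (LForm.atom a u))
      fun _ : Unit => LItem.formula (LForm.atom (a.neg D) v) : Option Unit → LItem D Λ)
      {s(u, v)} := by
  refine (prov_iff (CutSequent.cons (.formula (.atom a)) fun _ => .formula (.atom (a.neg D)))
    (fun | none => fun _ => u | some _ => fun _ => v) (by rintro (_ | _) <;> rfl)).2 ⟨.ax a, ?_⟩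
  exact Set.image_singleton

theorem Prov.par {K : ι → LItem D Λ} {Θ : Set (Sym2 Λ)} {x y : LForm L Λ ℕ}
    (h : Prov (lcons (.formula x) (lcons (.formula y) K)) Θ) :
    Prov (lcons (.formula (x.par y)) K) Θ := by
  obtain ⟨π, hπ⟩ := (prov_iff
    (CutSequent.cons (.formula x.1) (CutSequent.cons (.formula y.1) fun i => (K i).1))
    (fun | none => x.2 | some none => y.2 | some (some i) => (K i).2)
    (by rintro (_ | _ | _) <;> rfl)).1 h
  refine (prov_iff (CutSequent.cons (.formula (.par x.1 y.1)) fun i => (K i).1)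
    (fun | none => Sum.elim x.2 y.2 | some i => (K i).2)
    (by rintro (_ | _) <;> rfl)).2 ⟨.par _ _ _ π, ?_⟩
  rw [← hπ]
  exact image_sym2_map_comp _ _ _ (by rintro ⟨_ | _ | _, l⟩ <;> rfl) _

theorem Prov.tensor {K₁ : ι → LItem D Λ} {K₂ : κ → LItem D Λ} {Θ₁ Θ₂ : Set (Sym2 Λ)}
    {x y : LForm L Λ ℕ} (h₁ : Prov (lcons (.formula x) K₁) Θ₁)
    (h₂ : Prov (lcons (.formula y) K₂) Θ₂) :
    Prov (lcons (.formula (x.tensor y)) (Sum.elim K₁ K₂)) (Θ₁ ∪ Θ₂) := by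
  obtain ⟨π₁, hπ₁⟩ := (prov_iff (CutSequent.cons (.formula x.1) fun i => (K₁ i).1)
    (fun | none => x.2 | some i => (K₁ i).2) (by rintro (_ | _) <;> rfl)).1 h₁
  obtain ⟨π₂, hπ₂⟩ := (prov_iff (CutSequent.cons (.formula y.1) fun i => (K₂ i).1)
    (fun | none => y.2 | some i => (K₂ i).2) (by rintro (_ | _) <;> rfl)).1 h₂
  refine (prov_iff (CutSequent.cons (.formula (.tensor x.1 y.1))
    (CutSequent.append (fun i => (K₁ i).1) fun i => (K₂ i).1))
    (fun | none => Sum.elim x.2 y.2 | some (.inl i) => (K₁ i).2 | some (.inr i) => (K₂ i).2)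
    (by rintro (_ | _ | _) <;> rfl)).2 ⟨.tensor _ _ _ _ π₁ π₂, ?_⟩
  rw [← hπ₁, ← hπ₂, Proof.translate, Set.image_union]
  congr 1
  · exact image_sym2_map_comp _ _ _ (by rintro ⟨_ | _, l⟩ <;> rfl) _
  · exact image_sym2_map_comp _ _ _ (by rintro ⟨_ | _, l⟩ <;> rfl) _

theorem Prov.ex {K : ι → LItem D Λ} {Θ : Set (Sym2 Λ)} {x : LForm L Λ (Option ℕ)} (t : L.Term ℕ)
    (h : Prov (lcons (.formula (x.inst t)) K) Θ) : Prov (lcons (.formula x.ex) K) Θ := by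
  obtain ⟨π, hπ⟩ := (prov_iff (CutSequent.cons (.formula (x.1.inst t)) fun i => (K i).1)
    (fun | none => x.2 ∘ x.1.leafSubst _ | some i => (K i).2) (by rintro (_ | _) <;> rfl)).1 h
  refine (prov_iff (CutSequent.cons (.formula (.ex x.1)) fun i => (K i).1)
    (fun | none => x.2 | some i => (K i).2) (by rintro (_ | _) <;> rfl)).2 ⟨.ex _ _ t π, ?_⟩
  rw [← hπ]
  exact image_sym2_map_comp _ _ _ (by rintro ⟨_ | _, l⟩ <;> rfl) _

theorem Prov.all {K : ι → LItem D Λ} {Θ : Set (Sym2 Λ)} {x : LForm L Λ (Option ℕ)} (y : ℕ)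
    (hx : y ∉ x.all.1.freeVars) (hK : ∀ i, y ∉ (K i).1.freeVars)
    (h : Prov (lcons (.formula (x.inst (.var y))) K) Θ) : Prov (lcons (.formula x.all) K) Θ := by
  obtain ⟨π, hπ⟩ := (prov_iff (CutSequent.cons (.formula (x.1.inst (.var y))) fun i => (K i).1)
    (fun | none => x.2 ∘ x.1.leafSubst _ | some i => (K i).2) (by rintro (_ | _) <;> rfl)).1 h
  refine (prov_iff (CutSequent.cons (.formula (.all x.1)) fun i => (K i).1)
    (fun | none => x.2 | some i => (K i).2) (by rintro (_ | _) <;> rfl)).2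
    ⟨.all _ _ y hx hK π, ?_⟩
  rw [← hπ]
  exact image_sym2_map_comp _ _ _ (by rintro ⟨_ | _, l⟩ <;> rfl) _

theorem Prov.cut {K₁ : ι → LItem D Λ} {K₂ : κ → LItem D Λ} {Θ₁ Θ₂ : Set (Sym2 Λ)}
    {A : Formula L ℕ} {lab : A.Leaf ⊕ (A.neg D).Leaf → Λ} (σ : ℕ → L.Term ℕ)
    (h₁ : Prov (lcons (.formula (LForm.subst ⟨A, fun l => lab (.inl l)⟩ σ)) K₁) Θ₁)
    (h₂ : Prov (lcons (.formula (LForm.subst ⟨A.neg D, fun l => lab (.inr l)⟩ σ)) K₂) Θ₂) :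
    Prov (lcons (.cut A lab) (Sum.elim K₁ K₂)) (Θ₁ ∪ Θ₂) := by
  obtain ⟨π₁, hπ₁⟩ := (prov_iff (CutSequent.cons (.formula (A.subst σ)) fun i => (K₁ i).1)
    (fun | none => fun l => lab (.inl (A.leafSubst σ l)) | some i => (K₁ i).2)
    (by rintro (_ | _) <;> rfl)).1 h₁
  obtain ⟨π₂, hπ₂⟩ := (prov_iff
    (CutSequent.cons (.formula ((A.neg D).subst σ)) fun i => (K₂ i).1)
    (fun | none => fun l => lab (.inr ((A.neg D).leafSubst σ l)) | some i => (K₂ i).2)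
    (by rintro (_ | _) <;> rfl)).1 h₂
  refine (prov_iff (CutSequent.cons (.cut A)
    (CutSequent.append (fun i => (K₁ i).1) fun i => (K₂ i).1))
    (fun | none => lab | some (.inl i) => (K₁ i).2 | some (.inr i) => (K₂ i).2)
    (by rintro (_ | _ | _) <;> rfl)).2 ⟨.cut _ _ A σ π₁ π₂, ?_⟩
  rw [← hπ₁, ← hπ₂, Proof.translate, Set.image_union]
  congr 1
  · exact image_sym2_map_comp _ _ _ (by rintro ⟨_ | _, l⟩ <;> rfl) _
  · exact image_sym2_map_comp _ _ _ (by rintro ⟨_ | _, l⟩ <;> rfl) _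

/-- A component `k` is represented by a formula `x`: either it is this formula, or it is a cut and
`x` is obtained from its encoding by removing outer quantifiers and instantiating. -/
def Rep (k : LItem D Λ) (x : LForm L Λ ℕ) : Prop :=
  k = .formula x ∨ ∃ (A : Formula L ℕ) (lab : A.Leaf ⊕ (A.neg D).Leaf → Λ) (xs : List ℕ)
    (σ : ℕ → L.Term ℕ), k = .cut A lab ∧
      x = LForm.subst ⟨Formula.exs xs (.tensor A (A.neg D)),
        fun l => lab ((Formula.leafExs xs (.tensor A (A.neg D))).symm l)⟩ σ

/-- A partly stripped encoding of a cut has a tensor or an ∃ at its root. Hence the par, ∀ and axiom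
rules always act on genuine formulas. -/
theorem Rep.eq_of_ne {k : LItem D Λ} {x : LForm L Λ ℕ} (h : Rep k x)
    (h₁ : ∀ A B, x.1 ≠ .tensor A B) (h₂ : ∀ A, x.1 ≠ .ex A) : k = .formula x := by
  rcases h with h | ⟨A, lab, xs, σ, -, rfl⟩
  · exact h
  · cases xs with
    | nil => exact absurd rfl (h₁ _ _)
    | cons y ys => exact absurd rfl (h₂ _)

theorem Rep.tensor {k : LItem D Λ} {x y : LForm L Λ ℕ} (h : Rep k (x.tensor y)) :
    k = .formula (x.tensor y) ∨
      ∃ (A : Formula L ℕ) (lab : A.Leaf ⊕ (A.neg D).Leaf → Λ) (σ : ℕ → L.Term ℕ),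
        k = .cut A lab ∧ x = LForm.subst ⟨A, fun l => lab (.inl l)⟩ σ ∧
          y = LForm.subst ⟨A.neg D, fun l => lab (.inr l)⟩ σ := by
  rcases h with h | ⟨A, lab, xs, σ, rfl, h⟩
  · exact .inl h
  · cases xs with
    | nil =>
      refine .inr ⟨A, lab, σ, rfl, ?_⟩
      refine LForm.tensor_injective (h.trans ?_)
      rw [← LForm.subst_tensor]
      congr 1
      refine Sigma.ext rfl (heq_of_eq ?_)
      funext l
      rcases l with l | l <;> rfl
    | cons y ys => cases congrArg Sigma.fst h

/-- An outer ∃ belonging to the encoding of a cut has no rule of its own: instantiating it leaves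
the component `k` unchanged. -/
theorem Rep.ex {k : LItem D Λ} {x : LForm L Λ (Option ℕ)} (h : Rep k x.ex) :
    k = .formula x.ex ∨ ∀ t, Rep k (x.inst t) := by
  rcases h with h | ⟨A, lab, xs, σ, rfl, h⟩
  · exact .inl h
  · cases xs with
    | nil => cases congrArg Sigma.fst h
    | cons y ys =>
      -- The instantiating term is stored as the value at `y`; once all quantifiers are stripped,
      -- the accumulated map is the substitution of the cut rule.
      refine .inr fun t => .inr ⟨A, lab, ys, fun z => if z = y then t else σ z, rfl, ?_⟩
      have h' : x = (LForm.subst (LForm.subst ⟨Formula.exs ys (.tensor A (A.neg D)),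
          fun l => lab ((Formula.leafExs ys (.tensor A (A.neg D))).symm l)⟩
          fun z => if z = y then .var none else .var (some z)) (liftSubst σ)) :=
        LForm.ex_injective h
      rw [h', LForm.inst, LForm.subst_subst, LForm.subst_subst]
      congr 1
      funext z
      by_cases hz : z = y
      · simp [hz, Term.subst, liftSubst]
      · simp [hz, Term.subst, liftSubst, term_relabel_eq_subst, term_subst_subst]

/-- Instantiated encodings may have free variables while the cut itself has none, so freshness for
the representing formulas is enough for the ∀ rule. -/
theorem Rep.freeVars_subset {k : LItem D Λ} {x : LForm L Λ ℕ} (h : Rep k x) {y : ℕ}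
    (hy : y ∈ k.1.freeVars) : y ∈ x.1.freeVars := by
  rcases h with rfl | ⟨A, lab, xs, σ, rfl, -⟩
  · exact hy
  · simp [LItem.cut, Item.freeVars] at hy

theorem rep_encode (k : LItem D Λ) :
    Rep k ⟨k.1.encode D, fun l => k.2 ((k.1.encodeLeaf D).symm l)⟩ := by
  obtain ⟨A | A, lab⟩ := k
  · exact .inl rfl
  · exact .inr ⟨A, lab, _, Term.var, rfl, (LForm.subst_var _).symm⟩

end Prov

end FOMLL

/-! ### The instantiated subformula at each vertex of a parse tree. -/

namespace FOMLL

open FirstOrder.Language (Term)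

section NodeAt

variable {L : FirstOrder.Language.{u, v}} {Λ V V' : Type}

/-- How the labelled formula `x` at a vertex of kind `k` with set of children `ch` is composed of
the labelled formulas `F c` at its children; `t` is the term for the variable bound at the vertex,
and `l` is the label of the vertex. -/
def NodeAt (F : V → LForm L Λ ℕ) (k : Kind) (ch : V → Prop) (t : L.Term ℕ) (l : Λ)
    (x : LForm L Λ ℕ) : Prop :=
  match k with
  | .atom => (∀ c, ¬ ch c) ∧ ∃ a, x = .atom a l
  | .tensor => ∃ a b, a ≠ b ∧ (∀ c, ch c ↔ c = a ∨ c = b) ∧ x = (F a).tensor (F b)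
  | .par => ∃ a b, a ≠ b ∧ (∀ c, ch c ↔ c = a ∨ c = b) ∧ x = (F a).par (F b)
  | .all => ∃ a, (∀ c, ch c ↔ c = a) ∧ ∃ y : LForm L Λ (Option ℕ), x = y.all ∧ F a = y.inst t
  | .ex => ∃ a, (∀ c, ch c ↔ c = a) ∧ ∃ y : LForm L Λ (Option ℕ), x = y.ex ∧ F a = y.inst t

theorem NodeAt.map {F : V → LForm L Λ ℕ} {k : Kind} {ch : V → Prop} {t : L.Term ℕ} {l : Λ}
    {x : LForm L Λ ℕ} (h : NodeAt F k ch t l x) {F' : V' → LForm L Λ ℕ} {ch' : V' → Prop}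
    (f : V → V') (hf : Function.Injective f) (hF : ∀ v, F' (f v) = F v)
    (hch : ∀ c', ch' c' ↔ ∃ c, c' = f c ∧ ch c) : NodeAt F' k ch' t l x := by
  cases k with
  | atom => exact ⟨fun c hc => by obtain ⟨c, -, hc⟩ := (hch c).1 hc; exact h.1 c hc, h.2⟩
  | tensor | par =>
    obtain ⟨a, b, hab, hc, hx⟩ := h
    refine ⟨f a, f b, hf.ne hab, fun c => ?_, by simpa only [hF] using hx⟩
    rw [hch]
    constructor
    · rintro ⟨c, rfl, h⟩
      rcases (hc c).1 h with rfl | rfl <;> simp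
    · rintro (rfl | rfl)
      · exact ⟨a, rfl, (hc a).2 (.inl rfl)⟩
      · exact ⟨b, rfl, (hc b).2 (.inr rfl)⟩
  | all | ex =>
    obtain ⟨a, hc, hx⟩ := h
    refine ⟨f a, fun c => ?_, by simpa only [hF] using hx⟩
    rw [hch]
    constructor
    · rintro ⟨c, rfl, h⟩
      rw [(hc c).1 h]
    · rintro rfl
      exact ⟨a, rfl, (hc a).2 rfl⟩

end NodeAt

section OptionSum

variable {α β : Type}

theorem map_inl_eq_none_iff {p : Option α} {c a : α} {b : β} (h : p = none ↔ c = a) :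
    some (p.map Sum.inl) = some (none : Option (α ⊕ β)) ↔
      (some (.inl c) : Option (α ⊕ β)) = some (.inl a) ∨
        (some (.inl c) : Option (α ⊕ β)) = some (.inr b) := by
  simp [h]

theorem map_inr_eq_none_iff {p : Option β} {c a : β} {b : α} (h : p = none ↔ c = a) :
    some (p.map Sum.inr) = some (none : Option (α ⊕ β)) ↔
      (some (.inr c) : Option (α ⊕ β)) = some (.inl b) ∨
        (some (.inr c) : Option (α ⊕ β)) = some (.inr a) := by
  simp [h]

theorem map_inl_eq_iff {f : α → Option α} {c v : α} :
    some ((f c).map Sum.inl) = some (some (.inl v) : Option (α ⊕ β)) ↔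
      ∃ d, (some (.inl c) : Option (α ⊕ β)) = some (.inl d) ∧ f d = some v := by
  simp

theorem map_inr_eq_iff {f : β → Option β} {c v : β} :
    some ((f c).map Sum.inr) = some (some (.inr v) : Option (α ⊕ β)) ↔
      ∃ d, (some (.inr c) : Option (α ⊕ β)) = some (.inr d) ∧ f d = some v := by
  simp

theorem map_inl_eq_inr_iff {p : Option α} {q : β → Prop} {c : α} {v : β} :
    some (p.map Sum.inl) = some (some (.inr v) : Option (α ⊕ β)) ↔
      ∃ d, (some (.inl c) : Option (α ⊕ β)) = some (.inr d) ∧ q d := by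
  simp

theorem map_inr_eq_inl_iff {p : Option β} {q : α → Prop} {c : β} {v : α} :
    some (p.map Sum.inr) = some (some (.inl v) : Option (α ⊕ β)) ↔
      ∃ d, (some (.inr c) : Option (α ⊕ β)) = some (.inl d) ∧ q d := by
  simp

theorem some_eq_none_iff {p : Option α} {c a : α} (h : p = none ↔ c = a) :
    some p = some none ↔ some c = some a := by
  simp [h]

theorem some_eq_some_iff {f : α → Option α} {c v : α} :
    some (f c) = some (some v) ↔ ∃ d, some c = some d ∧ f d = some v := by
  simp

end OptionSum

namespace Formula

variable {L : FirstOrder.Language.{u, v}} {Λ X : Type}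

/-- The subformula at a vertex, with the free variables replaced according to `ρ`, the variables
bound below the vertex according to `β`, and the leaves labelled according to `g`. -/
def layout : {X : Type} → (A : Formula L X) → (X → L.Term ℕ) → (A.Vertex → L.Term ℕ) →
    (A.Vertex → Λ) → A.Vertex → LForm L Λ ℕ
  | _, atom a, ρ, _, g, _ => LForm.subst ⟨atom a, fun l => g ((atom a).leafVertex l)⟩ ρ
  | _, tensor A B, ρ, β, g, w => match (w : Option (A.Vertex ⊕ B.Vertex)) with
    | none => LForm.subst ⟨tensor A B, fun l => g ((tensor A B).leafVertex l)⟩ ρ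
    | some (.inl v) => A.layout ρ (fun v => β (some (.inl v))) (fun v => g (some (.inl v))) v
    | some (.inr v) => B.layout ρ (fun v => β (some (.inr v))) (fun v => g (some (.inr v))) v
  | _, par A B, ρ, β, g, w => match (w : Option (A.Vertex ⊕ B.Vertex)) with
    | none => LForm.subst ⟨par A B, fun l => g ((par A B).leafVertex l)⟩ ρ
    | some (.inl v) => A.layout ρ (fun v => β (some (.inl v))) (fun v => g (some (.inl v))) v
    | some (.inr v) => B.layout ρ (fun v => β (some (.inr v))) (fun v => g (some (.inr v))) v
  | _, all A, ρ, β, g, w => match (w : Option A.Vertex) with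
    | none => LForm.subst ⟨all A, fun l => g ((all A).leafVertex l)⟩ ρ
    | some v => A.layout (fun o => o.elim (β none) ρ) (fun v => β (some v)) (fun v => g (some v)) v
  | _, ex A, ρ, β, g, w => match (w : Option A.Vertex) with
    | none => LForm.subst ⟨ex A, fun l => g ((ex A).leafVertex l)⟩ ρ
    | some v => A.layout (fun o => o.elim (β none) ρ) (fun v => β (some v)) (fun v => g (some v)) v

theorem layout_root (A : Formula L X) (ρ : X → L.Term ℕ) (β : A.Vertex → L.Term ℕ)
    (g : A.Vertex → Λ) :
    A.layout ρ β g A.root = LForm.subst ⟨A, fun l => g (A.leafVertex l)⟩ ρ := by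
  cases A <;> rfl

/-- Undoing the rule at a vertex yields exactly the formulas at its children: the term `β v`
substituted below a quantifier is the one with which its body is instantiated. -/
theorem nodeAt_layout (A : Formula L X) (ρ : X → L.Term ℕ) (β : A.Vertex → L.Term ℕ)
    (g : A.Vertex → Λ) (v : A.Vertex) :
    NodeAt (A.layout ρ β g) (A.kind v) (fun c => A.parent c = some v) (β v) (g v)
      (A.layout ρ β g v) := by
  induction A with
  | atom a => exact ⟨fun _ => nofun, _, rfl⟩
  | tensor A B ihA ihB | par A B ihA ihB =>
    rcases v with _ | v | v
    · refine ⟨some (.inl A.root), some (.inr B.root), nofun, ?_, ?_⟩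
      · rintro (_ | c | c)
        · exact iff_of_false nofun (by rintro (h | h) <;> cases h)
        · exact map_inl_eq_none_iff parent_eq_none_iff
        · exact map_inr_eq_none_iff parent_eq_none_iff
      · simp only [layout, layout_root]
        first
        | rw [← LForm.subst_tensor]
        | rw [← LForm.subst_par]
        refine congrArg (fun x => LForm.subst x ρ) (Sigma.ext rfl (heq_of_eq ?_))
        funext l
        rcases l with l | l <;> rfl
    · refine (ihA ρ _ _ v).map (fun v => (some (Sum.inl v) : Option (A.Vertex ⊕ B.Vertex)))
        (fun _ _ h => Sum.inl_injective (Option.some_injective _ h))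
        (fun _ => rfl) ?_
      rintro (_ | c | c)
      · exact iff_of_false nofun (by rintro ⟨_, h, _⟩; cases h)
      · exact map_inl_eq_iff
      · exact map_inr_eq_inl_iff
    · refine (ihB ρ _ _ v).map (fun v => (some (Sum.inr v) : Option (A.Vertex ⊕ B.Vertex)))
        (fun _ _ h => Sum.inr_injective (Option.some_injective _ h))
        (fun _ => rfl) ?_
      rintro (_ | c | c)
      · exact iff_of_false nofun (by rintro ⟨_, h, _⟩; cases h)
      · exact map_inl_eq_inr_iff
      · exact map_inr_eq_iff
  | all A ih | ex A ih =>
    rcases v with _ | v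
    · refine ⟨some A.root, ?_,
        LForm.subst ⟨A, fun l => g (some (A.leafVertex l))⟩ (liftSubst ρ), rfl, ?_⟩
      · rintro (_ | c)
        · exact iff_of_false nofun nofun
        · exact some_eq_none_iff parent_eq_none_iff
      · rw [LForm.inst_liftSubst]
        exact layout_root A _ _ _
    · refine (ih _ _ _ v).map some (Option.some_injective _) (fun _ => rfl) ?_
      rintro (_ | c)
      · exact iff_of_false nofun (by rintro ⟨_, h, _⟩; cases h)
      · exact some_eq_some_iff

theorem layout_leafVertex (A : Formula L X) (ρ : X → L.Term ℕ) (β : A.Vertex → L.Term ℕ)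
    (g : A.Vertex → Λ) (l : A.Leaf) :
    A.layout ρ β g (A.leafVertex l) =
      .atom ((A.leafAtom l).subst (Sum.elim ρ β)) (g (A.leafVertex l)) := by
  induction A with
  | atom a =>
    simp only [leafAtom, Atom.relabel_subst]
    rfl
  | tensor A B ihA ihB | par A B ihA ihB =>
    rcases l with l | l
    · refine (ihA ρ _ _ l).trans ?_
      simp only [leafAtom, Atom.relabel_subst]
      congr 2
      funext x
      rcases x with x | x <;> rfl
    · refine (ihB ρ _ _ l).trans ?_
      simp only [leafAtom, Atom.relabel_subst]
      congr 2
      funext x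
      rcases x with x | x <;> rfl
  | all A ih | ex A ih =>
    refine (ih _ _ _ l).trans (congrArg (fun a => LForm.atom a (g (some (A.leafVertex l)))) ?_)
    refine Eq.trans ?_ (Atom.relabel_subst (A.leafAtom l) underQuantifier _).symm
    congr 1
    funext x
    rcases x with (_ | x) | x <;> rfl

theorem exists_leafVertex_eq {A : Formula L X} {w : A.Vertex} (h : A.kind w = .atom) :
    ∃ l, A.leafVertex l = w := by
  induction A with
  | atom a => exact ⟨(), rfl⟩
  | tensor A B ihA ihB | par A B ihA ihB =>
    rcases w with _ | w | w
    · cases h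
    · obtain ⟨l, rfl⟩ := ihA h
      exact ⟨.inl l, rfl⟩
    · obtain ⟨l, rfl⟩ := ihB h
      exact ⟨.inr l, rfl⟩
  | all A ih | ex A ih =>
    rcases w with _ | w
    · cases h
    · obtain ⟨l, rfl⟩ := ih h
      exact ⟨l, rfl⟩

/-- The distance of a vertex to the root. -/
def depth : {X : Type} → (A : Formula L X) → A.Vertex → ℕ
  | _, atom _, _ => 0
  | _, tensor A B, w => match (w : Option (A.Vertex ⊕ B.Vertex)) with
    | none => 0
    | some (.inl v) => A.depth v + 1
    | some (.inr v) => B.depth v + 1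
  | _, par A B, w => match (w : Option (A.Vertex ⊕ B.Vertex)) with
    | none => 0
    | some (.inl v) => A.depth v + 1
    | some (.inr v) => B.depth v + 1
  | _, all A, w => match (w : Option A.Vertex) with
    | none => 0
    | some v => A.depth v + 1
  | _, ex A, w => match (w : Option A.Vertex) with
    | none => 0
    | some v => A.depth v + 1

theorem depth_lt_of_parent {A : Formula L X} {v p : A.Vertex} (h : A.parent v = some p) :
    A.depth p < A.depth v := by
  induction A with
  | atom a => cases h
  | tensor A B ihA ihB | par A B ihA ihB =>
    rcases v with _ | v | v
    · cases h
    · obtain rfl := Option.some_injective _ h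
      rcases hp : A.parent v with _ | p
      · exact Nat.succ_pos _
      · exact Nat.succ_lt_succ (ihA hp)
    · obtain rfl := Option.some_injective _ h
      rcases hp : B.parent v with _ | p
      · exact Nat.succ_pos _
      · exact Nat.succ_lt_succ (ihB hp)
  | all A ih | ex A ih =>
    rcases v with _ | v
    · cases h
    · obtain rfl := Option.some_injective _ h
      rcases hp : A.parent v with _ | p
      · exact Nat.succ_pos _
      · exact Nat.succ_lt_succ (ih hp)

theorem reflTransGen_root (A : Formula L X) (v : A.Vertex) :
    Relation.ReflTransGen (fun u w => A.parent u = some w) v A.root := by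
  generalize hn : A.depth v = n
  induction n using Nat.strong_induction_on generalizing v with
  | _ n ih =>
    rcases hp : A.parent v with _ | p
    · rw [parent_eq_none_iff.1 hp]
    · exact .head hp (ih _ (hn ▸ depth_lt_of_parent hp) p rfl)

/-- Only quantifiers strictly between a vertex and the outside have been instantiated there, so
their values and those of `ρ` are the only sources of free variables. -/
theorem mem_freeVars_layout (A : Formula L X) (ρ : X → L.Term ℕ) (β : A.Vertex → L.Term ℕ)
    (g : A.Vertex → Λ) (v : A.Vertex) {n : ℕ} (h : n ∈ (A.layout ρ β g v).1.freeVars) :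
    (∃ x ∈ A.freeVars, n ∈ termVars (ρ x)) ∨
      ∃ w, Relation.TransGen (fun u w => A.parent u = some w) v w ∧ n ∈ termVars (β w) := by
  induction A with
  | atom a => exact .inl (mem_freeVars_subst.1 h)
  | tensor A B ihA ihB | par A B ihA ihB =>
    rcases v with _ | v | v
    · exact .inl (mem_freeVars_subst.1 h)
    · simp only [freeVars, Finset.mem_union]
      rcases ihA _ _ _ v h with ⟨x, hx, hn⟩ | ⟨w, hw, hn⟩
      · exact .inl ⟨x, .inl hx, hn⟩
      · exact .inr ⟨some (.inl w), hw.lift (fun w => (some (Sum.inl w) : Option (A.Vertex ⊕ B.Vertex)))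
          fun a b hab => by exact congrArg some (congrArg (Option.map Sum.inl) hab), hn⟩
    · simp only [freeVars, Finset.mem_union]
      rcases ihB _ _ _ v h with ⟨x, hx, hn⟩ | ⟨w, hw, hn⟩
      · exact .inl ⟨x, .inr hx, hn⟩
      · exact .inr ⟨some (.inr w), hw.lift (fun w => (some (Sum.inr w) : Option (A.Vertex ⊕ B.Vertex)))
          fun a b hab => by exact congrArg some (congrArg (Option.map Sum.inr) hab), hn⟩
  | all A ih | ex A ih =>
    rcases v with _ | v
    · exact .inl (mem_freeVars_subst.1 h)
    · simp only [freeVars, Finset.mem_eraseNone]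
      rcases ih _ _ _ v h with ⟨_ | x, hx, hn⟩ | ⟨w, hw, hn⟩
      · refine .inr ⟨none, ?_, hn⟩
        refine Relation.TransGen.tail' (b := some A.root) ?_
          (by simp [parent, parent_eq_none_iff.2 rfl])
        exact (reflTransGen_root A v).lift (fun w => (some w : Option A.Vertex)) fun a b hab => by exact congrArg some hab
      · exact .inl ⟨x, hx, hn⟩
      · exact .inr ⟨some w, hw.lift (fun w => (some w : Option A.Vertex)) fun a b hab => by exact congrArg some hab, hn⟩

end Formula

end FOMLL

/-! ### Nets, and the derivation step for each rule. -/

namespace FOMLL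

open FirstOrder.Language (Term)

section Lcons

variable {T : Type*} {ι : Type} {x : T} {K : ι → T}

theorem lcons_injective (hK : Function.Injective K) (hx : ∀ i, K i ≠ x) :
    Function.Injective (lcons x K) := by
  rintro (_ | i) (_ | j) h
  · rfl
  · exact absurd h.symm (hx j)
  · exact absurd h (hx i)
  · exact congrArg some (hK h)

theorem exists_lcons_eq {y : T} : (∃ o, lcons x K o = y) ↔ y = x ∨ ∃ i, K i = y := by
  constructor
  · rintro ⟨_ | i, h⟩
    · exact .inl h.symm
    · exact .inr ⟨i, h⟩
  · rintro (rfl | ⟨i, h⟩)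
    · exact ⟨none, rfl⟩
    · exact ⟨some i, h⟩

end Lcons

/-- The data of a correct linking from which a proof is built: a forest with links and leaps, the
instantiated formulas at the vertices, and eigenvariables for the universal vertices. -/
structure Net {L : FirstOrder.Language.{u, v}} (D : Duality L) (V : Type) where
  kind : V → Kind
  parent : V → Option V
  leap : V → V → Prop
  link : V → V → Prop
  form : V → LForm L V ℕ
  val : V → L.Term ℕ
  eigen : V → ℕ
  depth : V → ℕ
  depth_lt : ∀ v p, parent v = some p → depth p < depth v
  node : ∀ v, NodeAt form (kind v) (fun c => parent c = some v) (val v) v (form v)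
  val_all : ∀ v, kind v = .all → val v = .var (eigen v)
  leap_kind : ∀ x y, leap x y → kind x = .ex ∧ kind y = .all
  link_symm : ∀ u v, link u v → link v u
  link_atom : ∀ u v, link u v → kind u = .atom
  link_unique : ∀ u v w, link u v → link u w → v = w
  link_exists : ∀ u, kind u = .atom → ∃ v, link u v
  link_neg : ∀ u v, link u v → ∃ a, form u = .atom a u ∧ form v = .atom (a.neg D) v
  link_ne : ∀ u v, link u v → u ≠ v
  eigen_free : ∀ v y, eigen y ∈ (form v).1.freeVars →
    ∃ w, Relation.TransGen (fun u p => parent u = some p) v w ∧ (w = y ∨ leap w y)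

namespace Net

variable {L : FirstOrder.Language.{u, v}} {D : Duality L} {V : Type} {N : Net D V}

def graph (N : Net D V) : SwGraph V where
  sw v := N.kind v = .par ∨ N.kind v = .all
  into u v := N.parent u = some v ∨ N.leap u v
  link := N.link

def IsRoot (N : Net D V) (U : Set V) (v : V) : Prop := v ∈ U ∧ ∀ p, N.parent v = some p → p ∉ U

def links (N : Net D V) (U : Set V) : Set (Sym2 V) :=
  {e | ∃ u v, e = s(u, v) ∧ N.link u v ∧ u ∈ U}

/-- The families of labelled components which represent the roots of `U` derive the links in `U`. -/
def Derives (N : Net D V) (U : Set V) : Prop :=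
  ∀ ⦃κ : Type⦄ (r : κ → V), Function.Injective r → (∀ v, (∃ i, r i = v) ↔ N.IsRoot U v) →
    ∀ K : κ → LItem D V, (∀ i, Rep (K i) (N.form (r i))) → Prov K (N.links U)

/-- Children of `z` are in `U` by predecessor closure and lose their parent. No other vertex loses
one. -/
theorem isRoot_erase {U : Set V} (hU : N.graph.IsModule U) {z v : V} (hz : z ∈ U) :
    N.IsRoot (U \ {z}) v ↔ N.parent v = some z ∨ (v ≠ z ∧ N.IsRoot U v) := by
  constructor
  · rintro ⟨hv, hp⟩
    by_cases h : N.IsRoot U v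
    · exact .inr ⟨hv.2, h⟩
    · simp only [IsRoot, hv.1, true_and, not_forall, not_not] at h
      obtain ⟨p, hpv, hpU⟩ := h
      refine .inl ?_
      have := hp p hpv
      have hpz : p = z := by
        by_contra hne
        exact this ⟨hpU, hne⟩
      rw [hpv, hpz]
  · rintro (h | ⟨h, h'⟩)
    · refine ⟨⟨hU.into_closed v z (.inl h) hz, ?_⟩, fun p hp hpU => hpU.2 ?_⟩
      · rintro rfl
        exact lt_irrefl _ (N.depth_lt _ _ h)
      · rw [h, Option.some.injEq] at hp
        exact hp.symm
    · exact ⟨⟨h'.1, h⟩, fun p hp hpU => h'.2 p hp hpU.1⟩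

theorem links_erase {U : Set V} {z : V} (hz : N.kind z ≠ .atom) :
    N.links (U \ {z}) = N.links U := by
  ext e
  constructor
  · rintro ⟨u, v, rfl, h, hu⟩
    exact ⟨u, v, rfl, h, hu.1⟩
  · rintro ⟨u, v, rfl, h, hu⟩
    refine ⟨u, v, rfl, h, hu, ?_⟩
    rintro rfl
    exact hz (N.link_atom _ _ h)

theorem prov_of_lcons {κ : Type} {Λ : Type} {K : κ → LItem D Λ} {Θ : Set (Sym2 Λ)} (i₀ : κ)
    (h : Prov (lcons (K i₀) fun j : {j // j ≠ i₀} => K j) Θ) : Prov K Θ := by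
  refine Prov.reindex (fun o : Option {j // j ≠ i₀} => o.elim i₀ Subtype.val) ⟨?_, ?_⟩ ?_
  · rintro (_ | i) (_ | j) h
    · rfl
    · exact absurd h.symm j.2
    · exact absurd h i.2
    · exact congrArg some (Subtype.ext h)
  · intro j
    by_cases hj : j = i₀
    · exact ⟨none, hj.symm⟩
    · exact ⟨some ⟨j, hj⟩, rfl⟩
  · convert h using 1
    funext o
    cases o <;> rfl

theorem exists_ne_eq {κ : Type} {r : κ → V} (hr : Function.Injective r) {i₀ : κ} {v : V} :
    (∃ j : {j // j ≠ i₀}, r j = v) ↔ v ≠ r i₀ ∧ ∃ i, r i = v := by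
  constructor
  · rintro ⟨⟨j, hj⟩, rfl⟩
    exact ⟨hr.ne hj, j, rfl⟩
  · rintro ⟨h, i, rfl⟩
    exact ⟨⟨i, fun h' => h (h' ▸ rfl)⟩, rfl⟩

/-- A root of a module is not above a vertex of the module. -/
theorem notMem_of_transGen {U : Set V} (hU : N.graph.IsModule U) {v w : V} (hv : N.IsRoot U v)
    (h : Relation.TransGen (fun u p => N.parent u = some p) v w) : w ∉ U := by
  obtain ⟨p, hp, h⟩ := Relation.TransGen.head'_iff.1 h
  intro hw
  refine hv.2 p hp ?_
  clear hp
  induction h using Relation.ReflTransGen.head_induction_on with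
  | refl => exact hw
  | head hab _ ih => exact hU.into_closed _ _ (.inl hab) ih

/-- An occurrence would come from `z`, or an existential leaping to `z`, on the path from `v` to its
tree root. Both lie in `U`, by predecessor closure, whereas nothing on that path beyond a root of
`U` does. So removing a ∀ satisfies its eigenvariable condition. -/
theorem eigen_notMem {U : Set V} (hU : N.graph.IsModule U) {v z : V} (hv : N.IsRoot U v)
    (hz : z ∈ U) : N.eigen z ∉ (N.form v).1.freeVars := by
  intro h
  obtain ⟨w, hw, rfl | hwz⟩ := N.eigen_free v z h
  · exact notMem_of_transGen hU hv hw hz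
  · exact notMem_of_transGen hU hv hw (hU.into_closed _ _ (.inr hwz) hz)

theorem not_link_of_kind {z : V} (hz : N.kind z ≠ .atom) (u : V) :
    ¬ N.link z u ∧ ¬ N.link u z :=
  ⟨fun h => hz (N.link_atom _ _ h), fun h => hz (N.link_atom _ _ (N.link_symm _ _ h))⟩

theorem isRoot_of_terminal {U : Set V} {z : V} (hz : z ∈ U)
    (hterm : ∀ u ∈ U, ¬ N.graph.into z u) : N.IsRoot U z :=
  ⟨hz, fun p hp hpU => hterm p hpU (.inl hp)⟩

/-- Common part of ∀ and ∃. The rule may use any component representing the premise, because below a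
stripped cut quantifier that component is still the same cut. -/
theorem derives_of_unary {U : Set V} (hU : N.graph.IsModule U) {z a : V} (hz : z ∈ U)
    (hterm : ∀ u ∈ U, ¬ N.graph.into z u) (hk : N.kind z ≠ .atom)
    (ha : ∀ c, N.parent c = some z ↔ c = a) (hder : N.Derives (U \ {z}))
    (hrule : ∀ {κ : Type} (k : LItem D V) (K : κ → LItem D V), Rep k (N.form z) →
      (∀ i, ∃ v, N.IsRoot U v ∧ Rep (K i) (N.form v)) →
      (∀ k', Rep k' (N.form a) → Prov (lcons k' K) (N.links U)) →
        Prov (lcons k K) (N.links U)) : N.Derives U := by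
  intro κ r hr hroot K hK
  obtain ⟨i₀, rfl⟩ := (hroot z).2 (isRoot_of_terminal hz hterm)
  refine prov_of_lcons i₀ (hrule _ _ (hK i₀) (fun i => ⟨_, (hroot _).1 ⟨_, rfl⟩, hK _⟩) ?_)
  intro k' hk'
  have hpa := (ha a).2 rfl
  rw [← links_erase hk]
  refine hder (lcons a fun j : {j // j ≠ i₀} => r j) (lcons_injective ?_ ?_) (fun v => ?_) _ ?_
  · exact fun i j h => Subtype.ext (hr h)
  · rintro i rfl
    exact ((hroot _).1 ⟨_, rfl⟩).2 _ hpa hz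
  · rw [exists_lcons_eq, exists_ne_eq hr, isRoot_erase hU hz, ha, hroot]
  · rintro (_ | j)
    · exact hk'
    · exact hK _

theorem derives_of_par {U : Set V} (hU : N.graph.IsModule U) {z : V} (hz : z ∈ U)
    (hterm : ∀ u ∈ U, ¬ N.graph.into z u) (hk : N.kind z = .par)
    (hder : N.Derives (U \ {z})) : N.Derives U := by
  intro κ r hr hroot K hK
  obtain ⟨i₀, rfl⟩ := (hroot z).2 (isRoot_of_terminal hz hterm)
  have hn := N.node (r i₀)
  rw [hk] at hn
  obtain ⟨a, b, hab, hc, hform⟩ := hn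
  have hc : ∀ c, N.parent c = some (r i₀) ↔ c = a ∨ c = b := hc
  have hpa := (hc a).2 (.inl rfl)
  have hpb := (hc b).2 (.inr rfl)
  refine prov_of_lcons i₀ ?_
  have hrep := hK i₀
  rw [hform] at hrep
  rw [hrep.eq_of_ne (fun _ _ => nofun) fun _ => nofun]
  refine Prov.par ?_
  rw [← links_erase (z := r i₀) (by rw [hk]; nofun)]
  refine hder (lcons a (lcons b fun j : {j // j ≠ i₀} => r j))
    (lcons_injective (lcons_injective ?_ ?_) ?_) (fun v => ?_) _ ?_
  · exact fun i j h => Subtype.ext (hr h)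
  · rintro i rfl
    exact ((hroot _).1 ⟨_, rfl⟩).2 _ hpb hz
  · rintro (_ | i) h
    · exact hab h.symm
    · subst h
      exact ((hroot _).1 ⟨_, rfl⟩).2 _ hpa hz
  · rw [exists_lcons_eq, exists_lcons_eq, exists_ne_eq hr, isRoot_erase hU hz, hc, hroot, or_assoc]
  · rintro (_ | _ | j)
    · exact .inl rfl
    · exact .inl rfl
    · exact hK _

theorem derives_of_all {U : Set V} (hU : N.graph.IsModule U) {z : V} (hz : z ∈ U)
    (hterm : ∀ u ∈ U, ¬ N.graph.into z u) (hk : N.kind z = .all)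
    (hder : N.Derives (U \ {z})) : N.Derives U := by
  have hn := N.node z
  rw [hk] at hn
  obtain ⟨a, ha, x, hx, hxa⟩ := hn
  refine derives_of_unary hU hz hterm (by rw [hk]; nofun) ha hder ?_
  intro κ k K hrep hK hprov
  have hz' := eigen_notMem hU (isRoot_of_terminal hz hterm) hz
  rw [hx] at hrep hz'
  rw [hrep.eq_of_ne (fun _ _ => nofun) fun _ => nofun]
  refine Prov.all (N.eigen z) hz' (fun i hi => ?_) (hprov _ (.inl ?_))
  · obtain ⟨v, hv, hr⟩ := hK i
    exact eigen_notMem hU hv hz (hr.freeVars_subset hi)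
  · rw [hxa, N.val_all z hk]

theorem derives_of_ex {U : Set V} (hU : N.graph.IsModule U) {z : V} (hz : z ∈ U)
    (hterm : ∀ u ∈ U, ¬ N.graph.into z u) (hk : N.kind z = .ex)
    (hder : N.Derives (U \ {z})) : N.Derives U := by
  have hn := N.node z
  rw [hk] at hn
  obtain ⟨a, ha, x, hx, hxa⟩ := hn
  refine derives_of_unary hU hz hterm (by rw [hk]; nofun) ha hder ?_
  intro κ k K hrep hK hprov
  rw [hx] at hrep
  rcases hrep.ex with rfl | h
  · exact Prov.ex (N.val z) (hprov _ (.inl (by rw [hxa])))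
  · exact hprov k (hxa ▸ h _)

/-- Stated for an arbitrary partition, so that either premise of the tensor may be the one whose
empire was found. -/
theorem derives_of_tensor {U U₁ U₂ : Set V} {z a b : V} (hz : N.IsRoot U z)
    (hform : N.form z = (N.form a).tensor (N.form b)) (hk : N.kind z = .tensor)
    (hmem : ∀ v, v ∈ U ↔ v = z ∨ v ∈ U₁ ∨ v ∈ U₂) (h₁ : ∀ v ∈ U₁, v ∉ U₂)
    (hz₁ : z ∉ U₁) (hz₂ : z ∉ U₂) (hpa : N.parent a = some z) (hpb : N.parent b = some z)
    (hroot₁ : ∀ v, N.IsRoot U₁ v ↔ v = a ∨ (v ∈ U₁ ∧ N.IsRoot U v))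
    (hroot₂ : ∀ v, N.IsRoot U₂ v ↔ v = b ∨ (v ∈ U₂ ∧ N.IsRoot U v))
    (hder₁ : N.Derives U₁) (hder₂ : N.Derives U₂) : N.Derives U := by
  intro κ r hr hroot K hK
  obtain ⟨i₀, rfl⟩ := (hroot z).2 hz
  have hsub : ∀ W : Set V, r i₀ ∉ W → ∀ c, N.parent c = some (r i₀) →
      (∀ v, N.IsRoot W v ↔ v = c ∨ (v ∈ W ∧ N.IsRoot U v)) → N.Derives W →
      ∀ k, Rep k (N.form c) →
        Prov (lcons k fun j : {j // r j ∈ W} => K j) (N.links W) := by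
    intro W _ c hc hW hder k hk
    refine hder (lcons c fun j : {j // r j ∈ W} => r j) (lcons_injective ?_ ?_) (fun v => ?_) _ ?_
    · exact fun i j h => Subtype.ext (hr h)
    · rintro i rfl
      exact ((hroot _).1 ⟨_, rfl⟩).2 _ hc hz.1
    · rw [exists_lcons_eq, hW, ← hroot]
      refine or_congr Iff.rfl ⟨?_, ?_⟩
      · rintro ⟨⟨j, hj⟩, rfl⟩
        exact ⟨hj, j, rfl⟩
      · rintro ⟨hj, j, rfl⟩
        exact ⟨⟨j, hj⟩, rfl⟩
    · rintro (_ | j)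
      · exact hk
      · exact hK _
  have hlinks : N.links U = N.links U₁ ∪ N.links U₂ := by
    ext e
    constructor
    · rintro ⟨u, v, rfl, h, hu⟩
      rcases (hmem u).1 hu with rfl | hu | hu
      · exact absurd (N.link_atom _ _ h) (by rw [hk]; nofun)
      · exact .inl ⟨u, v, rfl, h, hu⟩
      · exact .inr ⟨u, v, rfl, h, hu⟩
    · rintro (⟨u, v, rfl, h, hu⟩ | ⟨u, v, rfl, h, hu⟩)
      · exact ⟨u, v, rfl, h, (hmem u).2 (.inr (.inl hu))⟩
      · exact ⟨u, v, rfl, h, (hmem u).2 (.inr (.inr hu))⟩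
  have key : Prov (lcons (K i₀) (Sum.elim (fun j : {j // r j ∈ U₁} => K j)
      fun j : {j // r j ∈ U₂} => K j)) (N.links U) := by
    have hrep := hK i₀
    rw [hform] at hrep
    rw [hlinks]
    -- A genuine tensor uses the tensor rule; the tensor of a fully stripped encoding uses the cut
    -- rule with the recorded substitution.
    rcases hrep.tensor with h | ⟨A, lab, σ, h, hA, hB⟩
    · rw [h]
      exact Prov.tensor (hsub U₁ hz₁ a hpa hroot₁ hder₁ _ (.inl rfl))
        (hsub U₂ hz₂ b hpb hroot₂ hder₂ _ (.inl rfl))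
    · rw [h]
      exact Prov.cut σ (hsub U₁ hz₁ a hpa hroot₁ hder₁ _ (.inl (by rw [hA])))
        (hsub U₂ hz₂ b hpb hroot₂ hder₂ _ (.inl (by rw [hB])))
  refine Prov.reindex (fun o : Option ({j // r j ∈ U₁} ⊕ {j // r j ∈ U₂}) =>
    o.elim i₀ (Sum.elim Subtype.val Subtype.val)) ⟨?_, ?_⟩ ?_
  · rintro (_ | i | i) (_ | j | j) h
    · rfl
    · exact absurd (show r i₀ ∈ U₁ by rw [show i₀ = j from h]; exact j.2) hz₁
    · exact absurd (show r i₀ ∈ U₂ by rw [show i₀ = j from h]; exact j.2) hz₂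
    · exact absurd (show r i₀ ∈ U₁ by rw [show i₀ = i from h.symm]; exact i.2) hz₁
    · exact congrArg (fun x => some (Sum.inl x)) (Subtype.ext h)
    · exact absurd (show r i ∈ U₂ by rw [show (i : κ) = j from h]; exact j.2) (h₁ _ i.2)
    · exact absurd (show r i₀ ∈ U₂ by rw [show i₀ = i from h.symm]; exact i.2) hz₂
    · exact absurd (show r j ∈ U₂ by rw [show (j : κ) = i from h.symm]; exact i.2) (h₁ _ j.2)
    · exact congrArg (fun x => some (Sum.inr x)) (Subtype.ext h)
  · intro j
    rcases (hmem (r j)).1 ((hroot _).1 ⟨j, rfl⟩).1 with h | h | h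
    · exact ⟨none, hr h.symm⟩
    · exact ⟨some (.inl ⟨j, h⟩), rfl⟩
    · exact ⟨some (.inr ⟨j, h⟩), rfl⟩
  · convert key using 1
    funext o
    rcases o with _ | _ | _ <;> rfl

end Net

end FOMLL

/-! ### Sequentialization by induction on modules. -/

namespace FOMLL

open FirstOrder.Language (Term)

namespace Net

variable {L : FirstOrder.Language.{u, v}} {D : Duality L} {V : Type} {N : Net D V}

theorem exists_child {z : V} (hz : N.kind z ≠ .atom) : ∃ c, N.parent c = some z := by
  have h := N.node z
  cases hk : N.kind z <;> rw [hk] at h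
  · exact absurd hk hz
  · obtain ⟨a, _, -, h, -⟩ := h
    exact ⟨a, (h a).2 (.inl rfl)⟩
  · obtain ⟨a, _, -, h, -⟩ := h
    exact ⟨a, (h a).2 (.inl rfl)⟩
  · obtain ⟨a, h, -⟩ := h
    exact ⟨a, (h a).2 rfl⟩
  · obtain ⟨a, h, -⟩ := h
    exact ⟨a, (h a).2 rfl⟩

theorem kind_ne_atom_of_sw {z : V} (hz : N.graph.sw z) : N.kind z ≠ .atom := by
  rcases hz with h | h <;> rw [h] <;> nofun

theorem exists_valid : ∃ s, N.graph.Valid s := by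
  classical
  refine ⟨fun z => if h : N.kind z ≠ .atom then (exists_child h).choose else z, fun z hz => ?_⟩
  simp only [dif_pos (kind_ne_atom_of_sw hz)]
  exact .inl (exists_child (kind_ne_atom_of_sw hz)).choose_spec

theorem parent_of_into {c t : V} (h : N.graph.into c t) (ht : ¬ N.graph.sw t) :
    N.parent c = some t :=
  h.resolve_right fun h => ht (.inr (N.leap_kind _ _ h).2)

theorem kind_ne_atom_of_into {c t : V} (h : N.graph.into c t) : N.kind t ≠ .atom := by
  intro hk
  rcases h with h | h
  · have hn := N.node t
    rw [hk] at hn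
    exact hn.1 c h
  · rw [(N.leap_kind _ _ h).2] at hk
    cases hk

/-- A vertex of the empire that becomes a root has a parent outside, and the only edge leaving the
empire is the one from `c` to `t`. -/
theorem isRoot_empire {U X : Set V} {c t v : V} (hE : N.graph.Empire U c t X)
    (hct : N.parent c = some t)
    (hX : ∀ x ∈ X, ∀ v ∈ U, v ∉ X → N.graph.into x v → x = c ∧ v = t) :
    N.IsRoot X v ↔ v = c ∨ (v ∈ X ∧ N.IsRoot U v) := by
  constructor
  · rintro ⟨hv, hp⟩
    by_cases h : N.IsRoot U v
    · exact .inr ⟨hv, h⟩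
    · simp only [IsRoot, hE.subset hv, true_and, not_forall, not_not] at h
      obtain ⟨p, hpv, hpU⟩ := h
      exact .inl (hX v hv p hpU (hp p hpv) (.inl hpv)).1
  · rintro (rfl | ⟨hv, h⟩)
    · refine ⟨hE.mem, fun p hp => ?_⟩
      rw [hct, Option.some.injEq] at hp
      exact hp ▸ hE.notMem
    · exact ⟨hv, fun p hp hpX => h.2 p hp (hE.subset hpX)⟩

theorem isRoot_diff_empire {U X : Set V} {c d t v : V} (hU : N.graph.IsModule U)
    (hE : N.graph.Empire U c t X) (ht : t ∈ U) (hdt : N.parent d = some t) (hcd : c ≠ d)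
    (hd : ∀ u, N.parent u = some t → u = c ∨ u = d)
    (hX : ∀ x ∈ X, ∀ v ∈ U, v ∉ X → N.graph.into x v → x = c ∧ v = t) :
    N.IsRoot ((U \ X) \ {t}) v ↔ v = d ∨ (v ∈ (U \ X) \ {t} ∧ N.IsRoot U v) := by
  constructor
  · rintro ⟨hv, hp⟩
    by_cases h : N.IsRoot U v
    · exact .inr ⟨hv, h⟩
    · simp only [IsRoot, hv.1.1, true_and, not_forall, not_not] at h
      obtain ⟨p, hpv, hpU⟩ := h
      refine .inl ((hd v ?_).resolve_left fun h => hv.1.2 (h ▸ hE.mem))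
      rw [hpv]
      by_contra hpt
      exact hp p hpv ⟨⟨hpU, fun h => hv.1.2 (hE.into_closed _ _ (.inl hpv) h)⟩,
        fun h => hpt (congrArg some h)⟩
  · rintro (rfl | ⟨hv, h⟩)
    · refine ⟨⟨⟨hU.into_closed _ _ (.inl hdt) ht, fun hvX => ?_⟩, ?_⟩, fun p hp => ?_⟩
      · exact hcd (hX v hvX t ht hE.notMem (.inl hdt)).1.symm
      · rintro rfl
        exact lt_irrefl _ (N.depth_lt _ _ hdt)
      · rw [hdt, Option.some.injEq] at hp
        exact fun h => h.2 hp.symm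
    · exact ⟨hv, fun p hp hpX => h.2 p hp hpX.1.1⟩

/-- Without compound vertices the only edges are links, and each atom has one. Connectivity
therefore reduces `U` to the two ends of a single link. -/
theorem derives_of_forall_atom {U : Set V} (hU : N.graph.IsModule U) (hne : U.Nonempty)
    (hat : ∀ v ∈ U, N.kind v = .atom) : N.Derives U := by
  intro κ r hr hroot K hK
  obtain ⟨u, hu⟩ := hne
  obtain ⟨v, huv⟩ := N.link_exists u (hat u hu)
  have hv : v ∈ U := (hU.link_closed u v huv).1 hu
  have hvu := N.link_symm _ _ huv
  have hUeq : ∀ w ∈ U, w = u ∨ w = v := by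
    obtain ⟨s, hs⟩ := N.exists_valid
    intro w hw
    refine hU.conn s hs {w | w = u ∨ w = v} ?_ u hu w hw (.inl rfl)
    intro a ha b hb hab
    rcases hab.into_or_link hs with h | h
    · exact absurd (hat b hb) (kind_ne_atom_of_into h)
    · constructor
      · rintro (rfl | rfl)
        · exact .inr (N.link_unique _ _ _ h huv)
        · exact .inl (N.link_unique _ _ _ h hvu)
      · rintro (rfl | rfl)
        · exact .inr (N.link_unique _ _ _ (N.link_symm _ _ h) huv)
        · exact .inl (N.link_unique _ _ _ (N.link_symm _ _ h) hvu)
  have hR : ∀ w ∈ U, N.IsRoot U w := fun w hw =>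
    ⟨hw, fun p hp hpU => kind_ne_atom_of_into (N := N) (.inl hp) (hat p hpU)⟩
  obtain ⟨i, rfl⟩ := (hroot u).2 (hR u hu)
  obtain ⟨j, rfl⟩ := (hroot v).2 (hR v hv)
  obtain ⟨a, hi, hj⟩ := N.link_neg _ _ huv
  have hlinks : N.links U = {s(r i, r j)} := by
    ext e
    constructor
    · rintro ⟨x, y, rfl, h, hx⟩
      rcases hUeq x hx with rfl | rfl
      · rw [N.link_unique _ _ _ h huv]
        rfl
      · rw [N.link_unique _ _ _ h hvu]
        exact Sym2.eq_swap
    · rintro rfl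
      exact ⟨_, _, rfl, huv, hu⟩
  have hij : i ≠ j := fun h => N.link_ne _ _ huv (congrArg r h)
  rw [hlinks]
  refine Prov.reindex (fun o : Option Unit => o.elim i fun _ => j) ⟨?_, ?_⟩ ?_
  · rintro (_ | _) (_ | _) h
    · rfl
    · exact absurd h hij
    · exact absurd h.symm hij
    · rfl
  · intro k
    rcases hUeq _ ((hroot _).1 ⟨k, rfl⟩).1 with h | h
    · exact ⟨none, hr h.symm⟩
    · exact ⟨some (), hr h.symm⟩
  · convert Prov.ax (D := D) a (r i) (r j) using 1
    have h₁ := hK i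
    have h₂ := hK j
    rw [hi] at h₁
    rw [hj] at h₂
    funext o
    rcases o with _ | _
    · exact h₁.eq_of_ne (fun _ _ => nofun) fun _ => nofun
    · exact h₂.eq_of_ne (fun _ _ => nofun) fun _ => nofun

/-- A net in which all switchings are trees yields a proof with the links of the net. -/
theorem derives [Finite V] (hB : N.graph.Bridges) {U : Set V} (hU : N.graph.IsModule U)
    (hne : U.Nonempty) : N.Derives U := by
  generalize hn : U.ncard = n
  induction n using Nat.strong_induction_on generalizing U with
  | _ n ih =>
  subst hn
  have hsub : ∀ W, W ⊆ U → ∀ z ∈ U, z ∉ W → W.ncard < U.ncard := fun W hW z hz hzW =>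
    Set.ncard_lt_ncard ⟨hW, fun h => hzW (h hz)⟩
  have herase : ∀ z ∈ U, N.kind z ≠ .atom → (∀ u ∈ U, ¬ N.graph.into z u) →
      (N.graph.sw z ∨ ∃ a, ∀ u, N.graph.into u z → u = a) → N.Derives (U \ {z}) := by
    intro z hz hk hterm h
    refine ih _ (hsub (U \ {z}) Set.sdiff_subset z hz fun h => h.2 rfl)
      (hU.erase hterm hz (N.not_link_of_kind hk) h) ?_ rfl
    obtain ⟨c, hc⟩ := exists_child hk
    refine ⟨c, hU.into_closed _ _ (.inl hc) hz, ?_⟩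
    rintro rfl
    exact lt_irrefl _ (N.depth_lt _ _ hc)
  by_cases h : ∃ z ∈ U, N.graph.sw z ∧ ∀ u ∈ U, ¬ N.graph.into z u
  · obtain ⟨z, hz, hsw, hterm⟩ := h
    have hd := herase z hz (kind_ne_atom_of_sw hsw) hterm (.inl hsw)
    rcases hsw with hk | hk
    · exact derives_of_par hU hz hterm hk hd
    · exact derives_of_all hU hz hterm hk hd
  have hdesc : ∀ v ∈ U, N.graph.sw v → ∃ u ∈ U, N.graph.into v u ∧ N.depth u < N.depth v := by
    intro z hz hsw
    by_contra hcon
    -- Leaps start at existentials, so an edge out of a switched vertex is a tree edge and decreases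
    -- the depth.
    refine h ⟨z, hz, hsw, fun u hu hzu => hcon ⟨u, hu, hzu, ?_⟩⟩
    rcases hzu with hzu | hzu
    · exact N.depth_lt _ _ hzu
    · have := (N.leap_kind _ _ hzu).1
      rcases hsw with hk | hk <;> rw [hk] at this <;> cases this
  by_cases hex : ∃ c, ∃ t ∈ U, N.graph.into c t ∧ ¬ N.graph.sw t
  · obtain ⟨s₀, hs₀⟩ := N.exists_valid
    obtain ⟨c, t, X, ht, hct, hts, hterm, hE, hX⟩ := SwGraph.exists_splitting hU hB
      (fun u v w h h' => kind_ne_atom_of_into h' (N.link_atom _ _ (N.link_symm _ _ h))) hs₀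
      N.depth hdesc hex
    have hpc := parent_of_into hct hts
    have hn := N.node t
    cases hk : N.kind t with
    | atom => exact absurd hk (kind_ne_atom_of_into hct)
    | par => exact absurd (.inl hk) hts
    | all => exact absurd (.inr hk) hts
    | ex =>
      rw [hk] at hn
      obtain ⟨a, ha, -⟩ := hn
      refine derives_of_ex hU ht hterm hk (herase t ht (by rw [hk]; nofun) hterm (.inr ⟨a, ?_⟩))
      exact fun u hu => (ha u).1 (parent_of_into hu hts)
    | tensor =>
      rw [hk] at hn
      obtain ⟨a, b, hab, hch, hform⟩ := hn
      have hch : ∀ u, N.parent u = some t ↔ u = a ∨ u = b := hch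
      have hroot := isRoot_of_terminal ht hterm
      have hlink := N.not_link_of_kind (z := t) (by rw [hk]; nofun)
      -- Here `d` is the premise of the tensor other than `c`. The empire of `c` and the remainder
      -- without `t` are both modules, nonempty, and smaller.
      have hsplit : ∀ d, c ≠ d → N.parent d = some t →
          (∀ u, N.parent u = some t → u = c ∨ u = d) →
          N.Derives X ∧ N.Derives ((U \ X) \ {t}) ∧
            (∀ v, N.IsRoot X v ↔ v = c ∨ (v ∈ X ∧ N.IsRoot U v)) ∧
            ∀ v, N.IsRoot ((U \ X) \ {t}) v ↔
              v = d ∨ (v ∈ (U \ X) \ {t} ∧ N.IsRoot U v) := by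
        intro d hcd hd hall
        have hr := fun v => isRoot_diff_empire (v := v) hU hE ht hd hcd hall hX
        refine ⟨ih _ (hsub _ hE.subset t ht hE.notMem) hE.toIsModule ⟨c, hE.mem⟩ rfl,
          ih _ (hsub ((U \ X) \ {t}) (fun x hx => hx.1.1) t ht fun h => h.2 rfl)
            (hU.diff_empire hE hterm hlink (fun u hu => hall u (parent_of_into hu hts)) hX)
            ⟨d, ((hr d).2 (.inl rfl)).1⟩ rfl, fun v => isRoot_empire hE hpc hX, hr⟩
      have hmem : ∀ v, v ∈ U ↔ v = t ∨ v ∈ X ∨ v ∈ (U \ X) \ {t} := by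
        intro v
        have h₁ := @hE.subset v
        simp only [Set.mem_sdiff, Set.mem_singleton_iff]
        constructor
        · tauto
        · rintro (rfl | h | h)
          · exact ht
          · exact h₁ h
          · exact h.1.1
      have hpa := (hch a).2 (.inl rfl)
      have hpb := (hch b).2 (.inr rfl)
      rcases (hch c).1 hpc with rfl | rfl
      · obtain ⟨h₁, h₂, h₃, h₄⟩ := hsplit b hab hpb fun u => (hch u).1
        exact derives_of_tensor hroot hform hk hmem (fun v hv h => h.1.2 hv) hE.notMem
          (fun h => h.2 rfl) hpa hpb h₃ h₄ h₁ h₂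
      · obtain ⟨h₁, h₂, h₃, h₄⟩ := hsplit a hab.symm hpa fun u hu => ((hch u).1 hu).symm
        exact derives_of_tensor hroot hform hk (fun v => (hmem v).trans (or_congr Iff.rfl or_comm))
          (fun v hv h => hv.1.2 h) (fun h => h.2 rfl) hE.notMem hpa hpb h₄ h₃ h₂ h₁
  -- If no edge enters an unswitched vertex, descent along tree edges excludes switched vertices
  -- too; then any compound vertex would be an unswitched one with a child, so all vertices are
  -- atoms.
  · have hsw : ∀ n, ∀ v ∈ U, N.depth v = n → ¬ N.graph.sw v := by
      intro n
      induction n using Nat.strong_induction_on with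
      | _ n ih =>
        intro v hv hn hsw
        obtain ⟨u, hu, hvu, hd⟩ := hdesc v hv hsw
        exact hex ⟨v, u, hu, hvu, ih _ (hn ▸ hd) u hu rfl⟩
    refine derives_of_forall_atom hU hne fun v hv => ?_
    by_contra hk
    obtain ⟨c, hc⟩ := exists_child hk
    exact hex ⟨c, v, hv, .inl hc, hsw _ v hv rfl⟩

end Net

end FOMLL

/-! ### From unification nets to proofs. -/

namespace FOMLL

open FirstOrder.Language (Term)

section OfCorrect

variable {L : FirstOrder.Language.{u, v}} {D : Duality L} {ι : Type}

theorem exists_injective_notMem {V : Type} [Finite V] {B : Set ℕ} (hB : B.Finite) :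
    ∃ η : V → ℕ, Function.Injective η ∧ ∀ v, η v ∉ B := by
  have := hB.infinite_compl.to_subtype
  obtain ⟨n, ⟨e⟩⟩ := Finite.exists_equiv_fin V
  refine ⟨fun v => (Infinite.natEmbedding (Bᶜ : Set ℕ) (e v) : ℕ), fun v w h => ?_,
    fun v => (Infinite.natEmbedding (Bᶜ : Set ℕ) (e v)).2⟩
  exact e.injective (Fin.ext ((Infinite.natEmbedding _).injective (Subtype.ext h)))

namespace Sequent

variable {Γ : Sequent L ι} {θ : Set (Sym2 Γ.Leaf)} {σ : Γ.Vertex → L.Term (ℕ ⊕ Γ.Vertex)}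

theorem leafVertex_injective (Γ : Sequent L ι) : Function.Injective Γ.leafVertex := by
  rintro ⟨i, l⟩ ⟨j, l'⟩ h
  obtain rfl : i = j := congrArg Sigma.fst h
  exact congrArg _ (Formula.leafVertex_injective _ (eq_of_heq (Sigma.mk.inj h).2))

theorem exists_leafVertex_eq {w : Γ.Vertex} (h : Γ.kind w = .atom) : ∃ l, Γ.leafVertex l = w := by
  obtain ⟨l, hl⟩ := Formula.exists_leafVertex_eq h
  exact ⟨⟨w.1, l⟩, Sigma.ext rfl (heq_of_eq hl)⟩

theorem parent_eq_some_iff {c w : Γ.Vertex} :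
    Γ.parent c = some w ↔ ∃ d, c = ⟨w.1, d⟩ ∧ (Γ w.1).parent d = some w.2 := by
  constructor
  · intro h
    obtain ⟨p, hp, rfl⟩ := Option.map_eq_some_iff.1 h
    exact ⟨c.2, rfl, hp⟩
  · rintro ⟨d, rfl, h⟩
    exact Option.map_eq_some_iff.2 ⟨_, h, rfl⟩

/-- The formula at a vertex, with the bound variables replaced according to `val`. -/
def layout (Γ : Sequent L ι) (val : Γ.Vertex → L.Term ℕ) (w : Γ.Vertex) : LForm L Γ.Vertex ℕ :=
  (Γ w.1).layout Term.var (fun v => val ⟨w.1, v⟩) (fun v => ⟨w.1, v⟩) w.2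

theorem layout_leafVertex (Γ : Sequent L ι) (val : Γ.Vertex → L.Term ℕ) (l : Γ.Leaf) :
    Γ.layout val (Γ.leafVertex l) =
      .atom ((Γ.leafAtom l).subst (Sum.elim Term.var val)) (Γ.leafVertex l) := by
  refine (Formula.layout_leafVertex _ _ _ _ _).trans ?_
  rw [leafAtom, Atom.relabel_subst]
  congr 2
  funext x
  rcases x with x | x <;> rfl

/-- The net of a linking with a given unifier, for a choice of eigenvariables. -/
noncomputable def Witness.net (h : Γ.Witness θ σ)
    (hdual : ∀ l l', s(l, l') ∈ θ →
      ((Γ l.1).leafPred l.2).IsDual D ((Γ l'.1).leafPred l'.2))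
    (hcover : ∀ l, ∃! e, e ∈ θ ∧ l ∈ e) (η : Γ.Vertex → ℕ) (hη : Function.Injective η)
    (h₁ : ∀ y i, η y ∉ (Γ i).freeVars) (h₂ : ∀ y w, Sum.inl (η y) ∉ termVars (σ w)) :
    Net D Γ.Vertex where
  kind := Γ.kind
  parent := Γ.parent
  leap := Γ.Leap σ
  link u v := ∃ l l', s(l, l') ∈ θ ∧ Γ.leafVertex l = u ∧ Γ.leafVertex l' = v
  form := Γ.layout fun w => (σ w).subst (Sum.elim Term.var fun y => Term.var (η y))
  val w := (σ w).subst (Sum.elim Term.var fun y => Term.var (η y))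
  eigen := η
  depth w := (Γ w.1).depth w.2
  depth_lt v p hp := by
    obtain ⟨d, rfl, hd⟩ := parent_eq_some_iff.1 hp
    exact Formula.depth_lt_of_parent hd
  node w := by
    refine (Formula.nodeAt_layout (Γ w.1) _ _ _ w.2).map (fun v => (⟨w.1, v⟩ : Γ.Vertex))
      (fun _ _ hab => eq_of_heq (Sigma.mk.inj hab).2) (fun _ => rfl) fun c => parent_eq_some_iff
  val_all w hw := by
    rw [h.eq_var w (by rw [hw]; nofun)]
    rfl
  leap_kind x y hxy := ⟨hxy.1, h.universal x hxy.1 y hxy.2⟩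
  link_symm := by
    rintro u v ⟨l, l', hl, rfl, rfl⟩
    exact ⟨l', l, Sym2.eq_swap ▸ hl, rfl, rfl⟩
  link_atom := by
    rintro u v ⟨l, l', hl, rfl, rfl⟩
    exact Formula.kind_leafVertex _ _
  link_unique := by
    rintro u v w ⟨l, l', hl, rfl, rfl⟩ ⟨m, m', hm, hm₁, rfl⟩
    obtain rfl := Γ.leafVertex_injective hm₁
    have := (hcover m).unique ⟨hl, Sym2.mem_mk_left _ _⟩ ⟨hm, Sym2.mem_mk_left _ _⟩
    rw [Sym2.congr_right.1 this]
  link_exists u hu := by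
    obtain ⟨l, rfl⟩ := exists_leafVertex_eq hu
    obtain ⟨e, ⟨he, hle⟩, -⟩ := hcover l
    obtain ⟨l', rfl⟩ := hle
    exact ⟨_, l, l', he, rfl, rfl⟩
  link_neg := by
    rintro u v ⟨l, l', hl, rfl, rfl⟩
    refine ⟨_, layout_leafVertex _ _ _, (layout_leafVertex _ _ _).trans ?_⟩
    have key : ∀ l : Γ.Leaf, (Γ.leafAtom l).subst (Sum.elim Term.var fun w =>
          (σ w).subst (Sum.elim Term.var fun y => Term.var (η y))) =
        ((Γ.leafAtom l).subst (Sum.elim (fun x => .var (Sum.inl x)) σ)).subst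
          (Sum.elim Term.var fun y => Term.var (η y)) := by
      intro l
      rw [Atom.subst_subst]
      congr 1
      funext x
      rcases x with x | x <;> rfl
    have hp := Atom.eq_neg_of_termSeq_eq D ?_ (h.equalizes l l' hl)
    · rw [key, key, hp]
      rfl
    · have := hdual l l' hl
      rw [← Formula.arity_leafAtom, ← Formula.arity_leafAtom] at this
      exact this
  link_ne := by
    rintro u v ⟨l, l', hl, rfl, rfl⟩ heq
    obtain rfl := Γ.leafVertex_injective heq
    have := hdual l l hl
    generalize (Γ l.1).leafPred l.2 = p at this
    obtain ⟨n, P⟩ := p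
    exact D.dual_ne P (eq_of_heq (Sigma.mk.inj this).2).symm
  eigen_free w y hy := by
    -- Freshness of `η` for the sequent and for the terms of `σ` leaves only occurrences that
    -- replace a universal vertex `y'`, and injectivity gives `y' = y`. The term holding it belongs
    -- to `y` itself or to an existential leaping to `y`.
    rcases Formula.mem_freeVars_layout _ _ _ _ _ hy with ⟨x, hx, hn⟩ | ⟨w', hw', hn⟩
    · rw [mem_termVars_var] at hn
      exact absurd (hn ▸ hx) (h₁ y w.1)
    · refine ⟨⟨w.1, w'⟩, Relation.TransGen.lift (p := fun u p => Γ.parent u = some p)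
        (fun v => (⟨w.1, v⟩ : Γ.Vertex))
        (fun a b hab => by exact parent_eq_some_iff.2 ⟨a, rfl, hab⟩) _ _ hw', ?_⟩
      obtain ⟨z, hz, hyz⟩ := mem_termVars_subst.1 hn
      rcases z with n | y'
      · rw [Sum.elim_inl, mem_termVars_var] at hyz
        exact absurd (hyz ▸ hz) (h₂ y _)
      · rw [Sum.elim_inr, mem_termVars_var] at hyz
        obtain rfl := hη hyz
        by_cases hk : Γ.kind ⟨w.1, w'⟩ = .ex
        · exact .inr ⟨hk, hz⟩
        · rw [h.eq_var _ hk, mem_termVars_var] at hz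
          exact .inl (Sum.inr_injective hz).symm

end Sequent

theorem Item.leafPred_encodeLeaf (I : Item L) (l : I.Leaf D) :
    (I.encode D).leafPred (I.encodeLeaf D l) = I.leafPred D l := by
  cases I with
  | formula A => rfl
  | cut A =>
    refine (Formula.leafPred_leafExs _ _ _).trans ?_
    rcases l with l | l <;> rfl

namespace CutSequent

variable {Δ : CutSequent L ι} {θ : Set (Sym2 (Δ.Leaf D))}

theorem encodeLeaf_bijective (Δ : CutSequent L ι) : Function.Bijective (Δ.encodeLeaf D) :=
  (Equiv.sigmaCongrRight fun i => (Δ i).encodeLeaf D).bijective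

theorem IsLinking.dual_encode (h : Δ.IsLinking D θ) (l l' : (Δ.encode D).Leaf)
    (hl : s(l, l') ∈ Sym2.map (Δ.encodeLeaf D) '' θ) :
    ((Δ.encode D l.1).leafPred l.2).IsDual D ((Δ.encode D l'.1).leafPred l'.2) := by
  obtain ⟨k, rfl⟩ := Δ.encodeLeaf_bijective.2 l
  obtain ⟨k', rfl⟩ := Δ.encodeLeaf_bijective.2 l'
  rw [← Sym2.map_mk, (Sym2.map.injective Δ.encodeLeaf_bijective.1).mem_set_image] at hl
  have := h.dual k k' hl
  rw [← Item.leafPred_encodeLeaf, ← Item.leafPred_encodeLeaf] at this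
  exact this

theorem IsLinking.cover_encode (h : Δ.IsLinking D θ) (l : (Δ.encode D).Leaf) :
    ∃! e, e ∈ Sym2.map (Δ.encodeLeaf D) '' θ ∧ l ∈ e := by
  obtain ⟨k, rfl⟩ := Δ.encodeLeaf_bijective.2 l
  obtain ⟨e, ⟨he, hk⟩, hu⟩ := h.cover k
  refine ⟨_, ⟨⟨e, he, rfl⟩, Sym2.mem_map.2 ⟨k, hk, rfl⟩⟩, ?_⟩
  rintro _ ⟨⟨e', he', rfl⟩, hm⟩
  obtain ⟨k', hk', hkk⟩ := Sym2.mem_map.1 hm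
  obtain rfl := Δ.encodeLeaf_bijective.1 hkk
  rw [hu e' ⟨he', hk'⟩]

/-- The whole vertex set is a module whose roots are the components. Labelling each leaf of the cut
sequent by its vertex in the encoding is injective, so equality of sets of labels gives back the
linking itself. -/
theorem IsUnificationNet.exists_translate_eq [Finite ι] (h : Δ.IsUnificationNet D θ) :
    ∃ π : Proof D Δ, π.translate = θ := by
  obtain ⟨hlink, hcorr⟩ := h
  obtain ⟨σ, hσ, hconn, hB, ⟨w₀⟩⟩ := Sequent.exists_witness_of_correct hcorr
  obtain ⟨η, hη, hηB⟩ := exists_injective_notMem (V := (Δ.encode D).Vertex)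
    (B := (⋃ i, ((Δ.encode D i).freeVars : Set ℕ)) ∪
      ⋃ w, Sum.inl ⁻¹' (termVars (σ w) : Set (ℕ ⊕ (Δ.encode D).Vertex)))
    ((Set.finite_iUnion fun i => Finset.finite_toSet _).union (Set.finite_iUnion fun w =>
      (Finset.finite_toSet _).preimage Sum.inl_injective.injOn))
  simp only [Set.mem_union, Set.mem_iUnion, Set.mem_preimage, Finset.mem_coe, not_or,
    not_exists] at hηB
  set N := hσ.net hlink.dual_encode hlink.cover_encode η hη (fun y => (hηB y).1)
    fun y => (hηB y).2 with hN
  have hU : N.graph.IsModule Set.univ :=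
    ⟨fun _ _ _ _ => trivial, fun _ _ _ => Iff.rfl, hconn⟩
  have hder := Net.derives (N := N) hB hU ⟨w₀, trivial⟩
    (fun i : ι => (⟨i, (Δ.encode D i).root⟩ : (Δ.encode D).Vertex)) ?_ ?_
    (fun i => ⟨Δ i, fun l => (Δ.encode D).leafVertex (Δ.encodeLeaf D ⟨i, l⟩)⟩) ?_
  · obtain ⟨π, hπ⟩ := (prov_iff Δ _ fun _ => rfl).1 hder
    refine ⟨π, ?_⟩
    have hinj := ((Δ.encode D).leafVertex_injective.comp
      (Δ.encodeLeaf_bijective (D := D)).1)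
    refine (Sym2.map.injective hinj).image_injective (hπ.trans ?_)
    ext e
    constructor
    · rintro ⟨u, v, rfl, ⟨l, l', ⟨e, he, hl⟩, rfl, rfl⟩, -⟩
      refine ⟨e, he, ?_⟩
      rw [Sym2.map_comp, Function.comp_apply, hl]
      rfl
    · rintro ⟨e, he, rfl⟩
      induction e with
      | _ a b => exact ⟨_, _, rfl, ⟨_, _, ⟨_, he, rfl⟩, rfl, rfl⟩, trivial⟩
  · exact fun i j hij => congrArg Sigma.fst hij
  · rintro ⟨i, w⟩
    constructor
    · rintro ⟨j, hj⟩
      refine ⟨trivial, fun p hp => ?_⟩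
      obtain rfl : j = i := congrArg Sigma.fst hj
      obtain ⟨d, hd, -⟩ := Option.map_eq_some_iff.1 hp
      obtain rfl := eq_of_heq (Sigma.mk.inj hj).2
      rw [Formula.parent_eq_none_iff.2 rfl] at hd
      cases hd
    · rintro ⟨-, hp⟩
      refine ⟨i, ?_⟩
      rcases h : (Δ.encode D i).parent w with _ | p
      · rw [Formula.parent_eq_none_iff.1 h]
      · exact absurd trivial (hp ⟨i, p⟩ (Option.map_eq_some_iff.2 ⟨p, h, rfl⟩))
  · intro i
    have := rep_encode (D := D) (Λ := (Δ.encode D).Vertex)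
      ⟨Δ i, fun l => (Δ.encode D).leafVertex (Δ.encodeLeaf D ⟨i, l⟩)⟩
    convert this using 1
    refine (Formula.layout_root _ _ _ _).trans ((LForm.subst_var _).trans ?_)
    refine Sigma.ext rfl (heq_of_eq (funext fun l => ?_))
    exact congrArg (fun l => (⟨i, (Δ.encode D i).leafVertex l⟩ : (Δ.encode D).Vertex))
      (((Δ i).encodeLeaf D).apply_symm_apply l).symm

end CutSequent

end OfCorrect

end FOMLL

/-! ### Embeddings of parse trees and forests. -/

namespace FOMLL

open FirstOrder.Language (Term)

section OptionSum

variable {α α' β β' : Type}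

theorem map_map_inl (f : α ≃ α') (g : β ≃ β') {p : Option α'} {q : Option α} (h : p = q.map f) :
    some (p.map Sum.inl) =
      Option.map (Equiv.optionCongr (Equiv.sumCongr f g)) (some (q.map Sum.inl)) := by
  subst h
  cases q <;> rfl

theorem map_map_inr (f : α ≃ α') (g : β ≃ β') {p : Option β'} {q : Option β} (h : p = q.map g) :
    some (p.map Sum.inr) =
      Option.map (Equiv.optionCongr (Equiv.sumCongr f g)) (some (q.map Sum.inr)) := by
  subst h
  cases q <;> rfl

theorem map_inl_of_eq (β : Type) {p q : Option α} (h : p = q) :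
    (some (p.map Sum.inl) : Option (Option (α ⊕ β))) = some (q.map Sum.inl) := h ▸ rfl

theorem map_inr_of_eq (α : Type) {p q : Option β} (h : p = q) :
    (some (p.map Sum.inr) : Option (Option (α ⊕ β))) = some (q.map Sum.inr) := h ▸ rfl

end OptionSum

namespace Formula

variable {L : FirstOrder.Language.{u, v}} {X Y : Type}

/-- Substitution does not change the parse tree of a formula. -/
def vertexSubst : {X Y : Type} → (A : Formula L X) → (σ : X → L.Term Y) →
    (A.subst σ).Vertex ≃ A.Vertex
  | _, _, atom _, _ => Equiv.refl Unit
  | _, _, tensor A B, σ =>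
      Equiv.optionCongr (Equiv.sumCongr (A.vertexSubst σ) (B.vertexSubst σ))
  | _, _, par A B, σ => Equiv.optionCongr (Equiv.sumCongr (A.vertexSubst σ) (B.vertexSubst σ))
  | _, _, all A, σ => Equiv.optionCongr (A.vertexSubst (liftSubst σ))
  | _, _, ex A, σ => Equiv.optionCongr (A.vertexSubst (liftSubst σ))

theorem kind_vertexSubst (A : Formula L X) (σ : X → L.Term Y) (w : (A.subst σ).Vertex) :
    A.kind (A.vertexSubst σ w) = (A.subst σ).kind w := by
  induction A generalizing Y with
  | atom a => rfl
  | tensor A B ihA ihB | par A B ihA ihB =>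
    rcases w with _ | w | w
    · rfl
    · exact ihA σ w
    · exact ihB σ w
  | all A ih | ex A ih =>
    rcases w with _ | w
    · rfl
    · exact ih _ w

theorem parent_vertexSubst (A : Formula L X) (σ : X → L.Term Y) (w : (A.subst σ).Vertex) :
    A.parent (A.vertexSubst σ w) = ((A.subst σ).parent w).map (A.vertexSubst σ) := by
  induction A generalizing Y with
  | atom a => rfl
  | tensor A B ihA ihB | par A B ihA ihB =>
    rcases w with _ | w | w
    · rfl
    · exact map_map_inl (A.vertexSubst σ) (B.vertexSubst σ) (ihA σ w)
    · exact map_map_inr (A.vertexSubst σ) (B.vertexSubst σ) (ihB σ w)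
  | all A ih | ex A ih =>
    rcases w with _ | w
    · rfl
    · exact congrArg some (ih (liftSubst σ) w)

theorem leafVertex_leafSubst (A : Formula L X) (σ : X → L.Term Y) (l : (A.subst σ).Leaf) :
    A.leafVertex (A.leafSubst σ l) = A.vertexSubst σ ((A.subst σ).leafVertex l) := by
  induction A generalizing Y with
  | atom a => rfl
  | tensor A B ihA ihB | par A B ihA ihB =>
    rcases l with l | l
    · exact congrArg (fun w => (some (Sum.inl w) : Option (A.Vertex ⊕ B.Vertex))) (ihA σ l)
    · exact congrArg (fun w => (some (Sum.inr w) : Option (A.Vertex ⊕ B.Vertex))) (ihB σ l)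
  | all A ih | ex A ih => exact congrArg some (ih (liftSubst σ) l)

/-- Clean forms name bound variables by vertices, so they commute with substitution once vertices
are matched by `vertexSubst`. Both sides use names of the unsubstituted tree to make them
comparable. -/
theorem leafAtom_leafSubst (A : Formula L X) (σ : X → L.Term Y) (l : (A.subst σ).Leaf) :
    ((A.subst σ).leafAtom l).subst (Sum.elim (fun y => Term.var (Sum.inl y)) fun w =>
        Term.var (Sum.inr (A.vertexSubst σ w))) =
      (A.leafAtom (A.leafSubst σ l)).subst
        (Sum.elim (fun x => (σ x).relabel Sum.inl) fun w => Term.var (Sum.inr w)) := by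
  induction A generalizing Y with
  | atom a =>
    refine (Atom.relabel_subst _ _ _).trans (Eq.trans ?_ (Atom.relabel_subst _ _ _).symm)
    refine (Atom.subst_subst _ _ _).trans ?_
    congr 1
    funext x
    exact (term_relabel_eq_subst _ _).symm
  | tensor A B ihA ihB | par A B ihA ihB =>
    rcases l with l | l
    · have := congrArg (fun a => a.relabel (Sum.map id fun w =>
        (some (Sum.inl w) : Option (A.Vertex ⊕ B.Vertex)))) (ihA σ l)
      simp only [Atom.relabel_eq_subst, Atom.subst_subst] at this
      refine (Atom.relabel_subst _ _ _).trans (Eq.trans ?_ (this.trans (Eq.trans ?_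
        (Atom.relabel_subst _ _ _).symm)))
      · congr 1
        funext x
        rcases x with x | x <;> rfl
      · congr 1
        funext x
        rcases x with x | x
        · simp [term_relabel_eq_subst, term_subst_subst, Term.subst]
          rfl
        · rfl
    · have := congrArg (fun a => a.relabel (Sum.map id fun w =>
        (some (Sum.inr w) : Option (A.Vertex ⊕ B.Vertex)))) (ihB σ l)
      simp only [Atom.relabel_eq_subst, Atom.subst_subst] at this
      refine (Atom.relabel_subst _ _ _).trans (Eq.trans ?_ (this.trans (Eq.trans ?_
        (Atom.relabel_subst _ _ _).symm)))
      · congr 1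
        funext x
        rcases x with x | x <;> rfl
      · congr 1
        funext x
        rcases x with x | x
        · simp [term_relabel_eq_subst, term_subst_subst, Term.subst]
          rfl
        · rfl
  | all A ih | ex A ih =>
    have := congrArg (fun a => a.relabel underQuantifier) (ih (liftSubst σ) l)
    simp only [Atom.relabel_eq_subst, Atom.subst_subst] at this
    refine (Atom.relabel_subst _ _ _).trans (Eq.trans ?_ (this.trans (Eq.trans ?_
      (Atom.relabel_subst _ _ _).symm)))
    · congr 1
      funext x
      rcases x with (_ | x) | x <;> rfl
    · congr 1
      funext x
      rcases x with (_ | x) | x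
      · rfl
      · simp [liftSubst, term_relabel_eq_subst, term_subst_subst, Term.subst, underQuantifier]
        rfl
      · rfl

/-- An embedding of parse trees. -/
structure Emb (A B : Formula L ℕ) where
  vert : A.Vertex → B.Vertex
  leaf : A.Leaf → B.Leaf
  kind : ∀ w, B.kind (vert w) = A.kind w
  parent_some : ∀ w p, A.parent w = some p → B.parent (vert w) = some (vert p)
  parent_root : ∀ p, B.parent (vert A.root) = some p → p = B.root
  leafVertex : ∀ l, B.leafVertex (leaf l) = vert (A.leafVertex l)

namespace Emb

def refl (A : Formula L ℕ) : Emb A A where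
  vert := id
  leaf := id
  kind _ := rfl
  parent_some _ _ h := h
  parent_root p h := by cases (parent_eq_none_iff.2 rfl).symm.trans h
  leafVertex _ := rfl

def parLeft (A B : Formula L ℕ) : Emb A (A.par B) where
  vert w := some (.inl w)
  leaf := Sum.inl
  kind _ := rfl
  parent_some _ _ h := map_inl_of_eq B.Vertex h
  parent_root p h := by
    cases (map_inl_of_eq B.Vertex (parent_eq_none_iff.2 (rfl : A.root = _))).symm.trans h
    rfl
  leafVertex _ := rfl

def parRight (A B : Formula L ℕ) : Emb B (A.par B) where
  vert w := some (.inr w)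
  leaf := Sum.inr
  kind _ := rfl
  parent_some _ _ h := map_inr_of_eq A.Vertex h
  parent_root p h := by
    cases (map_inr_of_eq A.Vertex (parent_eq_none_iff.2 (rfl : B.root = _))).symm.trans h
    rfl
  leafVertex _ := rfl

def tensorLeft (A B : Formula L ℕ) : Emb A (A.tensor B) where
  vert w := some (.inl w)
  leaf := Sum.inl
  kind _ := rfl
  parent_some _ _ h := map_inl_of_eq B.Vertex h
  parent_root p h := by
    cases (map_inl_of_eq B.Vertex (parent_eq_none_iff.2 (rfl : A.root = _))).symm.trans h
    rfl
  leafVertex _ := rfl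

def tensorRight (A B : Formula L ℕ) : Emb B (A.tensor B) where
  vert w := some (.inr w)
  leaf := Sum.inr
  kind _ := rfl
  parent_some _ _ h := map_inr_of_eq A.Vertex h
  parent_root p h := by
    cases (map_inr_of_eq A.Vertex (parent_eq_none_iff.2 (rfl : B.root = _))).symm.trans h
    rfl
  leafVertex _ := rfl

theorem parent_inst_root {A : Formula L (Option ℕ)} (t : L.Term ℕ) :
    A.parent (A.vertexSubst (fun o => o.elim t Term.var) (A.inst t).root) = none := by
  exact (A.parent_vertexSubst _ _).trans
    (congrArg (Option.map _) (parent_eq_none_iff.2 (rfl : (A.inst t).root = _)))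

def all (A : Formula L (Option ℕ)) (t : L.Term ℕ) : Emb (A.inst t) A.all where
  vert w := some (A.vertexSubst _ w)
  leaf := A.leafSubst _
  kind w := A.kind_vertexSubst _ w
  parent_some w p h := congrArg some ((A.parent_vertexSubst _ w).trans (congrArg (Option.map _) h))
  parent_root p h := by
    cases (congrArg some (parent_inst_root t)).symm.trans h
    rfl
  leafVertex l := congrArg some (A.leafVertex_leafSubst _ l)

def ex (A : Formula L (Option ℕ)) (t : L.Term ℕ) : Emb (A.inst t) A.ex where
  vert w := some (A.vertexSubst _ w)
  leaf := A.leafSubst _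
  kind w := A.kind_vertexSubst _ w
  parent_some w p h := congrArg some ((A.parent_vertexSubst _ w).trans (congrArg (Option.map _) h))
  parent_root p h := by
    cases (congrArg some (parent_inst_root t)).symm.trans h
    rfl
  leafVertex l := congrArg some (A.leafVertex_leafSubst _ l)

end Emb

end Formula

namespace Sequent

variable {L : FirstOrder.Language.{u, v}} {ι κ : Type}

/-- An embedding of parse forests. -/
structure Emb (Γ : Sequent L ι) (Γ' : Sequent L κ) where
  vert : Γ.Vertex → Γ'.Vertex
  leaf : Γ.Leaf → Γ'.Leaf
  inj : Function.Injective vert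
  kind : ∀ w, Γ'.kind (vert w) = Γ.kind w
  parent_iff : ∀ w p, Γ'.parent (vert w) = some (vert p) ↔ Γ.parent w = some p
  leafVertex : ∀ l, Γ'.leafVertex (leaf l) = vert (Γ.leafVertex l)

def Emb.ofComponents {Γ : Sequent L ι} {Γ' : Sequent L κ} (c : ι → κ)
    (e : ∀ i, Formula.Emb (Γ i) (Γ' (c i)))
    (hinj : Function.Injective fun w : Γ.Vertex => (⟨c w.1, (e w.1).vert w.2⟩ : Γ'.Vertex))
    (hroot : ∀ i p, (Γ' (c i)).parent ((e i).vert (Γ i).root) = some p →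
      ∀ w : Γ.Vertex, (⟨c w.1, (e w.1).vert w.2⟩ : Γ'.Vertex) ≠ ⟨c i, p⟩) :
    Emb Γ Γ' where
  vert w := ⟨c w.1, (e w.1).vert w.2⟩
  leaf l := ⟨c l.1, (e l.1).leaf l.2⟩
  inj := hinj
  kind w := (e w.1).kind w.2
  parent_iff := by
    have key : ∀ w p, Γ.parent w = some p →
        Γ'.parent ⟨c w.1, (e w.1).vert w.2⟩ = some ⟨c p.1, (e p.1).vert p.2⟩ := by
      intro w p h
      obtain ⟨q, hq, rfl⟩ := Option.map_eq_some_iff.1 h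
      exact Option.map_eq_some_iff.2 ⟨_, (e w.1).parent_some _ _ hq, rfl⟩
    refine fun w p => ⟨fun h => ?_, key w p⟩
    -- A root of `Γ` may acquire a parent, but by `hroot` never one in the image; this gives the
    -- converse direction.
    rcases hq : Γ.parent w with _ | q
    · obtain ⟨r, hr, hrp⟩ := Option.map_eq_some_iff.1 h
      rw [Formula.parent_eq_none_iff.1 (Option.map_eq_none_iff.1 hq)] at hr
      exact absurd hrp.symm (hroot _ r hr p)
    · have := (key w q hq).symm.trans h
      rw [hinj (Option.some_injective _ this)]
  leafVertex l := Sigma.ext rfl (heq_of_eq ((e l.1).leafVertex l.2))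

end Sequent

end FOMLL

/-! ### Good linkings along embeddings. -/

namespace FOMLL

open FirstOrder.Language (Term)

namespace SwGraph

variable {V V' : Type}

theorem Correct.mono {G : SwGraph V} {m m' : ℕ} (h : G.Correct m) (hm : m' ≤ m) :
    G.Correct m' := ⟨h.conn, by have := h.count; omega⟩

theorem Correct.of_bijective [Finite V] [Finite V'] {G : SwGraph V} {G' : SwGraph V'} {m : ℕ}
    (hG : G.Correct m) (f : V → V') (hf : Function.Bijective f)
    (hsw : ∀ v, G'.sw (f v) ↔ G.sw v) (hinto : ∀ u v, G'.into (f u) (f v) ↔ G.into u v)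
    (hlink : ∀ u v, G.link u v → G'.link (f u) (f v)) : G'.Correct m where
  conn s' hs' := by
    have : ∀ v, ∃ u, s' (f v) = f u := fun v => by
      obtain ⟨u, hu⟩ := hf.2 (s' (f v))
      exact ⟨u, hu.symm⟩
    choose s hs using this
    have hv : G.Valid s := fun v hv => by
      rw [← hinto, ← hs v]
      exact hs' _ ((hsw v).2 hv)
    intro Q hQ u _ v _ huQ
    obtain ⟨u, rfl⟩ := hf.2 u
    obtain ⟨v, rfl⟩ := hf.2 v
    refine hG.conn s hv (f ⁻¹' Q) (fun u _ v _ huv => ?_) u trivial v trivial huQ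
    refine hQ (f u) trivial (f v) trivial ?_
    rcases huv with h | h | ⟨h, rfl⟩
    · exact .inl (hlink u v h)
    · exact .inr (.inl ⟨(hinto u v).2 h.1, mt (hsw v).1 h.2⟩)
    · exact .inr (.inr ⟨(hsw v).2 h, hs v⟩)
  count := by
    have h4 : {p : V' × V' | G'.into p.1 p.2 ∧ ¬ G'.sw p.2} ⊆
        Prod.map f f '' {p : V × V | G.into p.1 p.2 ∧ ¬ G.sw p.2} := by
      rintro ⟨u, v⟩ ⟨huv, hv⟩
      obtain ⟨u, rfl⟩ := hf.2 u
      obtain ⟨v, rfl⟩ := hf.2 v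
      exact ⟨(u, v), ⟨(hinto u v).1 huv, mt (hsw v).2 hv⟩, rfl⟩
    have h5 : {v | G'.sw v} ⊆ f '' {v | G.sw v} := by
      intro v hv
      obtain ⟨v, rfl⟩ := hf.2 v
      exact ⟨v, (hsw v).1 hv, rfl⟩
    have h1 := hG.count
    have h2 := Set.ncard_image_of_injective {p : V × V | G.into p.1 p.2 ∧ ¬ G.sw p.2}
      (hf.1.prodMap hf.1)
    have h3 := Set.ncard_image_of_injective {v | G.sw v} hf.1
    have h6 := Set.ncard_le_ncard h4
    have h7 := Set.ncard_le_ncard h5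
    have h8 := Nat.card_le_card_of_injective f hf.1
    omega

end SwGraph

namespace Sequent

variable {L : FirstOrder.Language.{u, v}} {ι ι₁ ι₂ κ : Type}

section Emb

variable {Γ : Sequent L ι} {Γ' : Sequent L κ} {θ : Set (Sym2 Γ.Leaf)} {θ' : Set (Sym2 Γ'.Leaf)}
  {σ : Γ.Vertex → L.Term (ℕ ⊕ Γ.Vertex)} {σ' : Γ'.Vertex → L.Term (ℕ ⊕ Γ'.Vertex)}

theorem Emb.isSwitched_iff (F : Emb Γ Γ') (w : Γ.Vertex) :
    Γ'.IsSwitched (F.vert w) ↔ Γ.IsSwitched w := by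
  rw [IsSwitched, IsSwitched, F.kind]

/-- The assignment `σ'` extends the image of `σ` under an embedding and the renaming `g` of free
variables. -/
structure Emb.Extends (F : Emb Γ Γ') (g : ℕ → ℕ ⊕ Γ'.Vertex)
    (σ : Γ.Vertex → L.Term (ℕ ⊕ Γ.Vertex)) (σ' : Γ'.Vertex → L.Term (ℕ ⊕ Γ'.Vertex)) : Prop where
  apply_vert : ∀ w, σ' (F.vert w) = (σ w).relabel (Sum.elim g fun w => Sum.inr (F.vert w))
  ne_vert : ∀ n w, g n ≠ Sum.inr (F.vert w)
  apply_atom : ∀ l, (Γ'.leafAtom (F.leaf l)).subst (Sum.elim (fun x => .var (Sum.inl x)) σ') =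
    ((Γ.leafAtom l).subst (Sum.elim (fun x => .var (Sum.inl x)) σ)).relabel
      (Sum.elim g fun w => Sum.inr (F.vert w))

/-- Leaps between old vertices neither appear nor vanish: renamed free variables never name an old
vertex, and the embedding is injective. -/
theorem Emb.Extends.into_iff {F : Emb Γ Γ'} {g : ℕ → ℕ ⊕ Γ'.Vertex} (h : F.Extends g σ σ')
    (u w : Γ.Vertex) :
    (Γ'.netGraph θ' σ').into (F.vert u) (F.vert w) ↔ (Γ.netGraph θ σ).into u w := by
  refine or_congr (F.parent_iff u w) (and_congr (by rw [F.kind]) ?_)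
  rw [h.apply_vert, mem_termVars_relabel]
  constructor
  · rintro ⟨n | y, hy, hyw⟩
    · exact absurd hyw.symm (h.ne_vert n w)
    · rwa [F.inj (Sum.inr_injective hyw)]
  · exact fun hw => ⟨_, hw, rfl⟩

theorem Emb.link {F : Emb Γ Γ'} (hθ : Sym2.map F.leaf '' θ ⊆ θ') (u w : Γ.Vertex)
    (h : (Γ.netGraph θ σ).link u w) : (Γ'.netGraph θ' σ').link (F.vert u) (F.vert w) := by
  obtain ⟨l, l', hl, rfl, rfl⟩ := h
  exact ⟨F.leaf l, F.leaf l', hθ ⟨_, hl, rfl⟩, F.leafVertex l, F.leafVertex l'⟩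

theorem Emb.Extends.eq_var {F : Emb Γ Γ'} {g : ℕ → ℕ ⊕ Γ'.Vertex} (h : F.Extends g σ σ')
    (hσ : Γ.Witness θ σ) (w : Γ.Vertex) (hw : Γ'.kind (F.vert w) ≠ .ex) :
    σ' (F.vert w) = .var (.inr (F.vert w)) := by
  rw [h.apply_vert, hσ.eq_var w (by rwa [← F.kind])]
  rfl

theorem Emb.Extends.universal {F : Emb Γ Γ'} {g : ℕ → ℕ ⊕ Γ'.Vertex} (h : F.Extends g σ σ')
    (hσ : Γ.Witness θ σ) (hg : ∀ n w, g n = .inr w → Γ'.kind w = .all) (w : Γ.Vertex)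
    (hw : Γ'.kind (F.vert w) = .ex) (y : Γ'.Vertex) (hy : Sum.inr y ∈ termVars (σ' (F.vert w))) :
    Γ'.kind y = .all := by
  rw [h.apply_vert, mem_termVars_relabel] at hy
  obtain ⟨n | z, hz, hzy⟩ := hy
  · exact hg n y hzy.symm
  · obtain rfl := (Sum.inr_injective hzy)
    rw [F.kind] at hw ⊢
    exact hσ.universal w hw z hz

theorem Emb.Extends.equalizes {F : Emb Γ Γ'} {g : ℕ → ℕ ⊕ Γ'.Vertex} (h : F.Extends g σ σ')
    (hσ : Γ.Witness θ σ) (l l' : Γ'.Leaf) (hl : s(l, l') ∈ Sym2.map F.leaf '' θ) :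
    ((Γ'.leafAtom l).subst (Sum.elim (fun x => .var (Sum.inl x)) σ')).termSeq =
      ((Γ'.leafAtom l').subst (Sum.elim (fun x => .var (Sum.inl x)) σ')).termSeq := by
  have key : ∀ k k', s(k, k') ∈ θ →
      ((Γ'.leafAtom (F.leaf k)).subst (Sum.elim (fun x => .var (Sum.inl x)) σ')).termSeq =
        ((Γ'.leafAtom (F.leaf k')).subst (Sum.elim (fun x => .var (Sum.inl x)) σ')).termSeq := by
    intro k k' hk
    rw [h.apply_atom, h.apply_atom, Atom.relabel_eq_subst, Atom.relabel_eq_subst]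
    refine (Atom.termSeq_subst _ _).trans (Eq.trans ?_ (Atom.termSeq_subst _ _).symm)
    rw [hσ.equalizes k k' hk]
  obtain ⟨e, he, hel⟩ := hl
  induction e with
  | _ k k' =>
    rcases Sym2.eq_iff.1 hel with ⟨rfl, rfl⟩ | ⟨rfl, rfl⟩
    · exact key k k' he
    · exact (key k k' he).symm

/-- A criterion for extensions, in terms of the atoms before unification. -/
theorem Emb.extends_of_atom (F : Emb Γ Γ') {g : ℕ → ℕ ⊕ Γ'.Vertex}
    (τ : Γ'.Vertex → L.Term (ℕ ⊕ Γ'.Vertex))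
    (h₁ : ∀ w, σ' (F.vert w) = (σ w).relabel (Sum.elim g fun w => Sum.inr (F.vert w)))
    (h₂ : ∀ n w, g n ≠ Sum.inr (F.vert w))
    (hatom : ∀ l, (Γ'.leafAtom (F.leaf l)).subst (Sum.elim (fun x => .var (Sum.inl x)) τ) =
      (Γ.leafAtom l).relabel (Sum.elim g fun w => Sum.inr (F.vert w)))
    (hτ : ∀ w, (τ w).subst (Sum.elim (fun x => .var (Sum.inl x)) σ') = σ' w)
    (hg : ∀ n w, g n = Sum.inr w → σ' w = .var (.inr w)) : F.Extends g σ σ' := by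
  refine ⟨h₁, h₂, fun l => ?_⟩
  have := congrArg (fun a => a.subst (Sum.elim (fun x => .var (Sum.inl x)) σ')) (hatom l)
  simp only [Atom.relabel_subst, Atom.subst_subst] at this
  rw [Atom.relabel_eq_subst, Atom.subst_subst]
  refine Eq.trans ?_ (this.trans ?_)
  · congr 1
    funext x
    rcases x with x | w
    · rfl
    · exact (hτ w).symm
  · congr 1
    funext x
    rcases x with x | w
    · rcases hx : g x with y | w
      · simp [hx, Term.subst]
      · simp [hx, Term.subst, hg x w hx]
    · simp only [Sum.elim_inr, h₁, term_relabel_eq_subst]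

end Emb

theorem Good.of_bijective [Finite ι] [Finite κ] {Γ : Sequent L ι} {Γ' : Sequent L κ}
    {θ : Set (Sym2 Γ.Leaf)} (h : Γ.Good θ) (F : Emb Γ Γ') (hF : Function.Surjective F.vert)
    (hatom : ∀ l, Γ'.leafAtom (F.leaf l) = (Γ.leafAtom l).relabel (Sum.map id F.vert)) :
    Γ'.Good (Sym2.map F.leaf '' θ) := by
  obtain ⟨σ, hσ, hG⟩ := h
  choose p hp using hF
  have h₁ : ∀ w, (σ (p (F.vert w))).relabel (Sum.map id F.vert) =
      (σ w).relabel (Sum.map id F.vert) := fun w => by rw [F.inj (hp (F.vert w))]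
  have hE : F.Extends Sum.inl σ fun w => (σ (p w)).relabel (Sum.map id F.vert) :=
    F.extends_of_atom (fun w => .var (.inr w)) h₁ nofun (fun l => by
      rw [hatom l]
      refine (Atom.relabel_subst _ _ _).trans ((Atom.relabel_eq_subst _ _).trans ?_).symm
      congr 1
      funext x
      rcases x with x | x <;> rfl) (fun w => rfl) nofun
  refine ⟨_, ⟨fun w hw => ?_, fun w hw => ?_, hE.equalizes hσ⟩, ?_⟩
  · rw [← hp w] at hw
    have := hE.eq_var hσ (p w) hw
    rwa [hp] at this
  · have := hE.universal hσ nofun (p w)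
    rw [hp] at this
    exact this hw
  · refine (hG.of_bijective F.vert ⟨F.inj, fun w => ⟨p w, hp w⟩⟩ F.isSwitched_iff
      hE.into_iff (F.link subset_rfl)).mono ?_
    exact Set.ncard_image_le (Set.toFinite _)

/-- Covers par, ∀ and ∃. The renaming `g` turns the eigenvariable of a ∀ rule into the new vertex,
and `τ` gives a new ∃ its term. Leaps are thus created only when a ∀ captures a free variable
occurring in an earlier witness. -/
theorem Good.pendant [Finite ι] [Finite κ] {Γ : Sequent L ι} {Γ' : Sequent L κ}
    {θ : Set (Sym2 Γ.Leaf)} (h : Γ.Good θ) (F : Emb Γ Γ') (z : Γ'.Vertex) (a : Γ.Vertex)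
    (hz : ∀ w, w = z ∨ ∃ v, w = F.vert v) (hFz : ∀ v, F.vert v ≠ z) (hpz : Γ'.parent z = none)
    (ha : Γ'.parent (F.vert a) = some z)
    (hu : ¬ Γ'.IsSwitched z → ∀ u, Γ'.parent u = some z → u = F.vert a)
    (g : ℕ → ℕ ⊕ Γ'.Vertex) (hg : ∀ n w, g n = .inr w → w = z ∧ Γ'.kind z = .all)
    (τ : Γ'.Vertex → L.Term (ℕ ⊕ Γ'.Vertex)) (hτF : ∀ v, τ (F.vert v) = .var (.inr (F.vert v)))
    (hτ : Γ'.kind z ≠ .ex → τ z = .var (.inr z))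
    (hτz : Γ'.kind z = .ex → ∃ t : L.Term ℕ, τ z = t.relabel Sum.inl)
    (hatom : ∀ l, (Γ'.leafAtom (F.leaf l)).subst (Sum.elim (fun x => .var (Sum.inl x)) τ) =
      (Γ.leafAtom l).relabel (Sum.elim g fun w => Sum.inr (F.vert w))) :
    Γ'.Good (Sym2.map F.leaf '' θ) := by
  classical
  obtain ⟨σ, hσ, hG⟩ := h
  set G : ℕ ⊕ Γ.Vertex → ℕ ⊕ Γ'.Vertex := Sum.elim g fun w => Sum.inr (F.vert w) with hGdef
  set σ' : Γ'.Vertex → L.Term (ℕ ⊕ Γ'.Vertex) := fun w =>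
    if h : ∃ v, w = F.vert v then (σ h.choose).relabel G else τ w with hσ'
  have h₁ : ∀ v, σ' (F.vert v) = (σ v).relabel G := fun v => by
    have h : ∃ v', F.vert v = F.vert v' := ⟨v, rfl⟩
    simp only [hσ', dif_pos h]
    rw [← F.inj h.choose_spec]
  have hz' : σ' z = τ z := dif_neg fun ⟨v, hv⟩ => hFz v hv.symm
  have hnot : ∀ t : L.Term ℕ, ∀ y : Γ'.Vertex,
      Sum.inr y ∉ termVars (t.relabel (Sum.inl : ℕ → ℕ ⊕ Γ'.Vertex)) := by
    intro t y hy
    obtain ⟨_, -, h⟩ := mem_termVars_relabel.1 hy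
    cases h
  have hE : F.Extends g σ σ' := by
    refine F.extends_of_atom τ h₁ (fun n w h => hFz w (hg n _ h).1) hatom (fun w => ?_)
      fun n w h => ?_
    · rcases hz w with rfl | ⟨v, rfl⟩
      · rw [hz']
        by_cases hk : Γ'.kind w = .ex
        · obtain ⟨t, ht⟩ := hτz hk
          rw [ht, term_relabel_eq_subst, term_subst_subst]
          rfl
        · rw [hτ hk]
          exact hz'.trans (hτ hk)
      · rw [hτF]
        rfl
    · obtain ⟨rfl, hk⟩ := hg n w h
      rw [hz', hτ (by rw [hk]; nofun)]
  refine ⟨σ', ⟨fun w hw => ?_, fun w hw y hy => ?_, hE.equalizes hσ⟩, ?_⟩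
  · rcases hz w with rfl | ⟨v, rfl⟩
    · rw [hz', hτ hw]
    · exact hE.eq_var hσ v hw
  · rcases hz w with rfl | ⟨v, rfl⟩
    · obtain ⟨t, ht⟩ := hτz hw
      rw [hz', ht] at hy
      exact absurd hy (hnot t y)
    · exact hE.universal hσ (fun n w h => by obtain ⟨rfl, hk⟩ := hg n w h; exact hk) v hw y hy
  · refine (hG.pendant F.vert F.inj z a hz hFz F.isSwitched_iff hE.into_iff
      (F.link subset_rfl) ?_ (.inl ha) ?_).mono (Set.ncard_image_le (Set.toFinite _))
    -- Nothing leaves `z`: it has no parent, and the term of a new existential contains no universal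
    -- vertex.
    · rintro w (h | ⟨hk, h⟩)
      · rw [hpz] at h
        cases h
      · obtain ⟨t, ht⟩ := hτz hk
        rw [hz', ht] at h
        exact hnot t w h
    · rintro hs w (h | ⟨hk, h⟩)
      · exact hu hs w h
      · refine absurd (.inr ?_) hs
        rcases hz w with rfl | ⟨v, rfl⟩
        · obtain ⟨t, ht⟩ := hτz hk
          rw [hz', ht] at h
          exact absurd h (hnot t w)
        · exact hE.universal hσ (fun n w h => by obtain ⟨rfl, hk⟩ := hg n w h; exact hk) v hk z h

/-- The two witnesses are combined independently. Shared free variables do no harm, because they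
give no leaps, so no edge runs between the two images. -/
theorem Good.join [Finite ι₁] [Finite ι₂] [Finite κ] {Γ₁ : Sequent L ι₁} {Γ₂ : Sequent L ι₂}
    {Γ' : Sequent L κ} {θ₁ : Set (Sym2 Γ₁.Leaf)} {θ₂ : Set (Sym2 Γ₂.Leaf)} (h₁ : Γ₁.Good θ₁)
    (h₂ : Γ₂.Good θ₂) (F₁ : Emb Γ₁ Γ') (F₂ : Emb Γ₂ Γ') (z : Γ'.Vertex) (a : Γ₁.Vertex)
    (b : Γ₂.Vertex) (hz : ∀ w, w = z ∨ (∃ v, w = F₁.vert v) ∨ ∃ v, w = F₂.vert v)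
    (hFz₁ : ∀ v, F₁.vert v ≠ z) (hFz₂ : ∀ v, F₂.vert v ≠ z) (hF : ∀ v w, F₁.vert v ≠ F₂.vert w)
    (hp₁ : ∀ v w, Γ'.parent (F₁.vert v) ≠ some (F₂.vert w))
    (hp₂ : ∀ v w, Γ'.parent (F₂.vert v) ≠ some (F₁.vert w))
    (hpz : Γ'.parent z = none) (ha : Γ'.parent (F₁.vert a) = some z)
    (hb : Γ'.parent (F₂.vert b) = some z)
    (hu : ∀ u, Γ'.parent u = some z → u = F₁.vert a ∨ u = F₂.vert b) (hk : Γ'.kind z = .tensor)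
    (hatom₁ : ∀ l, Γ'.leafAtom (F₁.leaf l) = (Γ₁.leafAtom l).relabel (Sum.map id F₁.vert))
    (hatom₂ : ∀ l, Γ'.leafAtom (F₂.leaf l) = (Γ₂.leafAtom l).relabel (Sum.map id F₂.vert)) :
    Γ'.Good (Sym2.map F₁.leaf '' θ₁ ∪ Sym2.map F₂.leaf '' θ₂) := by
  classical
  obtain ⟨σ₁, hσ₁, hG₁⟩ := h₁
  obtain ⟨σ₂, hσ₂, hG₂⟩ := h₂
  set σ' : Γ'.Vertex → L.Term (ℕ ⊕ Γ'.Vertex) := fun w =>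
    if h : ∃ v, w = F₁.vert v then (σ₁ h.choose).relabel (Sum.map id F₁.vert) else
      if h : ∃ v, w = F₂.vert v then (σ₂ h.choose).relabel (Sum.map id F₂.vert) else
        .var (.inr w) with hσ'
  have h₁ : ∀ v, σ' (F₁.vert v) = (σ₁ v).relabel (Sum.map id F₁.vert) := fun v => by
    have h : ∃ v', F₁.vert v = F₁.vert v' := ⟨v, rfl⟩
    simp only [hσ', dif_pos h]
    rw [← F₁.inj h.choose_spec]
  have h₂ : ∀ v, σ' (F₂.vert v) = (σ₂ v).relabel (Sum.map id F₂.vert) := fun v => by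
    have h : ∃ v', F₂.vert v = F₂.vert v' := ⟨v, rfl⟩
    have h' : ¬ ∃ v', F₂.vert v = F₁.vert v' := fun ⟨v', hv⟩ => hF _ _ hv.symm
    simp only [hσ', dif_neg h', dif_pos h]
    rw [← F₂.inj h.choose_spec]
  have hz' : σ' z = .var (.inr z) := by
    have h : ¬ ∃ v', z = F₁.vert v' := fun ⟨v', hv⟩ => hFz₁ _ hv.symm
    have h' : ¬ ∃ v', z = F₂.vert v' := fun ⟨v', hv⟩ => hFz₂ _ hv.symm
    simp only [hσ', dif_neg h, dif_neg h']
  have aux : ∀ {ι : Type} {Γ : Sequent L ι} (F : Emb Γ Γ') (l : Γ.Leaf),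
      Γ'.leafAtom (F.leaf l) = (Γ.leafAtom l).relabel (Sum.map id F.vert) →
      (Γ'.leafAtom (F.leaf l)).subst
        (Sum.elim (fun x => .var (Sum.inl x)) fun w => .var (.inr w)) =
          (Γ.leafAtom l).relabel (Sum.elim Sum.inl fun w => Sum.inr (F.vert w)) := by
    intro ι Γ F l h
    rw [h]
    refine (Atom.relabel_subst _ _ _).trans ((Atom.relabel_eq_subst _ _).trans ?_).symm
    congr 1
    funext x
    rcases x with x | x <;> rfl
  have hE₁ : F₁.Extends Sum.inl σ₁ σ' := F₁.extends_of_atom (fun w => .var (.inr w)) h₁ nofun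
    (fun l => aux F₁ l (hatom₁ l)) (fun w => rfl) nofun
  have hE₂ : F₂.Extends Sum.inl σ₂ σ' := F₂.extends_of_atom (fun w => .var (.inr w)) h₂ nofun
    (fun l => aux F₂ l (hatom₂ l)) (fun w => rfl) nofun
  have hleap : ∀ {ι : Type} {Γ : Sequent L ι} {σ : Γ.Vertex → L.Term (ℕ ⊕ Γ.Vertex)}
      (F : Emb Γ Γ') (v : Γ.Vertex) (w : Γ'.Vertex), F.Extends Sum.inl σ σ' →
      Γ'.Leap σ' (F.vert v) w → ∃ v', w = F.vert v' := by
    intro ι Γ σ F v w hE hl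
    obtain ⟨n | y, hy, hyw⟩ := mem_termVars_relabel.1 (hE.apply_vert v ▸ hl.2)
    · cases hyw
    · exact ⟨y, Sum.inr_injective hyw⟩
  refine ⟨σ', ⟨fun w hw => ?_, fun w hw y hy => ?_, ?_⟩, ?_⟩
  · rcases hz w with rfl | ⟨v, rfl⟩ | ⟨v, rfl⟩
    · exact hz'
    · exact hE₁.eq_var hσ₁ v hw
    · exact hE₂.eq_var hσ₂ v hw
  · rcases hz w with rfl | ⟨v, rfl⟩ | ⟨v, rfl⟩
    · rw [hk] at hw
      cases hw
    · exact hE₁.universal hσ₁ nofun v hw y hy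
    · exact hE₂.universal hσ₂ nofun v hw y hy
  · rintro l l' (h | h)
    · exact hE₁.equalizes hσ₁ l l' h
    · exact hE₂.equalizes hσ₂ l l' h
  · refine hG₁.join hG₂ ((Set.ncard_union_le _ _).trans (Nat.add_le_add
      (Set.ncard_image_le (Set.toFinite _)) (Set.ncard_image_le (Set.toFinite _))))
      (Sum.elim F₁.vert F₂.vert) ?_ z a b ?_ ?_ ?_ ?_ ?_ ?_ ?_ (.inl ha) (.inl hb) ?_
    · rintro (v | v) (w | w) h
      · exact congrArg _ (F₁.inj h)
      · exact absurd h (hF _ _)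
      · exact absurd h.symm (hF _ _)
      · exact congrArg _ (F₂.inj h)
    · intro w
      rcases hz w with h | ⟨v, h⟩ | ⟨v, h⟩
      · exact .inl h
      · exact .inr ⟨.inl v, h⟩
      · exact .inr ⟨.inr v, h⟩
    · rintro (v | v)
      · exact hFz₁ v
      · exact hFz₂ v
    · rintro (v | v)
      · exact F₁.isSwitched_iff v
      · exact F₂.isSwitched_iff v
    · rintro (v | v) (w | w)
      · exact (hE₁.into_iff v w).trans Sum.liftRel_inl_inl.symm
      · refine iff_of_false ?_ Sum.not_liftRel_inl_inr
        rintro (h | h)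
        · exact hp₁ v w h
        · obtain ⟨v', hv'⟩ := hleap F₁ v _ hE₁ h
          exact hF _ _ hv'.symm
      · refine iff_of_false ?_ Sum.not_liftRel_inr_inl
        rintro (h | h)
        · exact hp₂ v w h
        · obtain ⟨v', hv'⟩ := hleap F₂ v _ hE₂ h
          exact hF _ _ hv'
      · exact (hE₂.into_iff v w).trans Sum.liftRel_inr_inr.symm
    · rintro _ _ (h | h)
      · exact F₁.link Set.subset_union_left _ _ h
      · exact F₂.link Set.subset_union_right _ _ h
    · rintro w (h | h)
      · rw [hpz] at h
        cases h
      · rw [Leap, hk] at h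
        cases h.1
    · rintro (h | h) <;> rw [hk] at h <;> cases h
    · rintro w (h | h)
      · exact hu w h
      · rcases hz w with rfl | ⟨v, rfl⟩ | ⟨v, rfl⟩
        · rw [Leap, hk] at h
          cases h.1
        · obtain ⟨v', hv'⟩ := hleap F₁ v _ hE₁ h
          exact absurd hv'.symm (hFz₁ _)
        · obtain ⟨v', hv'⟩ := hleap F₂ v _ hE₂ h
          exact absurd hv'.symm (hFz₂ _)

end Sequent

end FOMLL

/-! ### Each rule of the calculus preserves goodness. -/

namespace FOMLL

open FirstOrder.Language (Term)

variable {L : FirstOrder.Language.{u, v}}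

theorem Atom.subst_relabel {X Y Z : Type} (a : Atom L X) (σ : X → L.Term Y) (g : Y → Z) :
    (a.subst σ).relabel g = a.subst fun x => (σ x).relabel g := by
  rw [relabel_eq_subst, subst_subst]
  congr 1
  funext x
  exact (term_relabel_eq_subst _ _).symm

theorem Atom.relabel_relabel {X Y Z : Type} (a : Atom L X) (g : X → Y) (g' : Y → Z) :
    (a.relabel g).relabel g' = a.subst fun x => .var (g' (g x)) := by
  rw [relabel_eq_subst, relabel_subst]

theorem Formula.leafAtom_inst {Z : Type} (A : Formula L (Option ℕ)) (t : L.Term ℕ)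
    (l : (A.inst t).Leaf) (κ : ℕ ⊕ A.Vertex → L.Term Z) :
    ((A.inst t).leafAtom l).subst
        (Sum.elim (fun x => κ (.inl x)) fun w => κ (.inr (A.vertexSubst _ w))) =
      (A.leafAtom (A.leafSubst _ l)).subst (Sum.elim
        (fun o => o.elim (t.subst fun x => κ (.inl x)) fun x => κ (.inl x))
        fun w => κ (.inr w)) := by
  have := congrArg (fun a => a.subst κ) (A.leafAtom_leafSubst _ l)
  simp only [Atom.subst_subst] at this
  refine Eq.trans ?_ (this.trans ?_)
  · congr 1
    funext x
    rcases x with x | x <;> rfl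
  · congr 1
    funext x
    rcases x with (_ | x) | x
    · exact (congrArg (fun t => t.subst κ) (term_relabel_eq_subst _ _)).trans
        (term_subst_subst _ _ _)
    · rfl
    · rfl

namespace Sequent

variable {ι κ : Type}

theorem lcons_eq_of_parent {B : Formula L ℕ} {Γ : Sequent L ι} {u : Vertex (lcons B Γ)}
    {w : B.Vertex} (h : parent (lcons B Γ) u = some ⟨none, w⟩) :
    ∃ d, u = ⟨none, d⟩ ∧ B.parent d = some w :=
  parent_eq_some_iff.1 h

/-- Transfers hypotheses about the principal formula alone to the whole sequent. The context
contributes only `hΓ`: the renaming must not touch its free variables. -/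
theorem Good.unary [Finite ι] {Γ : Sequent L ι} {A B : Formula L ℕ}
    {θ : Set (Sym2 (Leaf (lcons A Γ)))} (h : Good (lcons A Γ) θ) (e : Formula.Emb A B)
    (hinj : Function.Injective e.vert) (hsurj : ∀ w, w = B.root ∨ ∃ v, w = e.vert v)
    (hne : ∀ v, e.vert v ≠ B.root) (hp : B.parent (e.vert A.root) = some B.root)
    (hp' : ∀ w, B.parent w = some B.root → w = e.vert A.root)
    (g : ℕ → ℕ ⊕ B.Vertex) (hg : ∀ n w, g n = .inr w → w = B.root ∧ B.kind B.root = .all)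
    (hΓ : ∀ i, ∀ n ∈ (Γ i).freeVars, g n = .inl n)
    (τ : B.Vertex → L.Term (ℕ ⊕ B.Vertex)) (hτe : ∀ v, τ (e.vert v) = .var (.inr (e.vert v)))
    (hτ : B.kind B.root ≠ .ex → τ B.root = .var (.inr B.root))
    (hτr : B.kind B.root = .ex → ∃ t : L.Term ℕ, τ B.root = t.relabel Sum.inl)
    (hatom : ∀ l, (B.leafAtom (e.leaf l)).subst (Sum.elim (fun x => .var (Sum.inl x)) τ) =
      (A.leafAtom l).relabel (Sum.elim g fun w => Sum.inr (e.vert w))) :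
    ∃ f : Leaf (lcons A Γ) → Leaf (lcons B Γ), (∀ l, f ⟨none, l⟩ = ⟨none, e.leaf l⟩) ∧
      (∀ i l, f ⟨some i, l⟩ = ⟨some i, l⟩) ∧ Good (lcons B Γ) (Sym2.map f '' θ) := by
  let m : ℕ ⊕ B.Vertex → ℕ ⊕ Vertex (lcons B Γ) := Sum.map id fun w => ⟨none, w⟩
  let F : Emb (lcons A Γ) (lcons B Γ) := Emb.ofComponents id
    (fun | none => e | some i => .refl (Γ i)) (by
      rintro ⟨_ | i, v⟩ ⟨_ | j, w⟩ hvw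
      · have hvw : e.vert v = e.vert w := eq_of_heq (Sigma.mk.inj hvw).2
        rw [hinj hvw]
      · cases congrArg Sigma.fst hvw
      · cases congrArg Sigma.fst hvw
      · cases congrArg Sigma.fst hvw
        cases eq_of_heq (Sigma.mk.inj hvw).2
        rfl) (by
      rintro (_ | i) p hp ⟨_ | j, w⟩ h
      · have h : e.vert w = p := eq_of_heq (Sigma.mk.inj h).2
        exact hne w (h.trans (e.parent_root p hp))
      · cases congrArg Sigma.fst h
      · cases (Formula.parent_eq_none_iff.2 rfl).symm.trans hp
      · cases (Formula.parent_eq_none_iff.2 rfl).symm.trans hp)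
  refine ⟨F.leaf, fun _ => rfl, fun _ _ => rfl, h.pendant F ⟨none, B.root⟩ ⟨none, A.root⟩ ?_ ?_ ?_
    ?_ ?_ (fun n => m (g n)) ?_
    (fun | ⟨none, w⟩ => (τ w).relabel m | ⟨some i, w⟩ => .var (.inr ⟨some i, w⟩))
    ?_ ?_ ?_ ?_⟩
  · rintro ⟨_ | i, w⟩
    · rcases hsurj w with rfl | ⟨v, rfl⟩
      · exact .inl rfl
      · exact .inr ⟨⟨none, v⟩, rfl⟩
    · exact .inr ⟨⟨some i, w⟩, rfl⟩
  · rintro ⟨_ | i, w⟩ h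
    · exact hne w (eq_of_heq (Sigma.mk.inj h).2)
    · cases congrArg Sigma.fst h
  · exact congrArg (Option.map _) (Formula.parent_eq_none_iff.2 (rfl : B.root = _))
  · exact congrArg (Option.map _) hp
  · rintro - u hu
    obtain ⟨d, rfl, hd⟩ := lcons_eq_of_parent hu
    rw [hp' d hd]
    rfl
  · intro n w h
    rcases hn : g n with k | v
    · simp [hn, m] at h
    · obtain ⟨rfl, hk⟩ := hg n v hn
      simp only [hn, m, Sum.map_inr, Sum.inr.injEq] at h
      exact ⟨h.symm, hk⟩
  · rintro ⟨_ | i, w⟩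
    · exact congrArg (Term.relabel m) (hτe w)
    · rfl
  · exact fun hk => congrArg (Term.relabel m) (hτ hk)
  · intro hk
    obtain ⟨t, ht⟩ := hτr hk
    refine ⟨t, (congrArg (Term.relabel m) ht).trans ?_⟩
    rw [term_relabel_eq_subst, term_relabel_eq_subst, term_relabel_eq_subst, term_subst_subst]
    rfl
  · rintro ⟨_ | i, l⟩
    · have := congrArg (fun a => a.relabel m) (hatom l)
      simp only [Atom.subst_relabel, Atom.relabel_relabel] at this
      refine (Atom.relabel_subst _ _ _).trans (Eq.trans ?_ (this.trans
        (Eq.trans ?_ (Atom.relabel_relabel _ _ _).symm)))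
      · congr 1
        funext x
        rcases x with x | x <;> rfl
      · congr 1
        funext x
        rcases x with x | x <;> rfl
    · refine (Atom.relabel_subst _ _ _).trans (Eq.trans ?_ (Atom.relabel_relabel _ _ _).symm)
      refine Atom.subst_congr ?_
      rintro (n | w) hn
      · have := hΓ i n (Formula.mem_freeVars_of_mem_leafAtom hn)
        exact (congrArg (fun y => (.var (m y) : L.Term (ℕ ⊕ Vertex (lcons B Γ)))) this).symm
      · rfl

theorem Good.all [Finite ι] {Γ : Sequent L ι} {A : Formula L (Option ℕ)} {x : ℕ}
    {θ : Set (Sym2 (Leaf (lcons (A.inst (.var x)) Γ)))} (h : Good (lcons (A.inst (.var x)) Γ) θ)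
    (hA : x ∉ A.all.freeVars) (hΓ : ∀ i, x ∉ (Γ i).freeVars) :
    ∃ f : Leaf (lcons (A.inst (.var x)) Γ) → Leaf (lcons A.all Γ),
      (∀ l, f ⟨none, l⟩ = ⟨none, A.leafSubst _ l⟩) ∧
      (∀ i l, f ⟨some i, l⟩ = ⟨some i, l⟩) ∧ Good (lcons A.all Γ) (Sym2.map f '' θ) := by
  refine h.unary (.all A (.var x)) (fun v w h => (A.vertexSubst _).injective (Option.some_injective _ h)) ?_
    nofun (congrArg some (Formula.Emb.parent_inst_root _)) ?_
    -- The eigenvariable becomes the variable bound at the new root. Its absence from the context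
    -- and from the quantified formula means that at the leaves it occurs only where the bound
    -- variable does.
    (fun n => if n = x then .inr none else .inl n) ?_ ?_
    (fun w => .var (.inr w)) (fun _ => rfl) (fun _ => rfl) nofun ?_
  · rintro (_ | w)
    · exact .inl rfl
    · exact .inr ⟨(A.vertexSubst _).symm w, congrArg some (Equiv.apply_symm_apply _ _).symm⟩
  · rintro (_ | w) hw
    · cases hw
    · have hw := Formula.parent_eq_none_iff.1 (Option.some_injective _ hw)
      rw [hw]
      exact congrArg some (Formula.parent_eq_none_iff.1 (Formula.Emb.parent_inst_root _)).symm
  · intro n w h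
    by_cases hn : n = x
    · simp only [hn, if_true] at h
      exact ⟨(Sum.inr_injective h).symm, rfl⟩
    · simp [hn] at h
  · intro i n hn
    rw [if_neg]
    rintro rfl
    exact hΓ i hn
  · intro l
    refine (Atom.relabel_subst _ _ _).trans (Eq.trans ?_ ((A.leafAtom_inst (.var x) l
      (Sum.elim (fun n => if n = x then .var (.inr none) else .var (.inl n))
        fun w => .var (.inr (some w)))).symm.trans
          (Eq.trans ?_ (Atom.relabel_eq_subst _ _).symm)))
    · refine Atom.subst_congr ?_
      rintro ((_ | n) | w) hn
      · simp only [Formula.underQuantifier, Sum.elim_inl, Option.elim_none, Term.subst, if_true]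
        rfl
      · have hn : n ≠ x := by
          rintro rfl
          exact hA (Finset.mem_eraseNone.2 (Formula.mem_freeVars_of_mem_leafAtom hn))
        simp only [Formula.underQuantifier, Sum.elim_inl, Option.elim_some, hn, if_false]
        rfl
      · rfl
    · congr 1
      funext y
      rcases y with y | y
      · by_cases hy : y = x <;> simp [hy]
      · rfl

theorem Good.ex [Finite ι] {Γ : Sequent L ι} {A : Formula L (Option ℕ)} {t : L.Term ℕ}
    {θ : Set (Sym2 (Leaf (lcons (A.inst t) Γ)))} (h : Good (lcons (A.inst t) Γ) θ) :
    ∃ f : Leaf (lcons (A.inst t) Γ) → Leaf (lcons A.ex Γ),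
      (∀ l, f ⟨none, l⟩ = ⟨none, A.leafSubst _ l⟩) ∧
      (∀ i l, f ⟨some i, l⟩ = ⟨some i, l⟩) ∧ Good (lcons A.ex Γ) (Sym2.map f '' θ) := by
  refine h.unary (.ex A t) (fun v w h => (A.vertexSubst _).injective (Option.some_injective _ h)) ?_
    nofun (congrArg some (Formula.Emb.parent_inst_root _)) ?_
    (fun n => .inl n) nofun (fun _ _ _ => rfl)
    (fun | none => t.relabel Sum.inl | some w => .var (.inr (some w))) (fun _ => rfl)
    (fun h => absurd rfl h) (fun _ => ⟨t, rfl⟩) ?_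
  · rintro (_ | w)
    · exact .inl rfl
    · exact .inr ⟨(A.vertexSubst _).symm w, congrArg some (Equiv.apply_symm_apply _ _).symm⟩
  · rintro (_ | w) hw
    · cases hw
    · have hw := Formula.parent_eq_none_iff.1 (Option.some_injective _ hw)
      rw [hw]
      exact congrArg some (Formula.parent_eq_none_iff.1 (Formula.Emb.parent_inst_root _)).symm
  · intro l
    refine (Atom.relabel_subst _ _ _).trans (Eq.trans ?_ ((A.leafAtom_inst t l
      (Sum.elim (fun n => .var (.inl n)) fun w => .var (.inr (some w)))).symm.trans
          (Eq.trans ?_ (Atom.relabel_eq_subst _ _).symm)))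
    · congr 1
      funext x
      rcases x with (_ | n) | w
      · exact term_relabel_eq_subst _ _
      · rfl
      · rfl
    · congr 1
      funext y
      rcases y with y | y <;> rfl

theorem Good.par [Finite ι] {Γ : Sequent L ι} {A B : Formula L ℕ}
    {θ : Set (Sym2 (Leaf (lcons A (lcons B Γ))))} (h : Good (lcons A (lcons B Γ)) θ) :
    ∃ f : Leaf (lcons A (lcons B Γ)) → Leaf (lcons (A.par B) Γ),
      (∀ l, f ⟨none, l⟩ = ⟨none, Sum.inl l⟩) ∧ (∀ l, f ⟨some none, l⟩ = ⟨none, Sum.inr l⟩) ∧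
      (∀ i l, f ⟨some (some i), l⟩ = ⟨some i, l⟩) ∧
        Good (lcons (A.par B) Γ) (Sym2.map f '' θ) := by
  let F : Emb (lcons A (lcons B Γ)) (lcons (A.par B) Γ) := Emb.ofComponents
    (fun | none => none | some none => none | some (some i) => some i)
    (fun | none => .parLeft A B | some none => .parRight A B | some (some i) => .refl (Γ i)) (by
      rintro ⟨_ | _ | i, v⟩ ⟨_ | _ | j, w⟩ h
      · cases eq_of_heq (Sigma.mk.inj h).2
        rfl
      · cases eq_of_heq (Sigma.mk.inj h).2
      · cases congrArg Sigma.fst h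
      · cases eq_of_heq (Sigma.mk.inj h).2
      · cases eq_of_heq (Sigma.mk.inj h).2
        rfl
      · cases congrArg Sigma.fst h
      · cases congrArg Sigma.fst h
      · cases congrArg Sigma.fst h
      · cases congrArg Sigma.fst h
        cases eq_of_heq (Sigma.mk.inj h).2
        rfl) (by
      rintro (_ | _ | i) p hp ⟨_ | _ | j, w⟩ h
      · cases (Formula.Emb.parLeft A B).parent_root p hp
        cases eq_of_heq (Sigma.mk.inj h).2
      · cases (Formula.Emb.parLeft A B).parent_root p hp
        cases eq_of_heq (Sigma.mk.inj h).2
      · cases congrArg Sigma.fst h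
      · cases (Formula.Emb.parRight A B).parent_root p hp
        cases eq_of_heq (Sigma.mk.inj h).2
      · cases (Formula.Emb.parRight A B).parent_root p hp
        cases eq_of_heq (Sigma.mk.inj h).2
      · cases congrArg Sigma.fst h
      · cases (Formula.parent_eq_none_iff.2 rfl).symm.trans hp
      · cases (Formula.parent_eq_none_iff.2 rfl).symm.trans hp
      · cases (Formula.parent_eq_none_iff.2 rfl).symm.trans hp)
  -- A par is switched, so a single premise is enough to attach it: whichever premise a switching
  -- chooses lies in the old connected part.
  refine ⟨F.leaf, fun _ => rfl, fun _ => rfl, fun _ _ => rfl,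
    h.pendant F ⟨none, none⟩ ⟨none, A.root⟩ ?_ ?_ rfl ?_ (fun h => absurd (.inl rfl) h) Sum.inl
      nofun (fun w => .var (.inr w)) (fun _ => rfl) (fun _ => rfl) nofun ?_⟩
  · rintro ⟨_ | i, w⟩
    · rcases w with _ | w | w
      · exact .inl rfl
      · exact .inr ⟨⟨none, w⟩, rfl⟩
      · exact .inr ⟨⟨some none, w⟩, rfl⟩
    · exact .inr ⟨⟨some (some i), w⟩, rfl⟩
  · rintro ⟨_ | _ | i, w⟩ h
    · cases eq_of_heq (Sigma.mk.inj h).2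
    · cases eq_of_heq (Sigma.mk.inj h).2
    · cases congrArg Sigma.fst h
  · exact congrArg (Option.map _)
      (map_inl_of_eq B.Vertex (Formula.parent_eq_none_iff.2 (rfl : A.root = _)))
  · rintro ⟨_ | _ | i, l⟩
    · refine (Atom.relabel_subst _ _ _).trans ((Atom.relabel_subst _ _ _).trans
        (Eq.trans ?_ (Atom.relabel_relabel _ _ _).symm))
      congr 1
      funext x
      rcases x with x | x <;> rfl
    · refine (Atom.relabel_subst _ _ _).trans ((Atom.relabel_subst _ _ _).trans
        (Eq.trans ?_ (Atom.relabel_relabel _ _ _).symm))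
      congr 1
      funext x
      rcases x with x | x <;> rfl
    · refine (Atom.relabel_subst _ _ _).trans (Eq.trans ?_ (Atom.relabel_relabel _ _ _).symm)
      congr 1
      funext x
      rcases x with x | x <;> rfl

theorem Good.tensor [Finite ι] [Finite κ] {Γ : Sequent L ι} {Δ : Sequent L κ} {A B : Formula L ℕ}
    {θ₁ : Set (Sym2 (Leaf (lcons A Γ)))} {θ₂ : Set (Sym2 (Leaf (lcons B Δ)))}
    (h₁ : Good (lcons A Γ) θ₁) (h₂ : Good (lcons B Δ) θ₂) :
    ∃ (f₁ : Leaf (lcons A Γ) → Leaf (lcons (A.tensor B) (Sum.elim Γ Δ)))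
      (f₂ : Leaf (lcons B Δ) → Leaf (lcons (A.tensor B) (Sum.elim Γ Δ))),
      (∀ l, f₁ ⟨none, l⟩ = ⟨none, Sum.inl l⟩) ∧ (∀ i l, f₁ ⟨some i, l⟩ = ⟨some (.inl i), l⟩) ∧
      (∀ l, f₂ ⟨none, l⟩ = ⟨none, Sum.inr l⟩) ∧ (∀ i l, f₂ ⟨some i, l⟩ = ⟨some (.inr i), l⟩) ∧
        Good (lcons (A.tensor B) (Sum.elim Γ Δ)) (Sym2.map f₁ '' θ₁ ∪ Sym2.map f₂ '' θ₂) := by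
  let F₁ : Emb (lcons A Γ) (lcons (A.tensor B) (Sum.elim Γ Δ)) := Emb.ofComponents
    (fun | none => none | some i => some (.inl i))
    (fun | none => .tensorLeft A B | some i => .refl (Γ i)) (by
      rintro ⟨_ | i, v⟩ ⟨_ | j, w⟩ h
      · cases eq_of_heq (Sigma.mk.inj h).2
        rfl
      · cases congrArg Sigma.fst h
      · cases congrArg Sigma.fst h
      · cases congrArg Sigma.fst h
        cases eq_of_heq (Sigma.mk.inj h).2
        rfl) (by
      rintro (_ | i) p hp ⟨_ | j, w⟩ h
      · cases (Formula.Emb.tensorLeft A B).parent_root p hp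
        cases eq_of_heq (Sigma.mk.inj h).2
      · cases congrArg Sigma.fst h
      · cases (Formula.parent_eq_none_iff.2 rfl).symm.trans hp
      · cases (Formula.parent_eq_none_iff.2 rfl).symm.trans hp)
  let F₂ : Emb (lcons B Δ) (lcons (A.tensor B) (Sum.elim Γ Δ)) := Emb.ofComponents
    (fun | none => none | some i => some (.inr i))
    (fun | none => .tensorRight A B | some i => .refl (Δ i)) (by
      rintro ⟨_ | i, v⟩ ⟨_ | j, w⟩ h
      · cases eq_of_heq (Sigma.mk.inj h).2
        rfl
      · cases congrArg Sigma.fst h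
      · cases congrArg Sigma.fst h
      · cases congrArg Sigma.fst h
        cases eq_of_heq (Sigma.mk.inj h).2
        rfl) (by
      rintro (_ | i) p hp ⟨_ | j, w⟩ h
      · cases (Formula.Emb.tensorRight A B).parent_root p hp
        cases eq_of_heq (Sigma.mk.inj h).2
      · cases congrArg Sigma.fst h
      · cases (Formula.parent_eq_none_iff.2 rfl).symm.trans hp
      · cases (Formula.parent_eq_none_iff.2 rfl).symm.trans hp)
  have hpar₁ : ∀ v p, parent (lcons (A.tensor B) (Sum.elim Γ Δ)) (F₁.vert v) = some p →
      ∀ w, F₂.vert w ≠ p := by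
    intro v p hp w hw
    subst hw
    obtain ⟨d, hd, hdp⟩ := parent_eq_some_iff.1 hp
    rcases v with ⟨_ | i, v⟩ <;> rcases w with ⟨_ | j, w⟩
    · cases eq_of_heq (Sigma.mk.inj hd).2
      have hdp := Option.some_injective _ hdp
      cases h : A.parent v <;> rw [h] at hdp <;> cases hdp
    · cases congrArg Sigma.fst hd
    · cases congrArg Sigma.fst hd
    · cases congrArg Sigma.fst hd
  have hpar₂ : ∀ v p, parent (lcons (A.tensor B) (Sum.elim Γ Δ)) (F₂.vert v) = some p →
      ∀ w, F₁.vert w ≠ p := by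
    intro v p hp w hw
    subst hw
    obtain ⟨d, hd, hdp⟩ := parent_eq_some_iff.1 hp
    rcases v with ⟨_ | i, v⟩ <;> rcases w with ⟨_ | j, w⟩
    · cases eq_of_heq (Sigma.mk.inj hd).2
      have hdp := Option.some_injective _ hdp
      cases h : B.parent v <;> rw [h] at hdp <;> cases hdp
    · cases congrArg Sigma.fst hd
    · cases congrArg Sigma.fst hd
    · cases congrArg Sigma.fst hd
  refine ⟨F₁.leaf, F₂.leaf, fun _ => rfl, fun _ _ => rfl, fun _ => rfl, fun _ _ => rfl,
    h₁.join h₂ F₁ F₂ ⟨none, none⟩ ⟨none, A.root⟩ ⟨none, B.root⟩ ?_ ?_ ?_ ?_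
      (fun v w h => hpar₁ v _ h w rfl) (fun v w h => hpar₂ v _ h w rfl) rfl ?_ ?_ ?_ rfl ?_ ?_⟩
  · rintro ⟨_ | i | i, w⟩
    · rcases w with _ | w | w
      · exact .inl rfl
      · exact .inr (.inl ⟨⟨none, w⟩, rfl⟩)
      · exact .inr (.inr ⟨⟨none, w⟩, rfl⟩)
    · exact .inr (.inl ⟨⟨some i, w⟩, rfl⟩)
    · exact .inr (.inr ⟨⟨some i, w⟩, rfl⟩)
  · rintro ⟨_ | i, w⟩ h
    · cases eq_of_heq (Sigma.mk.inj h).2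
    · cases congrArg Sigma.fst h
  · rintro ⟨_ | i, w⟩ h
    · cases eq_of_heq (Sigma.mk.inj h).2
    · cases congrArg Sigma.fst h
  · rintro ⟨_ | i, v⟩ ⟨_ | j, w⟩ h
    · cases eq_of_heq (Sigma.mk.inj h).2
    · cases congrArg Sigma.fst h
    · cases congrArg Sigma.fst h
    · cases congrArg Sigma.fst h
  · exact congrArg (Option.map _)
      (map_inl_of_eq B.Vertex (Formula.parent_eq_none_iff.2 (rfl : A.root = _)))
  · exact congrArg (Option.map _)
      (map_inr_of_eq A.Vertex (Formula.parent_eq_none_iff.2 (rfl : B.root = _)))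
  · intro u hu
    obtain ⟨d, rfl, hd⟩ := lcons_eq_of_parent hu
    rcases d with _ | d | d
    · cases hd
    · have hd := Option.some_injective _ hd
      rw [Formula.parent_eq_none_iff.1 (Option.map_eq_none_iff.1 hd)]
      exact .inl rfl
    · have hd := Option.some_injective _ hd
      rw [Formula.parent_eq_none_iff.1 (Option.map_eq_none_iff.1 hd)]
      exact .inr rfl
  · rintro ⟨_ | i, l⟩
    · refine (Atom.relabel_relabel _ _ _).trans (Eq.trans ?_ (Atom.relabel_relabel _ _ _).symm)
      congr 1
      funext x
      rcases x with x | x <;> rfl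
    · refine Eq.trans ?_ (Atom.relabel_relabel _ _ _).symm
      refine (Atom.relabel_eq_subst _ _).trans ?_
      congr 1
      funext x
      rcases x with x | x <;> rfl
  · rintro ⟨_ | i, l⟩
    · refine (Atom.relabel_relabel _ _ _).trans (Eq.trans ?_ (Atom.relabel_relabel _ _ _).symm)
      congr 1
      funext x
      rcases x with x | x <;> rfl
    · refine Eq.trans ?_ (Atom.relabel_relabel _ _ _).symm
      refine (Atom.relabel_eq_subst _ _).trans ?_
      congr 1
      funext x
      rcases x with x | x <;> rfl

theorem Good.ax (D : Duality L) (a : Atom L ℕ) :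
    Good (lcons (.atom a) fun _ : Unit => .atom (a.neg D)) {s(⟨none, ()⟩, ⟨some (), ()⟩)} := by
  set Γ : Sequent L (Option Unit) := lcons (.atom a) fun _ : Unit => .atom (a.neg D) with hΓ
  have hkind : ∀ w, Γ.kind w = .atom := by rintro ⟨_ | _, w⟩ <;> rfl
  have hpar : ∀ w, Γ.parent w = none := by rintro ⟨_ | _, w⟩ <;> rfl
  have hinto : ∀ u w, ¬ (Γ.netGraph {s(⟨none, ()⟩, ⟨some (), ()⟩)}
      fun w => .var (.inr w)).into u w := by
    rintro u w (h | ⟨h, -⟩)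
    · rw [hpar] at h
      cases h
    · rw [hkind] at h
      cases h
  have hsw : ∀ w, ¬ Γ.IsSwitched w := by
    rintro w (h | h) <;> rw [hkind] at h <;> cases h
  refine ⟨fun w => .var (.inr w), ⟨fun _ _ => rfl, fun w hw => ?_, ?_⟩, ?_, ?_⟩
  · rw [hkind] at hw
    cases hw
  · have key : ((Γ.leafAtom ⟨none, ()⟩).subst (Sum.elim (fun x => .var (Sum.inl x))
        fun w => .var (.inr w))).termSeq = ((Γ.leafAtom ⟨some (), ()⟩).subst
          (Sum.elim (fun x => .var (Sum.inl x)) fun w => .var (.inr w))).termSeq := by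
      refine (congrArg Atom.termSeq ((Atom.relabel_subst _ _ _).trans
        (Atom.relabel_subst a _ _))).trans (Eq.trans ?_ (congrArg Atom.termSeq
          ((Atom.relabel_subst _ _ _).trans (Atom.relabel_subst (a.neg D) _ _))).symm)
      rfl
    intro l l' h
    rcases Sym2.eq_iff.1 (Set.mem_singleton_iff.1 h) with ⟨rfl, rfl⟩ | ⟨rfl, rfl⟩
    · exact key
    · exact key.symm
  · intro s hs Q hQ u _ v _ huQ
    have := hQ ⟨none, ()⟩ trivial ⟨some (), ()⟩ trivial
      (.link ⟨⟨none, ()⟩, ⟨some (), ()⟩, rfl, rfl, rfl⟩)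
    rcases u with ⟨_ | _, u⟩ <;> rcases v with ⟨_ | _, v⟩
    · exact huQ
    · exact this.1 huQ
    · exact this.2 huQ
    · exact huQ
  · have h₁ : {p : Γ.Vertex × Γ.Vertex | (Γ.netGraph {s(⟨none, ()⟩, ⟨some (), ()⟩)}
        fun w => .var (.inr w)).into p.1 p.2 ∧ ¬ (Γ.netGraph {s(⟨none, ()⟩, ⟨some (), ()⟩)}
          fun w => .var (.inr w)).sw p.2} = ∅ :=
      Set.eq_empty_of_forall_notMem fun p hp => hinto _ _ hp.1
    have h₂ : {w | (Γ.netGraph {s(⟨none, ()⟩, ⟨some (), ()⟩)}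
        fun w => .var (.inr w)).sw w} = ∅ := Set.eq_empty_of_forall_notMem hsw
    have : Nontrivial Γ.Vertex := ⟨⟨none, ()⟩, ⟨some (), ()⟩, fun h => by cases congrArg Sigma.fst h⟩
    rw [h₁, h₂, Set.ncard_empty, Set.ncard_empty, Set.ncard_singleton]
    exact Finite.one_lt_card (α := Γ.Vertex)

theorem Good.reindex [Finite ι] [Finite κ] {Γ : Sequent L κ} (c : ι → κ)
    (hc : Function.Bijective c) {θ : Set (Sym2 (Leaf fun i => Γ (c i)))}
    (h : Good (fun i => Γ (c i)) θ) :
    Good Γ (Sym2.map (fun l : Leaf fun i => Γ (c i) => (⟨c l.1, l.2⟩ : Γ.Leaf)) '' θ) := by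
  let F : Emb (fun i => Γ (c i)) Γ := Emb.ofComponents c (fun i => .refl (Γ (c i))) (by
    rintro ⟨i, v⟩ ⟨j, w⟩ h
    obtain rfl := hc.1 (congrArg Sigma.fst h)
    have h : v = w := eq_of_heq (Sigma.mk.inj h).2
    rw [h]) (by
    intro i p hp
    cases (Formula.parent_eq_none_iff.2 rfl).symm.trans hp)
  refine h.of_bijective F ?_ ?_
  · rintro ⟨j, w⟩
    obtain ⟨i, rfl⟩ := hc.2 j
    exact ⟨⟨i, w⟩, rfl⟩
  · rintro ⟨i, l⟩
    refine Eq.trans ?_ (Atom.relabel_relabel _ _ _).symm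
    refine (Atom.relabel_eq_subst _ _).trans ?_
    congr 1
    funext x
    rcases x with x | x <;> rfl

end Sequent

end FOMLL

/-! ### Translations of proofs are correct. -/

namespace FOMLL

open FirstOrder.Language (Term)

section Sound

variable {L : FirstOrder.Language.{u, v}} {D : Duality L} {Λ ι κ : Type}

/-- The set `Θ` of pairs of labels comes from a correct linking. -/
def Sound (K : ι → LForm L Λ ℕ) (Θ : Set (Sym2 Λ)) : Prop :=
  Finite ι ∧ ∃ θ : Set (Sym2 (Sequent.Leaf fun i => (K i).1)),
    Sym2.map (fun l => (K l.1).2 l.2) '' θ = Θ ∧ Sequent.Good (fun i => (K i).1) θ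

theorem sound_iff {K : ι → LForm L Λ ℕ} {Θ : Set (Sym2 Λ)} (Γ : Sequent L ι)
    (lab : ∀ i, (Γ i).Leaf → Λ) (h : ∀ i, K i = ⟨Γ i, lab i⟩) :
    Sound K Θ ↔ Finite ι ∧ ∃ θ : Set (Sym2 Γ.Leaf),
      Sym2.map (fun l : Γ.Leaf => lab l.1 l.2) '' θ = Θ ∧ Γ.Good θ := by
  obtain rfl : K = fun i => ⟨Γ i, lab i⟩ := funext h
  exact Iff.rfl

theorem finite_of_option {α : Type} (h : Finite (Option α)) : Finite α :=
  Finite.of_injective (some : α → Option α) (Option.some_injective α)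

theorem Sound.reindex {K : κ → LForm L Λ ℕ} {Θ : Set (Sym2 Λ)} (c : ι → κ)
    (hc : Function.Bijective c) (h : Sound (fun i => K (c i)) Θ) : Sound K Θ := by
  obtain ⟨hfin, θ, hθ, hG⟩ := h
  have := Finite.of_surjective c hc.2
  refine ⟨this, _, ?_, hG.reindex (Γ := fun j => (K j).1) c hc⟩
  rw [← hθ]
  exact image_sym2_map_comp _ _ _ (fun _ => rfl) _

theorem Sound.ax (D : Duality L) (a : Atom L ℕ) (u v : Λ) :
    Sound (lcons (LForm.atom a u) fun _ : Unit => LForm.atom (a.neg D) v) {s(u, v)} := by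
  refine (sound_iff (lcons (.atom a) fun _ : Unit => .atom (a.neg D))
    (fun | none => fun _ => u | some _ => fun _ => v) (by rintro (_ | _) <;> rfl)).2
    ⟨inferInstance, _, ?_, Sequent.Good.ax D a⟩
  exact Set.image_singleton

theorem Sound.par {K : ι → LForm L Λ ℕ} {Θ : Set (Sym2 Λ)} {x y : LForm L Λ ℕ}
    (h : Sound (lcons x (lcons y K)) Θ) : Sound (lcons (x.par y) K) Θ := by
  obtain ⟨hfin, θ, hθ, hG⟩ := (sound_iff (lcons x.1 (lcons y.1 fun i => (K i).1))
    (fun | none => x.2 | some none => y.2 | some (some i) => (K i).2)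
    (by rintro (_ | _ | _) <;> rfl)).1 h
  have := finite_of_option (finite_of_option hfin)
  obtain ⟨f, hf₁, hf₂, hf₃, hG⟩ := hG.par
  set lab : ∀ o, (lcons (x.1.par y.1) (fun i => (K i).1) o).Leaf → Λ :=
    fun | none => Sum.elim x.2 y.2 | some i => (K i).2 with hlab
  refine (sound_iff _ lab (by rintro (_ | _) <;> rfl)).2 ⟨inferInstance, _, ?_, hG⟩
  rw [← hθ]
  refine image_sym2_map_comp _ _ _ ?_ _
  rintro ⟨_ | _ | i, l⟩
  · exact congrArg (fun m : Sequent.Leaf _ => lab m.1 m.2) (hf₁ l)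
  · exact congrArg (fun m : Sequent.Leaf _ => lab m.1 m.2) (hf₂ l)
  · exact congrArg (fun m : Sequent.Leaf _ => lab m.1 m.2) (hf₃ i l)

theorem Sound.tensor {K₁ : ι → LForm L Λ ℕ} {K₂ : κ → LForm L Λ ℕ} {Θ₁ Θ₂ : Set (Sym2 Λ)}
    {x y : LForm L Λ ℕ} (h₁ : Sound (lcons x K₁) Θ₁) (h₂ : Sound (lcons y K₂) Θ₂) :
    Sound (lcons (x.tensor y) (Sum.elim K₁ K₂)) (Θ₁ ∪ Θ₂) := by
  obtain ⟨hfin₁, θ₁, hθ₁, hG₁⟩ := (sound_iff (lcons x.1 fun i => (K₁ i).1)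
    (fun | none => x.2 | some i => (K₁ i).2) (by rintro (_ | _) <;> rfl)).1 h₁
  obtain ⟨hfin₂, θ₂, hθ₂, hG₂⟩ := (sound_iff (lcons y.1 fun i => (K₂ i).1)
    (fun | none => y.2 | some i => (K₂ i).2) (by rintro (_ | _) <;> rfl)).1 h₂
  have := finite_of_option hfin₁
  have := finite_of_option hfin₂
  obtain ⟨f₁, f₂, hf₁, hf₁', hf₂, hf₂', hG⟩ := hG₁.tensor hG₂
  set lab : ∀ o, (lcons (x.1.tensor y.1) (Sum.elim (fun i => (K₁ i).1) fun i => (K₂ i).1) o).Leaf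
      → Λ := fun | none => Sum.elim x.2 y.2 | some (.inl i) => (K₁ i).2 | some (.inr i) => (K₂ i).2
    with hlab
  refine (sound_iff _ lab (by rintro (_ | _ | _) <;> rfl)).2 ⟨inferInstance, _, ?_, hG⟩
  rw [← hθ₁, ← hθ₂, Set.image_union]
  congr 1
  · refine image_sym2_map_comp _ _ _ ?_ _
    rintro ⟨_ | i, l⟩
    · exact congrArg (fun m : Sequent.Leaf _ => lab m.1 m.2) (hf₁ l)
    · exact congrArg (fun m : Sequent.Leaf _ => lab m.1 m.2) (hf₁' i l)
  · refine image_sym2_map_comp _ _ _ ?_ _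
    rintro ⟨_ | i, l⟩
    · exact congrArg (fun m : Sequent.Leaf _ => lab m.1 m.2) (hf₂ l)
    · exact congrArg (fun m : Sequent.Leaf _ => lab m.1 m.2) (hf₂' i l)

theorem Sound.ex {K : ι → LForm L Λ ℕ} {Θ : Set (Sym2 Λ)} {x : LForm L Λ (Option ℕ)} (t : L.Term ℕ)
    (h : Sound (lcons (x.inst t) K) Θ) : Sound (lcons x.ex K) Θ := by
  obtain ⟨hfin, θ, hθ, hG⟩ := (sound_iff (lcons (x.1.inst t) fun i => (K i).1)
    (fun | none => x.2 ∘ x.1.leafSubst _ | some i => (K i).2) (by rintro (_ | _) <;> rfl)).1 h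
  have := finite_of_option hfin
  obtain ⟨f, hf₁, hf₂, hG⟩ := hG.ex
  set lab : ∀ o, (lcons (Formula.ex x.1) (fun i => (K i).1) o).Leaf → Λ :=
    fun | none => x.2 | some i => (K i).2 with hlab
  refine (sound_iff _ lab (by rintro (_ | _) <;> rfl)).2 ⟨inferInstance, _, ?_, hG⟩
  rw [← hθ]
  refine image_sym2_map_comp _ _ _ ?_ _
  rintro ⟨_ | i, l⟩
  · exact congrArg (fun m : Sequent.Leaf _ => lab m.1 m.2) (hf₁ l)
  · exact congrArg (fun m : Sequent.Leaf _ => lab m.1 m.2) (hf₂ i l)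

theorem Sound.all {K : ι → LForm L Λ ℕ} {Θ : Set (Sym2 Λ)} {x : LForm L Λ (Option ℕ)} (y : ℕ)
    (hx : y ∉ x.all.1.freeVars) (hK : ∀ i, y ∉ (K i).1.freeVars)
    (h : Sound (lcons (x.inst (.var y)) K) Θ) : Sound (lcons x.all K) Θ := by
  obtain ⟨hfin, θ, hθ, hG⟩ := (sound_iff (lcons (x.1.inst (.var y)) fun i => (K i).1)
    (fun | none => x.2 ∘ x.1.leafSubst _ | some i => (K i).2) (by rintro (_ | _) <;> rfl)).1 h
  have := finite_of_option hfin
  obtain ⟨f, hf₁, hf₂, hG⟩ := hG.all hx hK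
  set lab : ∀ o, (lcons (Formula.all x.1) (fun i => (K i).1) o).Leaf → Λ :=
    fun | none => x.2 | some i => (K i).2 with hlab
  refine (sound_iff _ lab (by rintro (_ | _) <;> rfl)).2 ⟨inferInstance, _, ?_, hG⟩
  rw [← hθ]
  refine image_sym2_map_comp _ _ _ ?_ _
  rintro ⟨_ | i, l⟩
  · exact congrArg (fun m : Sequent.Leaf _ => lab m.1 m.2) (hf₁ l)
  · exact congrArg (fun m : Sequent.Leaf _ => lab m.1 m.2) (hf₂ i l)

/-- One ∃ rule for each variable of the list, with the value of σ as its term, rebuilds the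
quantifier prefix of an encoded cut. -/
theorem Sound.exs {K : ι → LForm L Λ ℕ} {Θ : Set (Sym2 Λ)} (xs : List ℕ) (T : Formula L ℕ)
    (lab : T.Leaf → Λ) (σ : ℕ → L.Term ℕ) (h : Sound (lcons (LForm.subst ⟨T, lab⟩ σ) K) Θ) :
    Sound (lcons (LForm.subst
      ⟨Formula.exs xs T, fun l => lab ((Formula.leafExs xs T).symm l)⟩ σ) K) Θ := by
  induction xs with
  | nil => exact h
  | cons y ys ih =>
    refine Sound.ex (x := LForm.subst (LForm.subst ⟨Formula.exs ys T,
      fun l => lab ((Formula.leafExs ys T).symm l)⟩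
        fun z => if z = y then .var none else .var (some z)) (liftSubst σ)) (σ y) ?_
    convert ih using 2
    rw [LForm.inst, LForm.subst_subst, LForm.subst_subst]
    congr 1
    funext z
    by_cases hz : z = y
    · simp [hz, Term.subst, liftSubst]
    · simp [hz, Term.subst, liftSubst, term_relabel_eq_subst, term_subst_subst]

/-- The encoding of a labelled component. -/
noncomputable def LItem.encode (k : LItem D Λ) : LForm L Λ ℕ :=
  ⟨k.1.encode D, fun l => k.2 ((k.1.encodeLeaf D).symm l)⟩

theorem freeVars_encode (I : Item L) : (I.encode D).freeVars = I.freeVars := by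
  cases I with
  | formula A => rfl
  | cut A => exact Formula.freeVars_exs_sort D A

theorem LItem.encode_cut (A : Formula L ℕ) (lab : A.Leaf ⊕ (A.neg D).Leaf → Λ)
    (σ : ℕ → L.Term ℕ) : (LItem.cut A lab).encode = LForm.subst
      ⟨Formula.exs (A.freeVars.sort (· ≤ ·)) (.tensor A (A.neg D)),
        fun l => lab ((Formula.leafExs _ (.tensor A (A.neg D))).symm l)⟩ σ := by
  refine (LForm.subst_var _).symm.trans (LForm.subst_congr fun y hy => ?_)
  rw [show (LItem.cut A lab).encode.1.freeVars = ∅ from Formula.freeVars_exs_sort D A] at hy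
  exact absurd hy (Finset.notMem_empty y)

/-- The labelling is arbitrary so that the induction hypothesis can be used with labels pulled back
along the tracking map of the last rule. -/
theorem Proof.sound {Δ : CutSequent L ι} (π : Proof D Δ) (lab : ∀ i, (Δ i).Leaf D → Λ) :
    Sound (fun i => LItem.encode ⟨Δ i, lab i⟩)
      (Sym2.map (fun l : Δ.Leaf D => lab l.1 l.2) '' π.translate) := by
  induction π with
  | reindex e Γ π ih =>
    refine Sound.reindex e e.bijective ?_
    convert ih fun i => lab (e i) using 1
    exact image_sym2_map_comp _ _ _ (fun _ => rfl) _
  | ax a =>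
    convert Sound.ax D a (lab none ()) (lab (some ()) ()) using 1
    · funext o
      rcases o with _ | _ <;> rfl
    · exact Set.image_singleton
  | par Γ A B π ih =>
    have h := ih fun o l => lab (Track.par Γ A B ⟨o, l⟩).1 (Track.par Γ A B ⟨o, l⟩).2
    convert Sound.par (x := ⟨A, fun l => lab none (Sum.inl l)⟩)
      (y := ⟨B, fun l => lab none (Sum.inr l)⟩)
      (K := fun i => LItem.encode ⟨Γ i, lab (some i)⟩) ?_ using 1
    · funext o
      rcases o with _ | _
      · refine Sigma.ext rfl (heq_of_eq ?_)
        funext l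
        rcases l with l | l <;> rfl
      · rfl
    · convert h using 1
      · funext o
        rcases o with _ | _ | _ <;> rfl
      · exact image_sym2_map_comp _ _ _ (fun _ => rfl) _
  | tensor Γ Δ A B π₁ π₂ ih₁ ih₂ =>
    have h₁ := ih₁ fun o l => lab (Track.tensorLeft Γ Δ A B ⟨o, l⟩).1
      (Track.tensorLeft Γ Δ A B ⟨o, l⟩).2
    have h₂ := ih₂ fun o l => lab (Track.tensorRight Γ Δ A B ⟨o, l⟩).1
      (Track.tensorRight Γ Δ A B ⟨o, l⟩).2
    have := Sound.tensor (x := ⟨A, fun l => lab none (Sum.inl l)⟩)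
      (y := ⟨B, fun l => lab none (Sum.inr l)⟩)
      (K₁ := fun i => LItem.encode ⟨Γ i, lab (some (.inl i))⟩)
      (K₂ := fun i => LItem.encode ⟨Δ i, lab (some (.inr i))⟩)
      (by
        convert h₁ using 1
        funext o
        rcases o with _ | _ <;> rfl)
      (by
        convert h₂ using 1
        funext o
        rcases o with _ | _ <;> rfl)
    convert this using 1
    · funext o
      rcases o with _ | _ | _
      · refine Sigma.ext rfl (heq_of_eq ?_)
        funext l
        rcases l with l | l <;> rfl
      · rfl
      · rfl
    · rw [Proof.translate, Set.image_union]
      congr 1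
      · exact image_sym2_map_comp _ _ _ (fun _ => rfl) _
      · exact image_sym2_map_comp _ _ _ (fun _ => rfl) _
  | ex Γ A t π ih =>
    have h := ih fun o l => lab (Track.ex Γ A t ⟨o, l⟩).1 (Track.ex Γ A t ⟨o, l⟩).2
    convert Sound.ex (x := ⟨A, lab none⟩) (K := fun i => LItem.encode ⟨Γ i, lab (some i)⟩) t ?_
      using 1
    · funext o
      rcases o with _ | _ <;> rfl
    · convert h using 1
      · funext o
        rcases o with _ | _ <;> rfl
      · exact image_sym2_map_comp _ _ _ (fun _ => rfl) _
  | all Γ A x hA hΓ π ih =>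
    have h := ih fun o l => lab (Track.all Γ A x ⟨o, l⟩).1 (Track.all Γ A x ⟨o, l⟩).2
    convert Sound.all (x := ⟨A, lab none⟩) (K := fun i => LItem.encode ⟨Γ i, lab (some i)⟩) x hA
      (fun i => by
        have := hΓ i
        rwa [← freeVars_encode (D := D)] at this) ?_ using 1
    · funext o
      rcases o with _ | _ <;> rfl
    · convert h using 1
      · funext o
        rcases o with _ | _ <;> rfl
      · exact image_sym2_map_comp _ _ _ (fun _ => rfl) _
  | cut Γ Δ A σ π₁ π₂ ih₁ ih₂ =>
    have h₁ := ih₁ fun o l => lab (Track.cutLeft Γ Δ A σ ⟨o, l⟩).1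
      (Track.cutLeft Γ Δ A σ ⟨o, l⟩).2
    have h₂ := ih₂ fun o l => lab (Track.cutRight Γ Δ A σ ⟨o, l⟩).1
      (Track.cutRight Γ Δ A σ ⟨o, l⟩).2
    -- On encodings a cut is a tensor of the instantiated cut formulas followed by ∃ rules. The
    -- result carries σ, which is harmless since the encoding of a cut is closed.
    have h := Sound.tensor (x := LForm.subst ⟨A, fun l => lab none (Sum.inl l)⟩ σ)
      (y := LForm.subst ⟨A.neg D, fun l => lab none (Sum.inr l)⟩ σ)
      (K₁ := fun i => LItem.encode ⟨Γ i, lab (some (.inl i))⟩)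
      (K₂ := fun i => LItem.encode ⟨Δ i, lab (some (.inr i))⟩)
      (by
        convert h₁ using 1
        funext o
        rcases o with _ | _ <;> rfl)
      (by
        convert h₂ using 1
        funext o
        rcases o with _ | _ <;> rfl)
    rw [← LForm.subst_tensor] at h
    have := Sound.exs (A.freeVars.sort (· ≤ ·)) _ _ σ h
    convert this using 1
    · funext o
      rcases o with _ | _ | _
      · refine (LItem.encode_cut A (lab none) σ).trans ?_
        refine congrArg (fun x => LForm.subst x σ) (Sigma.ext rfl (heq_of_eq ?_))
        funext l
        exact (congrFun (Sum.elim_comp_inl_inr (α := A.Leaf) (β := (A.neg D).Leaf) (lab none))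
          ((Formula.leafExs (A.freeVars.sort (· ≤ ·)) (.tensor A (A.neg D))).symm l)).symm
      · rfl
      · rfl
    · rw [Proof.translate, Set.image_union]
      congr 1
      · exact image_sym2_map_comp _ _ _ (fun _ => rfl) _
      · exact image_sym2_map_comp _ _ _ (fun _ => rfl) _

theorem Proof.correct [Finite ι] {Δ : CutSequent L ι} (π : Proof D Δ) :
    (Δ.encode D).Correct (Sym2.map (Δ.encodeLeaf D) '' π.translate) := by
  obtain ⟨-, θ, hθ, hG⟩ := (sound_iff (Δ.encode D) (fun i l => (⟨i, l⟩ : (Δ.encode D).Leaf))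
    fun i => by
      refine Sigma.ext rfl (heq_of_eq (funext fun l => ?_))
      exact congrArg (fun l => (⟨i, l⟩ : (Δ.encode D).Leaf))
        (((Δ i).encodeLeaf D).apply_symm_apply l)).1
    (π.sound fun i l => Δ.encodeLeaf D ⟨i, l⟩)
  have hθ : θ = Sym2.map (Δ.encodeLeaf D) '' π.translate := by
    refine Eq.trans ?_ hθ
    have : (fun l : (Δ.encode D).Leaf => (⟨l.1, l.2⟩ : (Δ.encode D).Leaf)) = id := rfl
    rw [this, Sym2.map_id, Set.image_id]
  rw [← hθ]
  exact hG.correct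

end Sound

end FOMLL

/-! ### Translations of proofs are linkings. -/

namespace FOMLL

open FirstOrder.Language (Term)

section IsLinking

variable {L : FirstOrder.Language.{u, v}} {D : Duality L} {ι ι₁ ι₂ κ : Type}

theorem PredSym.IsDual.symm {p q : PredSym L} (h : p.IsDual D q) : q.IsDual D p := by
  obtain ⟨n, P⟩ := p
  rw [IsDual] at h
  subst h
  rw [IsDual, D.dual_dual]

namespace CutSequent

theorem IsLinking.image {Δ : CutSequent L ι} {Δ' : CutSequent L κ} {θ : Set (Sym2 (Δ.Leaf D))}
    (h : Δ.IsLinking D θ) {f : Δ.Leaf D → Δ'.Leaf D} (hf : Function.Bijective f)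
    (hp : ∀ l, (Δ' (f l).1).leafPred D (f l).2 = (Δ l.1).leafPred D l.2) :
    Δ'.IsLinking D (Sym2.map f '' θ) where
  dual := by
    rintro l l' ⟨e, he, hel⟩
    induction e with
    | _ k k' =>
      have := h.dual k k' he
      rw [← hp, ← hp] at this
      rcases Sym2.eq_iff.1 hel with ⟨rfl, rfl⟩ | ⟨rfl, rfl⟩
      · exact this
      · exact this.symm
  cover l := by
    obtain ⟨k, rfl⟩ := hf.2 l
    obtain ⟨e, ⟨he, hl⟩, hu⟩ := h.cover k
    refine ⟨_, ⟨⟨e, he, rfl⟩, Sym2.mem_map.2 ⟨_, hl, rfl⟩⟩, ?_⟩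
    rintro _ ⟨⟨e', he', rfl⟩, hm⟩
    obtain ⟨k', hk', hkk⟩ := Sym2.mem_map.1 hm
    obtain rfl := hf.1 hkk
    rw [hu e' ⟨he', hk'⟩]

theorem IsLinking.union {Δ₁ : CutSequent L ι₁} {Δ₂ : CutSequent L ι₂} {Δ' : CutSequent L κ}
    {θ₁ : Set (Sym2 (Δ₁.Leaf D))} {θ₂ : Set (Sym2 (Δ₂.Leaf D))}
    (h₁ : Δ₁.IsLinking D θ₁) (h₂ : Δ₂.IsLinking D θ₂) {f₁ : Δ₁.Leaf D → Δ'.Leaf D}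
    {f₂ : Δ₂.Leaf D → Δ'.Leaf D} (hf : Function.Bijective (Sum.elim f₁ f₂))
    (hp₁ : ∀ l, (Δ' (f₁ l).1).leafPred D (f₁ l).2 = (Δ₁ l.1).leafPred D l.2)
    (hp₂ : ∀ l, (Δ' (f₂ l).1).leafPred D (f₂ l).2 = (Δ₂ l.1).leafPred D l.2) :
    Δ'.IsLinking D (Sym2.map f₁ '' θ₁ ∪ Sym2.map f₂ '' θ₂) where
  dual := by
    rintro l l' (⟨e, he, hel⟩ | ⟨e, he, hel⟩)
    · induction e with
      | _ k k' =>
        have := h₁.dual k k' he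
        rw [← hp₁, ← hp₁] at this
        rcases Sym2.eq_iff.1 hel with ⟨rfl, rfl⟩ | ⟨rfl, rfl⟩
        · exact this
        · exact this.symm
    · induction e with
      | _ k k' =>
        have := h₂.dual k k' he
        rw [← hp₂, ← hp₂] at this
        rcases Sym2.eq_iff.1 hel with ⟨rfl, rfl⟩ | ⟨rfl, rfl⟩
        · exact this
        · exact this.symm
  cover l := by
    have hne : ∀ l l', f₁ l ≠ f₂ l' := fun l l' h => by
      cases hf.1 (show Sum.elim f₁ f₂ (.inl l) = Sum.elim f₁ f₂ (.inr l') from h)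
    have hf₁ : Function.Injective f₁ := hf.1.comp Sum.inl_injective
    have hf₂ : Function.Injective f₂ := hf.1.comp Sum.inr_injective
    obtain ⟨k | k, hl⟩ := hf.2 l
    · obtain ⟨e, ⟨he, hk⟩, hu⟩ := h₁.cover k
      refine ⟨_, ⟨.inl ⟨e, he, rfl⟩, Sym2.mem_map.2 ⟨_, hk, hl⟩⟩, ?_⟩
      rintro _ ⟨⟨e', he', rfl⟩ | ⟨e', he', rfl⟩, hm⟩
      · obtain ⟨k', hk', rfl⟩ := Sym2.mem_map.1 hm
        obtain rfl := hf₁ hl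
        rw [hu e' ⟨he', hk'⟩]
      · obtain ⟨k', hk', rfl⟩ := Sym2.mem_map.1 hm
        exact absurd hl (hne _ _)
    · obtain ⟨e, ⟨he, hk⟩, hu⟩ := h₂.cover k
      refine ⟨_, ⟨.inr ⟨e, he, rfl⟩, Sym2.mem_map.2 ⟨_, hk, hl⟩⟩, ?_⟩
      rintro _ ⟨⟨e', he', rfl⟩ | ⟨e', he', rfl⟩, hm⟩
      · obtain ⟨k', hk', rfl⟩ := Sym2.mem_map.1 hm
        exact absurd hl.symm (hne _ _)
      · obtain ⟨k', hk', rfl⟩ := Sym2.mem_map.1 hm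
        obtain rfl := hf₂ hl
        rw [hu e' ⟨he', hk'⟩]

end CutSequent

/-- The tracking maps of a rule together form a bijection from the leaves of its hypotheses to those
of its conclusion, preserving predicate symbols. The inverse `g` is written out in each logical
case. -/
theorem Proof.isLinking {Δ : CutSequent L ι} (π : Proof D Δ) : Δ.IsLinking D π.translate := by
  induction π with
  | reindex e Γ π ih =>
    exact ih.image (Equiv.sigmaCongrLeft (β := fun j => (Γ j).Leaf D) e).bijective fun _ => rfl
  | ax a =>
    have hd : PredSym.IsDual D (⟨a.arity, a.pred⟩ : PredSym L) ⟨a.arity, D.dual a.pred⟩ := rfl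
    refine ⟨?_, ?_⟩
    · intro l l' h
      rcases Sym2.eq_iff.1 (Set.mem_singleton_iff.1 h) with ⟨rfl, rfl⟩ | ⟨rfl, rfl⟩
      · exact hd
      · exact hd.symm
    · rintro ⟨_ | _, l⟩
      · exact ⟨_, ⟨rfl, Sym2.mem_mk_left _ _⟩, fun e he => he.1⟩
      · exact ⟨_, ⟨rfl, Sym2.mem_mk_right _ _⟩, fun e he => he.1⟩
  | par Γ A B π ih =>
    let g : (CutSequent.cons (.formula (.par A B)) Γ).Leaf D →
        (CutSequent.cons (.formula A) (CutSequent.cons (.formula B) Γ)).Leaf D := fun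
      | ⟨none, Sum.inl l⟩ => ⟨none, l⟩
      | ⟨none, Sum.inr l⟩ => ⟨some none, l⟩
      | ⟨some i, l⟩ => ⟨some (some i), l⟩
    refine ih.image (Function.bijective_iff_has_inverse.2 ⟨g, ?_, ?_⟩) ?_
    · rintro ⟨_ | _ | i, l⟩ <;> rfl
    · rintro ⟨_ | i, l⟩
      · rcases l with l | l <;> rfl
      · rfl
    · rintro ⟨_ | _ | i, l⟩ <;> rfl
  | tensor Γ Δ A B π₁ π₂ ih₁ ih₂ =>
    let g : (CutSequent.cons (.formula (.tensor A B)) (CutSequent.append Γ Δ)).Leaf D →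
        (CutSequent.cons (.formula A) Γ).Leaf D ⊕ (CutSequent.cons (.formula B) Δ).Leaf D := fun
      | ⟨none, Sum.inl l⟩ => .inl ⟨none, l⟩
      | ⟨none, Sum.inr l⟩ => .inr ⟨none, l⟩
      | ⟨some (.inl i), l⟩ => .inl ⟨some i, l⟩
      | ⟨some (.inr i), l⟩ => .inr ⟨some i, l⟩
    refine ih₁.union ih₂ (Function.bijective_iff_has_inverse.2 ⟨g, ?_, ?_⟩) ?_ ?_
    · rintro (⟨_ | i, l⟩ | ⟨_ | i, l⟩) <;> rfl
    · rintro ⟨_ | i | i, l⟩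
      · rcases l with l | l <;> rfl
      · rfl
      · rfl
    · rintro ⟨_ | i, l⟩ <;> rfl
    · rintro ⟨_ | i, l⟩ <;> rfl
  | ex Γ A t π ih =>
    let g : (CutSequent.cons (.formula (.ex A)) Γ).Leaf D →
        (CutSequent.cons (.formula (A.inst t)) Γ).Leaf D := fun
      | ⟨none, l⟩ => ⟨none, (A.leafSubst _).symm l⟩
      | ⟨some i, l⟩ => ⟨some i, l⟩
    refine ih.image (Function.bijective_iff_has_inverse.2 ⟨g, ?_, ?_⟩) ?_
    · rintro ⟨_ | i, l⟩
      · exact congrArg (Sigma.mk none) (Equiv.symm_apply_apply _ l)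
      · rfl
    · rintro ⟨_ | i, l⟩
      · exact congrArg (Sigma.mk none) (Equiv.apply_symm_apply (A.leafSubst _) l)
      · rfl
    · rintro ⟨_ | i, l⟩
      · exact A.leafPred_leafSubst _ l
      · rfl
  | all Γ A x _ _ π ih =>
    let g : (CutSequent.cons (.formula (.all A)) Γ).Leaf D →
        (CutSequent.cons (.formula (A.inst (.var x))) Γ).Leaf D := fun
      | ⟨none, l⟩ => ⟨none, (A.leafSubst _).symm l⟩
      | ⟨some i, l⟩ => ⟨some i, l⟩
    refine ih.image (Function.bijective_iff_has_inverse.2 ⟨g, ?_, ?_⟩) ?_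
    · rintro ⟨_ | i, l⟩
      · exact congrArg (Sigma.mk none) (Equiv.symm_apply_apply _ l)
      · rfl
    · rintro ⟨_ | i, l⟩
      · exact congrArg (Sigma.mk none) (Equiv.apply_symm_apply (A.leafSubst _) l)
      · rfl
    · rintro ⟨_ | i, l⟩
      · exact A.leafPred_leafSubst _ l
      · rfl
  | cut Γ Δ A σ π₁ π₂ ih₁ ih₂ =>
    let g : (CutSequent.cons (.cut A) (CutSequent.append Γ Δ)).Leaf D →
        (CutSequent.cons (.formula (A.subst σ)) Γ).Leaf D ⊕
          (CutSequent.cons (.formula ((A.neg D).subst σ)) Δ).Leaf D := fun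
      | ⟨none, Sum.inl l⟩ => .inl ⟨none, (A.leafSubst σ).symm l⟩
      | ⟨none, Sum.inr l⟩ => .inr ⟨none, ((A.neg D).leafSubst σ).symm l⟩
      | ⟨some (.inl i), l⟩ => .inl ⟨some i, l⟩
      | ⟨some (.inr i), l⟩ => .inr ⟨some i, l⟩
    refine ih₁.union ih₂ (Function.bijective_iff_has_inverse.2 ⟨g, ?_, ?_⟩) ?_ ?_
    · rintro (⟨_ | i, l⟩ | ⟨_ | i, l⟩)
      · exact congrArg (fun l => Sum.inl (⟨none, l⟩ : CutSequent.Leaf D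
          (CutSequent.cons (.formula (A.subst σ)) Γ)))
            (Equiv.symm_apply_apply (A.leafSubst σ) l)
      · rfl
      · exact congrArg (fun l => Sum.inr (⟨none, l⟩ : CutSequent.Leaf D
          (CutSequent.cons (.formula ((A.neg D).subst σ)) Δ)))
            (Equiv.symm_apply_apply ((A.neg D).leafSubst σ) l)
      · rfl
    · rintro ⟨_ | i | i, l⟩
      · rcases l with l | l
        · exact congrArg (fun l => (⟨none, Sum.inl l⟩ : CutSequent.Leaf D
            (CutSequent.cons (.cut A) (CutSequent.append Γ Δ))))
              (Equiv.apply_symm_apply (A.leafSubst σ) l)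
        · exact congrArg (fun l => (⟨none, Sum.inr l⟩ : CutSequent.Leaf D
            (CutSequent.cons (.cut A) (CutSequent.append Γ Δ))))
              (Equiv.apply_symm_apply ((A.neg D).leafSubst σ) l)
      · rfl
      · rfl
    · rintro ⟨_ | i, l⟩
      · exact A.leafPred_leafSubst σ l
      · rfl
    · rintro ⟨_ | i, l⟩
      · exact (A.neg D).leafPred_leafSubst σ l
      · rfl

end IsLinking

end FOMLL

theorem mainTheorem7 (L : FirstOrder.Language.{u, v}) (D : FOMLL.Duality L)
    {ι : Type} [Finite ι] (Δ : FOMLL.CutSequent L ι) :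
    Set.range (fun π : FOMLL.Proof D Δ => π.translate) = {θ | Δ.IsUnificationNet D θ} := by
  ext θ
  constructor
  · rintro ⟨π, rfl⟩
    exact ⟨π.isLinking, π.correct⟩
  · exact fun h => h.exists_translate_eq
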